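/- A hypergraph $\mathcal H$ consists of a finite set $\mathit{nodes}(\mathcal H)$ and a set $\mathit{edges}(\mathcal H)$ of subsets of it whose union is $\mathit{nodes}(\mathcal H)$. For a set $S$ of nodes, an $[S]$-path is a finite sequence of nodes $X_0,\dots,X_\ell$ ($\ell\ge 0$) such that each $\{X_i,X_{i+1}\}$ is contained in $h\setminus S$ for some hyperedge $h$; a set $W$ is $[S]$-connected if any two members of $W$ are joined by an $[S]$-path, and an $[S]$-component is a maximal $[S]$-connected non-empty subset of $\mathit{nodes}(\mathcal H)\setminus S$. The frontier $\mathrm{Fr}(C)$ of a set $C$ of nodes of $\mathcal H_1$ is the union of the hyperedges of $\mathcal H_1$ that meet $C$. Let $(\mathcal H_1,\mathcal H_2)$ be a pair of hypergraphs; components and connectedness below refer to $\mathcal H_1$. A strategy $\sigma$ of the Captain in the Robber and Captain game on $(\mathcal H_1,\mathcal H_2)$ assigns to each configuration $v_p=(h_p,M_p,C_p)$ in its domain a pair $\sigma(v_p)=(h_r,M_r)$ with $h_r\in\mathit{edges}(\mathcal H_2)$ and $M_r\subseteq h_r\cap\mathrm{Fr}(C_p)$. The options of the Robber are then the $[M_r]$-components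 $C_r$ such that $C_p\cup C_r$ is $[M_p\cap M_r]$-connected. The domain of $\sigma$ is the smallest set that contains the initial configuration $(\emptyset,\emptyset,\mathit{nodes}(\mathcal H_1))$ and, with each $v_p$, all $(h_r,M_r,C_r)$ where $C_r$ is an option of the Robber. The strategy graph of $\sigma$ has arcs from each $v_p$ in the domain to all these $(h_r,M_r,C_r)$, or to the capture configuration $(h_r,M_r,\emptyset)$ if the Robber has no option. The strategy $\sigma$ is winning if its strategy graph has no directed cycle. It is greedy if, for each $v_p$ in its domain, $M_r=h_r\cap\mathrm{Fr}(C_p)$, and $h_r=h_p$ whenever $h_p\cap C_p\neq\emptyset$. **Theorem.** The following problem is decidable in polynomial time: given a pair $(\mathcal H_1,\mathcal H_2)$ of hypergraphs, does the Captain have a greedy winning strategy in the Robber and Captain game on $(\mathcal H_1,\mathcal H_2)$? More precisely, there are a deterministic multi-stack Turing machine and a polynomial $p$ such that, for every pair of hypergraphs with nodes among $0,\dots,n-1$, encoded by $n$ in unary and by the two incidence matrices (one 0/1 row of length $n$ for each listed hyperedge), the machine halts on the encoding $w$ after at most $p(|w|)$ steps and outputs the correct answer. -/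

import Mathlib

namespace RobberCaptain

open scoped Hypergraph

section Connectivity

variable {V : Type*}

/-- `X` is `[S]`-adjacent to `Y` in `H`: some hyperedge `h` satisfies `{X, Y} ⊆ h - S`. -/
def AdjOff (H : Hypergraph V) (S : Set V) (X Y : V) : Prop :=
  ∃ h ∈ E(H), X ∈ h \ S ∧ Y ∈ h \ S

/-- There is an `[S]`-path from `X` to `Y`: a finite sequence of nodes (possibly of length zero)
whose consecutive members are `[S]`-adjacent. -/
def HasPathOff (H : Hypergraph V) (S : Set V) (X Y : V) : Prop :=
  Relation.ReflTransGen (AdjOff H S) X Y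

/-- `W` is `[S]`-connected. -/
def ConnectedOff (H : Hypergraph V) (S W : Set V) : Prop :=
  ∀ X ∈ W, ∀ Y ∈ W, HasPathOff H S X Y

/-- `C` is an `[S]`-component of `H`: a maximal `[S]`-connected non-empty subset of
`nodes(H) - S`. -/
def IsComponentOff (H : Hypergraph V) (S C : Set V) : Prop :=
  Maximal (fun W : Set V => W.Nonempty ∧ W ⊆ V(H) \ S ∧ ConnectedOff H S W) C

/-- The frontier of `C` in `H`: the union of all hyperedges of `H` that meet `C`. -/
def frontierOf (H : Hypergraph V) (C : Set V) : Set V :=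
  {x | ∃ h ∈ E(H), (h ∩ C).Nonempty ∧ x ∈ h}

end Connectivity

section Game

/-- A position `(h, M)` of the Captain: a squad `h` and the set `M` of cops in action. -/
structure Position (V : Type*) where
  /-- the squad, a hyperedge of the second hypergraph -/
  squad : Set V
  /-- the cops of the squad that are in action -/
  cops : Set V

/-- A configuration `(h, M, C)`: a position of the Captain, and the set of nodes in which the
Robber is free to move (empty if the Robber is captured). -/
structure Config (V : Type*) extends Position V where
  /-- the component where the Robber stands -/
  robber : Set V

variable {V : Type*}

/-- The initial configuration `(∅, ∅, nodes(H₁))`. -/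
def initialConfig (H₁ : Hypergraph V) : Config V :=
  ⟨⟨∅, ∅⟩, V(H₁)⟩

/-- `C` is a `[v, M]`-option of the Robber: `C` is an `[M]`-component of `H₁` such that
`C_p ∪ C` is `[M_p ∩ M]`-connected, where `v = (h_p, M_p, C_p)`. -/
def IsOption (H₁ : Hypergraph V) (v : Config V) (M C : Set V) : Prop :=
  IsComponentOff H₁ M C ∧ ConnectedOff H₁ (v.cops ∩ M) (v.robber ∪ C)

/-- The domain of the strategy with move function `σ`: it contains the initial configuration, and
with each configuration `v` all the configurations `(h_r, M_r, C_r)` where `σ v = (h_r, M_r)` and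
`C_r` is a `[v, M_r]`-option of the Robber; nothing else is in it. The values of `σ` outside this
domain play no role. -/
inductive Dom (H₁ : Hypergraph V) (σ : Config V → Position V) : Config V → Prop
  | init : Dom H₁ σ (initialConfig H₁)
  | move (v : Config V) (C : Set V) (hv : Dom H₁ σ v) (hC : IsOption H₁ v (σ v).cops C) :
      Dom H₁ σ ⟨σ v, C⟩

/-- `σ` is a strategy of the Captain on `(H₁, H₂)`: on its domain, `σ v = (h_r, M_r)` with `h_r` a
hyperedge of `H₂` and `M_r ⊆ h_r ∩ Fr(C_p)`. -/
def IsStrategy (H₁ H₂ : Hypergraph V) (σ : Config V → Position V) : Prop :=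
  ∀ v, Dom H₁ σ v →
    (σ v).squad ∈ E(H₂) ∧ (σ v).cops ⊆ (σ v).squad ∩ frontierOf H₁ v.robber

/-- The arcs of the strategy graph: from each configuration `v` in the domain, with
`σ v = (h_r, M_r)`, to `(h_r, M_r, C_r)` for each option `C_r` of the Robber, and to the capture
configuration `(h_r, M_r, ∅)` if the Robber has no option. -/
def Arc (H₁ : Hypergraph V) (σ : Config V → Position V) (v w : Config V) : Prop :=
  Dom H₁ σ v ∧ w.toPosition = σ v ∧
    (IsOption H₁ v (σ v).cops w.robber ∨
      ((∀ C, ¬ IsOption H₁ v (σ v).cops C) ∧ w.robber = ∅))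

/-- `σ` is winning for the Captain: its strategy graph has no directed cycle. -/
def IsWinning (H₁ : Hypergraph V) (σ : Config V → Position V) : Prop :=
  ∀ v, ¬ Relation.TransGen (Arc H₁ σ) v v

/-- `σ` is greedy: for each configuration `v = (h_p, M_p, C_p)` in its domain,
`σ v = (h_r, M_r)` with `M_r = h_r ∩ Fr(C_p)`, where `h_r = h_p` whenever `h_p ∩ C_p ≠ ∅`. -/
def IsGreedy (H₁ : Hypergraph V) (σ : Config V → Position V) : Prop :=
  ∀ v, Dom H₁ σ v →
    (σ v).cops = (σ v).squad ∩ frontierOf H₁ v.robber ∧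
      ((v.squad ∩ v.robber).Nonempty → (σ v).squad = v.squad)

/-- The Captain has a greedy winning strategy in the Robber and Captain game on `(H₁, H₂)`. -/
def HasGreedyWinningStrategy (H₁ H₂ : Hypergraph V) : Prop :=
  ∃ σ : Config V → Position V, IsStrategy H₁ H₂ σ ∧ IsGreedy H₁ σ ∧ IsWinning H₁ σ

end Game

section Inputs

/-- The hypergraph whose hyperedges are the members of the list `L`, and whose nodes are the
elements of its hyperedges. -/
def hypergraphOf {n : ℕ} (L : List (Finset (Fin n))) : Hypergraph (Fin n) where
  vertexSet := {x | ∃ h ∈ L, x ∈ h}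
  edgeSet := {e | ∃ h ∈ L, (h : Set (Fin n)) = e}
  subset_vertexSet_of_mem_edgeSet' := by
    rintro _ ⟨h, hh, rfl⟩ x hx
    exact ⟨h, hh, by simpa using hx⟩

/-- An input of the decision problem: a pair of finite hypergraphs with nodes among
`0, …, n - 1`, each one given by a list of its hyperedges (in any order, repetitions allowed). -/
structure Instance where
  /-- the number of available node names -/
  n : ℕ
  /-- the hyperedges of the first hypergraph -/
  edges₁ : List (Finset (Fin n))
  /-- the hyperedges of the second hypergraph -/
  edges₂ : List (Finset (Fin n))

/-- The first hypergraph of an input. -/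
def Instance.H₁ (I : Instance) : Hypergraph (Fin I.n) := hypergraphOf I.edges₁

/-- The second hypergraph of an input. -/
def Instance.H₂ (I : Instance) : Hypergraph (Fin I.n) := hypergraphOf I.edges₂

/-- Every hypergraph on finitely many nodes, each of which occurs in some hyperedge, is given by a
list of hyperedges. -/
theorem exists_hypergraphOf_eq {n : ℕ} (H : Hypergraph (Fin n)) (hH : V(H) = ⋃₀ E(H)) :
    ∃ L, hypergraphOf L = H := by
  classical
  obtain ⟨L, hL⟩ : ∃ L : List (Finset (Fin n)), ∀ h, h ∈ L ↔ (h : Set (Fin n)) ∈ E(H) :=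
    ⟨(Finset.univ.filter fun h : Finset (Fin n) => (h : Set (Fin n)) ∈ E(H)).toList, by simp⟩
  refine ⟨L, Hypergraph.ext (Set.ext fun x => ?_) (Set.ext fun e => ?_)⟩
  · refine ⟨fun ⟨h, hh, hx⟩ => ?_, fun hx => ?_⟩
    · exact H.subset_vertexSet_of_mem_edgeSet' ((hL h).1 hh) (by simpa using hx)
    · rw [hH] at hx
      obtain ⟨e, he, hx⟩ := hx
      exact ⟨e.toFinset, (hL _).2 (by simpa using he), by simpa using hx⟩
  · refine ⟨?_, fun he => ⟨e.toFinset, (hL _).2 (by simpa using he), by simp⟩⟩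
    rintro ⟨h, hh, rfl⟩
    exact (hL h).1 hh

/-- The tape symbols of encoded inputs. -/
inductive Sym
  | zero
  | one
  | comma
  | semicolon
  deriving DecidableEq

/-- The row of an incidence matrix that belongs to `h`: its characteristic 0/1 string of length
`n`, followed by a comma. -/
def encodeRow {n : ℕ} (h : Finset (Fin n)) : List Sym :=
  List.ofFn (fun i => if i ∈ h then Sym.one else Sym.zero) ++ [Sym.comma]

/-- The encoding of an input: the number `n` in unary, then the two incidence matrices (one row
for each hyperedge), separated by semicolons. -/
def Instance.encode (I : Instance) : List Sym :=
  List.replicate I.n Sym.one ++ [Sym.semicolon] ++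
    I.edges₁.flatMap encodeRow ++ [Sym.semicolon] ++ I.edges₂.flatMap encodeRow

open Classical in
/-- The answer to the decision problem: whether the Captain has a greedy winning strategy. -/
noncomputable def Instance.answer (I : Instance) : Bool :=
  decide (HasGreedyWinningStrategy I.H₁ I.H₂)

end Inputs

end RobberCaptain

/-!
The game is replaced by a simpler one whose positions can be enumerated. A greedy Captain has only
one choice, that of his squad, and only when his squad does not meet the component of the Robber.
In such a configuration the squad `h` and any node `x` of the component determine everything that
matters: the component is the set of nodes reachable from `x` outside of `h`, and the cops next to
it are all in action. If the Captain changes to the squad `k`, the Robber may go to all nodes that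
are reachable from `x` outside of `k ∩ B`, where `B` is the border of the component. If the Robber
then chooses a component that meets `k`, the Captain has to keep the squad `k` for one move; this
can only shrink the component, and makes it disjoint from `k`. So it suffices that the Captain wins
from `(k, z)` for all nodes `z ∉ k` that are reachable in this sense. This is the inductive
predicate `RobberCaptain.WinAt`, and `RobberCaptain.hasGreedyWinningStrategy_iff` says that it
describes the winner. Inputs without nodes are special, since there a capture configuration can
coincide with the initial configuration, and so are disconnected hypergraphs, on which the Robber
has no option after the first move.

The predicate `WinAt` has polynomially many instances `(h, x)`, and it is a least fixpoint of a
first-order operator, as are the reachability relations in its definition. If a row of a matrix is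
named by the position of the comma at its end, then even the incidence relations have such
definitions over the positions of the input. Hence the answer is computed by a fixed program
(`RobberCaptain.program`) that forms inflationary fixpoints of first-order formulas over the domain
`0, …, N - 1`, where `N` is the length of the input.

All these programs run in polynomial time on a multi-stack machine
(`StackProgram.nonempty_tm2ComputableInPolyTime`). A relation is kept as a bit tape, made of two
stacks, on which the bit of a tuple has the address given by the base-`N` value of the tuple.
Variables and loop counters are kept in unary on stacks of their own, quantifiers are evaluated by
trying all values, and a fixpoint of arity `k` is reached after `N ^ k` rounds, so that all loops
have a length that is known in advance. The programs are written in a small structured language,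
which is compiled into the machine model with an exact count of the steps.
-/

set_option linter.unusedSectionVars false

/-! ### Structured programs on stacks and their compilation -/

namespace StackProgram

open Turing StateTransition

/-- A structured program that works on stacks indexed by `K`, where stack `k` holds symbols from
`Γ k`. Tests look at the top symbol of one stack only (`none` if that stack is empty). -/
inductive Prog {K : Type} (Γ : K → Type) : Type
  | skip
  | push (k : K) (a : Γ k)
  | pop (k : K)
  | seq (p q : Prog Γ)
  | ite (k : K) (f : Option (Γ k) → Bool) (p q : Prog Γ)
  | loop (k : K) (f : Option (Γ k) → Bool) (p : Prog Γ)

variable {K : Type} [DecidableEq K] {Γ : K → Type}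

open Function in
/-- Big-step semantics: `Runs p S S' t` means that `p`, started with the stacks `S`, terminates with
the stacks `S'`, and that the compiled program makes `t` steps on the way. -/
inductive Runs : Prog Γ → (∀ k, List (Γ k)) → (∀ k, List (Γ k)) → ℕ → Prop
  | skip (S) : Runs .skip S S 1
  | push (S k a) : Runs (.push k a) S (update S k (a :: S k)) 1
  | pop (S k) : Runs (.pop k) S (update S k (S k).tail) 1
  | seq {p q S S' S'' t t'} : Runs p S S' t → Runs q S' S'' t' → Runs (.seq p q) S S'' (t + t')
  | iteTrue {k f p q S S' t} :
      f (S k).head? = true → Runs p S S' t → Runs (.ite k f p q) S S' (t + 1)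
  | iteFalse {k f p q S S' t} :
      f (S k).head? = false → Runs q S S' t → Runs (.ite k f p q) S S' (t + 1)
  | loopStop {k f p S} : f (S k).head? = false → Runs (.loop k f p) S S 1
  | loopStep {k f p S S' S'' t t'} : f (S k).head? = true → Runs p S S' t →
      Runs (.loop k f p) S' S'' t' → Runs (.loop k f p) S S'' (t + t' + 1)

/-- The labels of the machine code of a program. -/
def Lbl : Prog Γ → Type
  | .skip => Unit
  | .push _ _ => Unit
  | .pop _ => Unit
  | .seq p q => Lbl p ⊕ Lbl q
  | .ite _ _ p q => Option (Lbl p ⊕ Lbl q)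
  | .loop _ _ p => Option (Lbl p)

/-- A program has finitely many labels. -/
@[reducible]
def lblFintype : (p : Prog Γ) → Fintype (Lbl p)
  | .skip => inferInstanceAs (Fintype Unit)
  | .push _ _ => inferInstanceAs (Fintype Unit)
  | .pop _ => inferInstanceAs (Fintype Unit)
  | .seq p q =>
    letI := lblFintype p
    letI := lblFintype q
    inferInstanceAs (Fintype (Lbl p ⊕ Lbl q))
  | .ite _ _ p q =>
    letI := lblFintype p
    letI := lblFintype q
    inferInstanceAs (Fintype (Option (Lbl p ⊕ Lbl q)))
  | .loop _ _ p =>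
    letI := lblFintype p
    inferInstanceAs (Fintype (Option (Lbl p)))

instance (p : Prog Γ) : Fintype (Lbl p) := lblFintype p

/-- The label at which the code of a program is entered. -/
def entry : (p : Prog Γ) → Lbl p
  | .skip => ()
  | .push _ _ => ()
  | .pop _ => ()
  | .seq p _ => Sum.inl (entry p)
  | .ite _ _ _ _ => (none : Option _)
  | .loop _ _ _ => (none : Option _)

/-- The machine code of a program, for a machine with a Boolean register in which the labels of the
program are embedded by `emb`. The code jumps to `exit` when the program terminates. -/
def code {Λ : Type} : (p : Prog Γ) → (Lbl p → Λ) → Λ → Lbl p → TM2.Stmt Γ Λ Bool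
  | .skip, _, exit, _ => .goto fun _ => exit
  | .push k a, _, exit, _ => .push k (fun _ => a) (.goto fun _ => exit)
  | .pop k, _, exit, _ => .pop k (fun v _ => v) (.goto fun _ => exit)
  | .seq p q, emb, exit, l =>
    match l with
    | .inl l => code p (fun l => emb (.inl l)) (emb (.inr (entry q))) l
    | .inr l => code q (fun l => emb (.inr l)) exit l
  | .ite k f p q, emb, exit, l =>
    match l with
    | none => .peek k (fun _ a => f a)
        (.goto fun v => emb (some (if v then .inl (entry p) else .inr (entry q))))
    | some (.inl l) => code p (fun l => emb (some (.inl l))) exit l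
    | some (.inr l) => code q (fun l => emb (some (.inr l))) exit l
  | .loop k f p, emb, exit, l =>
    match l with
    | none => .peek k (fun _ a => f a)
        (.goto fun v => if v then emb (some (entry p)) else exit)
    | some l => code p (fun l => emb (some l)) (emb none) l

theorem iterate_code {Λ : Type} (M : Λ → TM2.Stmt Γ Λ Bool) {p : Prog Γ}
    {S S' : ∀ k, List (Γ k)} {t : ℕ} (hr : Runs p S S' t) :
    ∀ (emb : Lbl p → Λ) (exit : Λ), (∀ l, M (emb l) = code p emb exit l) → ∀ v : Bool, ∃ v' : Bool,
      (flip bind (TM2.step M))^[t] (some ⟨some (emb (entry p)), v, S⟩) =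
        some ⟨some exit, v', S'⟩ := by
  induction hr with
  | skip S => exact fun emb exit h v => ⟨v, by simp [flip, h, code]⟩
  | push S k a => exact fun emb exit h v => ⟨v, by simp [flip, h, code]⟩
  | pop S k => exact fun emb exit h v => ⟨v, by simp [flip, h, code]⟩
  | @seq p q S S' S'' t t' _ _ ih₁ ih₂ =>
    intro emb exit h v
    obtain ⟨v₁, h₁⟩ := ih₁ (fun l => emb (.inl l)) (emb (.inr (entry q))) (fun l => h (.inl l)) v
    obtain ⟨v₂, h₂⟩ := ih₂ (fun l => emb (.inr l)) exit (fun l => h (.inr l)) v₁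
    refine ⟨v₂, ?_⟩
    rw [add_comm, Function.iterate_add_apply]
    exact (congrArg _ h₁).trans h₂
  | @iteTrue k f p q S S' t hf _ ih =>
    intro emb exit h v
    obtain ⟨v₁, h₁⟩ := ih (fun l => emb (some (.inl l))) exit (fun l => h (some (.inl l))) true
    refine ⟨v₁, ?_⟩
    rw [Function.iterate_add_apply, Function.iterate_one]
    refine (congrArg _ (congrArg some ?_)).trans h₁
    change TM2.stepAux (M (emb none)) v S = _
    rw [show M (emb none) = _ from h none]
    simp [code, hf]
  | @iteFalse k f p q S S' t hf _ ih =>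
    intro emb exit h v
    obtain ⟨v₁, h₁⟩ := ih (fun l => emb (some (.inr l))) exit (fun l => h (some (.inr l))) false
    refine ⟨v₁, ?_⟩
    rw [Function.iterate_add_apply, Function.iterate_one]
    refine (congrArg _ (congrArg some ?_)).trans h₁
    change TM2.stepAux (M (emb none)) v S = _
    rw [show M (emb none) = _ from h none]
    simp [code, hf]
  | @loopStop k f p S hf =>
    intro emb exit h v
    refine ⟨false, congrArg some ?_⟩
    change TM2.stepAux (M (emb none)) v S = _
    rw [show M (emb none) = _ from h none]
    simp [code, hf]
  | @loopStep k f p S S' S'' t t' hf _ _ ih₁ ih₂ =>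
    intro emb exit h v
    obtain ⟨v₁, h₁⟩ := ih₁ (fun l => emb (some l)) (emb none) (fun l => h (some l)) true
    obtain ⟨v₂, h₂⟩ := ih₂ emb exit h v₁
    refine ⟨v₂, ?_⟩
    rw [add_comm t t', Function.iterate_add_apply, Function.iterate_one, Function.iterate_add_apply]
    refine (congrArg _ ((congrArg _ (congrArg some ?_)).trans h₁)).trans h₂
    change TM2.stepAux (M (emb none)) v S = _
    rw [show M (emb none) = _ from h none]
    simp [code, hf]

/-- The machine that runs a program, with input stack `k₀` and output stack `k₁`. -/
def machine [Fintype K] (p : Prog Γ) (k₀ k₁ : K) [Fintype (Γ k₀)] : FinTM2 where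
  K := K
  k₀ := k₀
  k₁ := k₁
  Γ := Γ
  Λ := Option (Lbl p)
  main := some (entry p)
  σ := Bool
  initialState := false
  m := fun l => l.elim (.load (fun _ => false) .halt) (code p some none)

/-- A program that turns the stacks with only the input into the stacks with only the output yields
a computation of its machine with one more step. -/
theorem machine_outputs [Fintype K] (p : Prog Γ) (k₀ k₁ : K) [Fintype (Γ k₀)]
    (w : List (Γ k₀)) (o : List (Γ k₁)) {t m : ℕ} (htm : t + 1 ≤ m)
    (h : Runs p (Function.update (fun _ => []) k₀ w) (Function.update (fun _ => []) k₁ o) t) :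
    Nonempty (TM2OutputsInTime (machine p k₀ k₁) w (some o) m) := by
  obtain ⟨v, hv⟩ := iterate_code (machine p k₀ k₁).m h some none (fun _ => rfl) false
  refine ⟨⟨⟨t + 1, ?_⟩, htm⟩⟩
  have h₀ : initList (machine p k₀ k₁) w =
      ⟨some (some (entry p)), false, Function.update (fun _ => []) k₀ w⟩ := by
    unfold initList
    congr 1
    funext k
    rcases eq_or_ne k₀ k with rfl | hk
    · exact (dif_pos rfl).trans
        (Function.update_self (β := fun k => List (Γ k)) k₀ w fun _ => []).symm
    · exact (dif_neg hk.symm).trans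
        (Function.update_of_ne (β := fun k => List (Γ k)) hk.symm w fun _ => []).symm
  have h₁ : haltList (machine p k₀ k₁) o =
      ⟨none, false, Function.update (fun _ => []) k₁ o⟩ := by
    unfold haltList
    congr 1
    funext k
    rcases eq_or_ne k₁ k with rfl | hk
    · exact (dif_pos rfl).trans
        (Function.update_self (β := fun k => List (Γ k)) k₁ o fun _ => []).symm
    · exact (dif_neg hk.symm).trans
        (Function.update_of_ne (β := fun k => List (Γ k)) hk.symm o fun _ => []).symm
  rw [add_comm, Function.iterate_add_apply, Function.iterate_one, h₀]
  refine (congrArg _ hv).trans ?_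
  exact (congrArg some h₁).symm

end StackProgram

/-! ### Counters and bit tapes on stacks -/

namespace StackProgram

open Function

/-- The counters of the evaluation machine, each one kept in unary on a stack of its own: the length
of the input, three auxiliary counters, and for each variable its value and the number of
iterations that are left in the loop over it. -/
inductive Ctr (X : Type)
  | size
  | addr
  | prod
  | tmp
  | var (x : X)
  | left (x : X)
  deriving DecidableEq, Fintype

/-- The stacks of the evaluation machine: the counters, two stacks for the part of each tape before
and after the current position, a stack of intermediate results, the input and the output. -/
inductive Stack (A X : Type)
  | ctr (c : Ctr X)
  | before (a : A)
  | after (a : A)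
  | res
  | inp
  | out
  deriving DecidableEq, Fintype

/-- The stack symbols: the input stack holds symbols from `I`, all others hold bits. -/
abbrev Symbol (I : Type) {A X : Type} : Stack A X → Type
  | .inp => I
  | _ => Bool

/-- The contents of all stacks, with counters read as natural numbers. -/
structure Store (I A X : Type) where
  ctr : Ctr X → ℕ
  before : A → List Bool
  after : A → List Bool
  res : List Bool
  inp : List I
  out : List Bool

variable {I A X : Type} [DecidableEq A] [DecidableEq X]

/-- The stacks that represent a store. -/
def Store.stk (s : Store I A X) : ∀ k : Stack A X, List (Symbol I k)
  | .ctr c => List.replicate (s.ctr c) true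
  | .before a => s.before a
  | .after a => s.after a
  | .res => s.res
  | .inp => s.inp
  | .out => s.out

variable (I A X) in
/-- Programs on the stacks of the evaluation machine. -/
abbrev SProg := Prog (Symbol I (A := A) (X := X))

/-- The program `p` turns the store `s` into the store `s'` within `n` steps. -/
def Exec (p : SProg I A X) (s s' : Store I A X) (n : ℕ) : Prop :=
  ∃ t ≤ n, Runs p s.stk s'.stk t

/-- The store in which counter `c` is set to `n`. -/
def Store.setCtr (s : Store I A X) (c : Ctr X) (n : ℕ) : Store I A X :=
  { s with ctr := update s.ctr c n }

@[simp] theorem Store.setCtr_self (s : Store I A X) (c : Ctr X) : s.setCtr c (s.ctr c) = s := by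
  simp [Store.setCtr]

@[simp] theorem Store.setCtr_setCtr (s : Store I A X) (c : Ctr X) (m n : ℕ) :
    (s.setCtr c m).setCtr c n = s.setCtr c n := by
  simp [Store.setCtr]

theorem Store.setCtr_comm (s : Store I A X) {c d : Ctr X} (h : c ≠ d) (m n : ℕ) :
    (s.setCtr c m).setCtr d n = (s.setCtr d n).setCtr c m := by
  simp [Store.setCtr, update_comm h]

@[simp] theorem Store.ctr_setCtr_self (s : Store I A X) (c : Ctr X) (n : ℕ) :
    (s.setCtr c n).ctr c = n := by
  simp [Store.setCtr]

theorem Store.ctr_setCtr_of_ne (s : Store I A X) {c d : Ctr X} (h : d ≠ c) (n : ℕ) :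
    (s.setCtr c n).ctr d = s.ctr d := by
  simp [Store.setCtr, update_of_ne h]

theorem Exec.mono {p : SProg I A X} {s s' : Store I A X} {m n : ℕ} (h : Exec p s s' m)
    (hmn : m ≤ n) : Exec p s s' n :=
  let ⟨t, ht, hr⟩ := h
  ⟨t, ht.trans hmn, hr⟩

theorem Exec.seq {p q : SProg I A X} {s s' s'' : Store I A X} {m n : ℕ} (h : Exec p s s' m)
    (h' : Exec q s' s'' n) : Exec (.seq p q) s s'' (m + n) :=
  let ⟨t, ht, hr⟩ := h
  let ⟨t', ht', hr'⟩ := h'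
  ⟨t + t', add_le_add ht ht', .seq hr hr'⟩

theorem Exec.skip (s : Store I A X) : Exec .skip s s 1 := ⟨1, le_rfl, .skip _⟩

theorem Exec.push {s s' : Store I A X} {k : Stack A X} {a : Symbol I k}
    (h : s'.stk = update s.stk k (a :: s.stk k)) : Exec (.push k a) s s' 1 :=
  ⟨1, le_rfl, h ▸ .push _ _ _⟩

theorem Exec.pop {s s' : Store I A X} {k : Stack A X}
    (h : s'.stk = update s.stk k (s.stk k).tail) : Exec (.pop k) s s' 1 :=
  ⟨1, le_rfl, h ▸ .pop _ _⟩

theorem Exec.iteTrue {p q : SProg I A X} {s s' : Store I A X} {k : Stack A X}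
    {f : Option (Symbol I k) → Bool} {n : ℕ} (hf : f (s.stk k).head? = true) (h : Exec p s s' n) :
    Exec (.ite k f p q) s s' (n + 1) :=
  let ⟨t, ht, hr⟩ := h
  ⟨t + 1, by lia, .iteTrue hf hr⟩

theorem Exec.iteFalse {p q : SProg I A X} {s s' : Store I A X} {k : Stack A X}
    {f : Option (Symbol I k) → Bool} {n : ℕ} (hf : f (s.stk k).head? = false) (h : Exec q s s' n) :
    Exec (.ite k f p q) s s' (n + 1) :=
  let ⟨t, ht, hr⟩ := h
  ⟨t + 1, by lia, .iteFalse hf hr⟩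

theorem Exec.loopStop {p : SProg I A X} {s : Store I A X} {k : Stack A X}
    {f : Option (Symbol I k) → Bool} (hf : f (s.stk k).head? = false) :
    Exec (.loop k f p) s s 1 :=
  ⟨1, le_rfl, .loopStop hf⟩

theorem Exec.loopStep {p : SProg I A X} {s s' s'' : Store I A X} {k : Stack A X}
    {f : Option (Symbol I k) → Bool} {m n : ℕ} (hf : f (s.stk k).head? = true) (h : Exec p s s' m)
    (h' : Exec (.loop k f p) s' s'' n) : Exec (.loop k f p) s s'' (m + n + 1) :=
  let ⟨t, ht, hr⟩ := h
  let ⟨t', ht', hr'⟩ := h'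
  ⟨t + t' + 1, by lia, .loopStep hf hr hr'⟩

theorem stk_setCtr (s : Store I A X) (c : Ctr X) (n : ℕ) :
    (s.setCtr c n).stk = update s.stk (.ctr c) (List.replicate n true) := by
  funext k
  rcases eq_or_ne k (.ctr c) with rfl | hk
  · simp [Store.stk, Store.setCtr]
  · rw [update_of_ne hk]
    cases k <;> first | rfl | simp_all [Store.stk, Store.setCtr]

theorem stk_setBefore (s : Store I A X) (a : A) (l : List Bool) :
    Store.stk { s with before := update s.before a l } = update s.stk (.before a) l := by
  funext k
  rcases eq_or_ne k (.before a) with rfl | hk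
  · simp [Store.stk]
  · rw [update_of_ne hk]
    cases k <;> first | rfl | simp_all [Store.stk]

theorem stk_setAfter (s : Store I A X) (a : A) (l : List Bool) :
    Store.stk { s with after := update s.after a l } = update s.stk (.after a) l := by
  funext k
  rcases eq_or_ne k (.after a) with rfl | hk
  · simp [Store.stk]
  · rw [update_of_ne hk]
    cases k <;> first | rfl | simp_all [Store.stk]

theorem stk_setRes (s : Store I A X) (l : List Bool) :
    Store.stk { s with res := l } = update s.stk .res l := by
  funext k
  rcases eq_or_ne k (.res) with rfl | hk
  · simp [Store.stk]
  · rw [update_of_ne hk]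
    cases k <;> first | rfl | simp_all

theorem stk_setInp (s : Store I A X) (l : List I) :
    Store.stk { s with inp := l } = update s.stk .inp l := by
  funext k
  rcases eq_or_ne k (.inp) with rfl | hk
  · simp [Store.stk]
  · rw [update_of_ne hk]
    cases k <;> first | rfl | simp_all

theorem stk_setOut (s : Store I A X) (l : List Bool) :
    Store.stk { s with out := l } = update s.stk .out l := by
  funext k
  rcases eq_or_ne k (.out) with rfl | hk
  · simp [Store.stk]
  · rw [update_of_ne hk]
    cases k <;> first | rfl | simp_all

/-- Increment a counter. -/
def inc (c : Ctr X) : SProg I A X := .push (.ctr c) true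

/-- Decrement a counter. -/
def dec (c : Ctr X) : SProg I A X := .pop (.ctr c)

theorem exec_inc (s : Store I A X) (c : Ctr X) :
    Exec (inc c) s (s.setCtr c (s.ctr c + 1)) 1 :=
  .push (by rw [stk_setCtr]; rfl)

theorem exec_dec (s : Store I A X) (c : Ctr X) :
    Exec (dec c) s (s.setCtr c (s.ctr c - 1)) 1 :=
  .pop (by rw [stk_setCtr]; exact congrArg _ List.tail_replicate.symm)

/-- The program that pushes the bit `b` on the stack of results. -/
def pushRes (b : Bool) : SProg I A X := .push .res b

/-- The program that removes the last result. -/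
def popRes : SProg I A X := .pop .res

theorem exec_pushRes (s : Store I A X) (b : Bool) :
    Exec (pushRes b) s { s with res := b :: s.res } 1 :=
  .push (by rw [stk_setRes]; rfl)

theorem exec_popRes (s : Store I A X) :
    Exec popRes s { s with res := s.res.tail } 1 :=
  .pop (by rw [stk_setRes]; rfl)

/-- Branch on the last result. -/
def iteRes (p q : SProg I A X) : SProg I A X := .ite .res (fun b => b.getD false) p q

theorem exec_iteRes {p q : SProg I A X} {s s' : Store I A X} {b : Bool} {r : List Bool} {n : ℕ}
    (hs : s.res = b :: r) (h : Exec (if b then p else q) s s' n) :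
    Exec (iteRes p q) s s' (n + 1) := by
  cases b
  · exact .iteFalse (by simp [Store.stk, hs]) (by simpa using h)
  · exact .iteTrue (by simp [Store.stk, hs]) (by simpa using h)

/-- Run a program as often as counter `c` says, decrementing `c` each time. -/
def loopCtr (c : Ctr X) (p : SProg I A X) : SProg I A X :=
  .loop (.ctr c) Option.isSome (.seq (dec c) p)

/-- The rule for `loopCtr`: `Φ i` describes the store after `i` rounds, up to the value of `c`. -/
theorem exec_loopCtr {c : Ctr X} {p : SProg I A X} {m n : ℕ} (Φ : ℕ → Store I A X → Prop)
    (h : ∀ i < m, ∀ s, Φ i s → ∃ s', Φ (i + 1) s' ∧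
      Exec p (s.setCtr c (m - 1 - i)) (s'.setCtr c (m - 1 - i)) n) {s : Store I A X}
    (hs : Φ 0 s) :
    ∃ s', Φ m s' ∧ Exec (loopCtr c p) (s.setCtr c m) (s'.setCtr c 0) (m * (n + 2) + 1) := by
  induction m generalizing Φ s with
  | zero => exact ⟨s, hs, (Exec.loopStop (by simp [Store.stk])).mono (by simp)⟩
  | succ m ih =>
    obtain ⟨s₁, hs₁, h₁⟩ := h 0 (by lia) s hs
    obtain ⟨s₂, hs₂, h₂⟩ := ih (fun i => Φ (i + 1)) (fun i hi s' hs' => by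
      obtain ⟨s'', hs'', h''⟩ := h (i + 1) (by lia) s' hs'
      refine ⟨s'', hs'', ?_⟩
      rwa [show m + 1 - 1 - (i + 1) = m - 1 - i by lia] at h'') hs₁
    refine ⟨s₂, hs₂, ?_⟩
    refine (Exec.loopStep (by simp [Store.stk, List.head?_replicate])
      (.seq (exec_dec _ c) ?_) h₂).mono
      (?_ : 1 + n + (m * (n + 2) + 1) + 1 ≤ _)
    · simpa using h₁
    · rw [Nat.succ_mul]; lia

/-- The rule for `loopCtr` if the store after `i` rounds is known explicitly. -/
theorem exec_loopCtr' {c : Ctr X} {p : SProg I A X} {m n : ℕ} (F : ℕ → Store I A X)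
    (h : ∀ i < m, Exec p ((F i).setCtr c (m - 1 - i)) ((F (i + 1)).setCtr c (m - 1 - i)) n) :
    Exec (loopCtr c p) ((F 0).setCtr c m) ((F m).setCtr c 0) (m * (n + 2) + 1) := by
  obtain ⟨s', rfl, h'⟩ := exec_loopCtr (fun i s => s = F i)
    (fun i hi s hs => ⟨_, rfl, by subst hs; exact h i hi⟩) rfl
  exact h'

/-- Reset a counter to zero. -/
def clearCtr (c : Ctr X) : SProg I A X := loopCtr c .skip

theorem exec_clearCtr (s : Store I A X) (c : Ctr X) :
    Exec (clearCtr c) s (s.setCtr c 0) (s.ctr c * 3 + 1) := by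
  simpa [clearCtr] using exec_loopCtr' (c := c) (m := s.ctr c) (fun _ => s) (fun i _ => Exec.skip _)

/-- Run a program as often as counter `c` says, preserving `c` with the help of `Ctr.tmp`. -/
def rep (c : Ctr X) (p : SProg I A X) : SProg I A X :=
  .seq (loopCtr c (.seq (inc .tmp) p)) (loopCtr .tmp (inc c))

theorem exec_rep {c : Ctr X} (hc : c ≠ .tmp) {p : SProg I A X} {m n : ℕ} (F : ℕ → Store I A X)
    (hF : ∀ i, (F i).ctr c = m) (hF' : ∀ i, (F i).ctr .tmp = 0)
    (h : ∀ i < m, ∀ a b, Exec p (((F i).setCtr c a).setCtr .tmp b)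
      (((F (i + 1)).setCtr c a).setCtr .tmp b) n) :
    Exec (rep c p) (F 0) (F m) (m * (n + 6) + 2) := by
  have h₁ := exec_loopCtr' (c := c) (p := .seq (inc .tmp) p) (m := m) (n := 1 + n)
    (fun i => (F i).setCtr .tmp i) (fun i hi => by
      refine .seq (exec_inc _ _) ?_
      have := h i hi (m - 1 - i) (i + 1)
      simpa [Store.setCtr_comm _ hc.symm, Store.ctr_setCtr_of_ne _ hc.symm] using this)
  have h₂ := exec_loopCtr' (I := I) (A := A) (c := .tmp) (p := inc c) (m := m) (n := 1)
    (fun i => (F m).setCtr c i) (fun i hi => by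
      have := exec_inc (((F m).setCtr c i).setCtr .tmp (m - 1 - i)) c
      simpa [Store.setCtr_comm _ hc.symm, Store.ctr_setCtr_of_ne _ hc,
        Store.ctr_setCtr_of_ne _ hc.symm] using this)
  have e₁ : ((F 0).setCtr .tmp 0).setCtr c m = F 0 := by
    have := (F 0).setCtr_self .tmp
    rw [hF'] at this
    rw [this, ← hF 0, Store.setCtr_self]
  have e₂ : ((F m).setCtr c m).setCtr .tmp 0 = F m := by
    have := (F m).setCtr_self c
    rw [hF] at this
    rw [this, ← hF' m, Store.setCtr_self]
  rw [e₁, Store.setCtr_comm _ hc.symm] at h₁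
  rw [e₂] at h₂
  exact (h₁.seq h₂).mono (by ring_nf; lia)

/-- Add counter `c` to counter `d`. -/
theorem exec_rep_inc {c d : Ctr X} (hc : c ≠ .tmp) (hd : d ≠ .tmp) (hcd : c ≠ d)
    (s : Store I A X) (hs : s.ctr .tmp = 0) :
    Exec (rep c (inc d)) s (s.setCtr d (s.ctr d + s.ctr c)) (s.ctr c * 7 + 2) := by
  have := exec_rep (I := I) (A := A) hc (p := inc d) (m := s.ctr c) (n := 1)
    (fun i => s.setCtr d (s.ctr d + i)) (fun i => s.ctr_setCtr_of_ne hcd _)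
    (fun i => by rw [s.ctr_setCtr_of_ne hd.symm, hs]) (fun i hi a b => by
      have := exec_inc (((s.setCtr d (s.ctr d + i)).setCtr c a).setCtr .tmp b) d
      rw [Store.ctr_setCtr_of_ne _ hd, Store.ctr_setCtr_of_ne _ hcd.symm,
        Store.ctr_setCtr_self, Store.setCtr_comm _ hd.symm, Store.setCtr_comm _ hcd,
        Store.setCtr_setCtr] at this
      exact this)
  simpa using this

/-- Subtract counter `c` from counter `d`. -/
theorem exec_rep_dec {c d : Ctr X} (hc : c ≠ .tmp) (hd : d ≠ .tmp) (hcd : c ≠ d)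
    (s : Store I A X) (hs : s.ctr .tmp = 0) :
    Exec (rep c (dec d)) s (s.setCtr d (s.ctr d - s.ctr c)) (s.ctr c * 7 + 2) := by
  have := exec_rep (I := I) (A := A) hc (p := dec d) (m := s.ctr c) (n := 1)
    (fun i => s.setCtr d (s.ctr d - i)) (fun i => s.ctr_setCtr_of_ne hcd _)
    (fun i => by rw [s.ctr_setCtr_of_ne hd.symm, hs]) (fun i hi a b => by
      have := exec_dec (((s.setCtr d (s.ctr d - i)).setCtr c a).setCtr .tmp b) d
      rw [Store.ctr_setCtr_of_ne _ hd, Store.ctr_setCtr_of_ne _ hcd.symm,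
        Store.ctr_setCtr_self, Store.setCtr_comm _ hd.symm, Store.setCtr_comm _ hcd,
        Store.setCtr_setCtr] at this
      exact this)
  simpa using this

end StackProgram

namespace StackProgram

open Function

variable {I A X : Type} [DecidableEq A] [DecidableEq X]

/-! ### Random access to bit tapes -/

/-- The address of the cell with the given coordinates in an array in which every coordinate ranges
over `0, …, N - 1`. -/
def address (N : ℕ) (xs : List ℕ) : ℕ := xs.foldl (fun u x => u * N + x) 0

theorem foldl_address_lt {N : ℕ} (xs : List ℕ) (hxs : ∀ x ∈ xs, x < N) (u : ℕ) :
    xs.foldl (fun u x => u * N + x) u < (u + 1) * N ^ xs.length := by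
  induction xs generalizing u with
  | nil => simp
  | cons x xs ih =>
    refine (ih (fun y hy => hxs y (by simp [hy])) (u * N + x)).trans_le ?_
    have : u * N + x + 1 ≤ (u + 1) * N := by
      have := hxs x (by simp)
      rw [Nat.succ_mul]; lia
    calc _ ≤ (u + 1) * N * N ^ xs.length := Nat.mul_le_mul_right _ this
      _ = _ := by rw [List.length_cons, pow_succ]; ring

theorem address_lt {N : ℕ} {xs : List ℕ} (hxs : ∀ x ∈ xs, x < N) :
    address N xs < N ^ xs.length := by
  simpa [address] using foldl_address_lt xs hxs 0

theorem foldl_address_inj {N : ℕ} {xs ys : List ℕ} (hxs : ∀ x ∈ xs, x < N) (hys : ∀ y ∈ ys, y < N)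
    (hl : xs.length = ys.length) {u v : ℕ}
    (h : xs.foldl (fun u x => u * N + x) u = ys.foldl (fun u x => u * N + x) v) :
    u = v ∧ xs = ys := by
  induction xs generalizing ys u v with
  | nil => cases ys <;> simp_all
  | cons x xs ih =>
    cases ys with
    | nil => simp at hl
    | cons y ys =>
      have hx := hxs x (by simp)
      have hy := hys y (by simp)
      obtain ⟨h₁, h₂⟩ := ih (ys := ys) (u := u * N + x) (v := v * N + y)
        (fun z hz => hxs z (by simp [hz])) (fun z hz => hys z (by simp [hz]))
        (by simpa using hl) h
      have hN : 0 < N := by lia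
      have h₃ : (u * N + x) % N = (v * N + y) % N := by rw [h₁]
      have h₄ : (u * N + x) / N = (v * N + y) / N := by rw [h₁]
      rw [Nat.mul_add_mod', Nat.mul_add_mod', Nat.mod_eq_of_lt hx, Nat.mod_eq_of_lt hy] at h₃
      rw [mul_comm u, mul_comm v, Nat.mul_add_div hN, Nat.mul_add_div hN,
        Nat.div_eq_of_lt hx, Nat.div_eq_of_lt hy] at h₄
      exact ⟨by simpa using h₄, by rw [h₃, h₂]⟩

theorem address_inj {N : ℕ} {xs ys : List ℕ} (hxs : ∀ x ∈ xs, x < N) (hys : ∀ y ∈ ys, y < N)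
    (hl : xs.length = ys.length) (h : address N xs = address N ys) : xs = ys :=
  (foldl_address_inj hxs hys hl h).2

/-- Replace the value `u` of `Ctr.addr` by `u * N + x`, where `N` is the value of `Ctr.size`. -/
def digit (x : X) : SProg I A X :=
  .seq (loopCtr .addr (rep .size (inc .prod))) (.seq (loopCtr .prod (inc .addr))
    (rep (.var x) (inc .addr)))

theorem exec_digit (s : Store I A X) (x : X) (u : ℕ) (hp : s.ctr .prod = 0) (ht : s.ctr .tmp = 0) :
    Exec (digit x) (s.setCtr .addr u) (s.setCtr .addr (u * s.ctr .size + s.ctr (.var x)))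
      (u * (s.ctr .size * 7 + 4) + u * s.ctr .size * 3 + s.ctr (.var x) * 7 + 4) := by
  have h₁ := exec_loopCtr' (I := I) (A := A) (X := X) (c := .addr) (p := rep .size (inc .prod))
    (m := u) (n := s.ctr .size * 7 + 2) (fun i => s.setCtr .prod (i * s.ctr .size))
    (fun i _ => by
      have := exec_rep_inc (c := .size) (d := .prod) (by simp) (by simp) (by simp)
        ((s.setCtr .prod (i * s.ctr .size)).setCtr .addr (u - 1 - i))
        (by simp [Store.ctr_setCtr_of_ne, ht])
      simp only [Store.ctr_setCtr_of_ne, ne_eq, reduceCtorEq, not_false_eq_true,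
        Store.ctr_setCtr_self] at this
      rw [Store.setCtr_comm _ (show (.addr : Ctr X) ≠ .prod by simp), Store.setCtr_setCtr] at this
      rwa [Nat.succ_mul])
  have h₂ := exec_loopCtr' (I := I) (A := A) (X := X) (c := .prod) (p := inc .addr)
    (m := u * s.ctr .size) (n := 1) (fun i => s.setCtr .addr i)
    (fun i _ => by
      have := exec_inc ((s.setCtr .addr i).setCtr .prod (u * s.ctr .size - 1 - i)) .addr
      rw [Store.setCtr_comm _ (show (.prod : Ctr X) ≠ .addr by simp), Store.setCtr_setCtr,
        Store.ctr_setCtr_of_ne _ (by simp), Store.ctr_setCtr_self] at this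
      exact this)
  have h₃ := exec_rep_inc (c := .var x) (d := .addr) (by simp) (by simp) (by simp)
    (s.setCtr .addr (u * s.ctr .size)) (by simp [Store.ctr_setCtr_of_ne, ht])
  rw [Store.ctr_setCtr_self, Store.ctr_setCtr_of_ne _ (by simp), Store.setCtr_setCtr] at h₃
  have e : (s.setCtr .prod 0) = s := by rw [← hp, Store.setCtr_self]
  rw [s.setCtr_comm (show (.addr : Ctr X) ≠ .prod by simp) _ 0, e] at h₂
  rw [Nat.zero_mul, e, s.setCtr_comm (show (.prod : Ctr X) ≠ .addr by simp) _ 0] at h₁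
  exact (h₁.seq (h₂.seq h₃)).mono (by lia)

/-- Add the address with coordinates `xs` to `Ctr.addr`. -/
def addressCode : List X → SProg I A X
  | [] => .skip
  | x :: xs => .seq (digit x) (addressCode xs)

theorem exec_addressCode (s : Store I A X) (hp : s.ctr .prod = 0) (ht : s.ctr .tmp = 0) (B : ℕ)
    (hN : 0 < s.ctr .size) (xs : List X) (hxs : ∀ x ∈ xs, s.ctr (.var x) < s.ctr .size) (u : ℕ)
    (hB : (u + 1) * s.ctr .size ^ xs.length ≤ B) :
    Exec (addressCode xs) (s.setCtr .addr u)
      (s.setCtr .addr ((xs.map fun x => s.ctr (.var x)).foldl (fun u x => u * s.ctr .size + x) u))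
      (xs.length * (B * (s.ctr .size * 10 + 4) + s.ctr .size * 7 + 4) + 1) := by
  induction xs generalizing u with
  | nil => exact (Exec.skip _).mono (by simp)
  | cons x xs ih =>
    have hx := hxs x (by simp)
    have hu : u ≤ B := by
      refine le_trans ?_ hB
      calc u ≤ (u + 1) * 1 := by lia
        _ ≤ _ := Nat.mul_le_mul_left _ (Nat.one_le_pow _ _ hN)
    refine ((exec_digit s x u hp ht).seq
      (ih (fun y hy => hxs y (by simp [hy])) _ (le_trans ?_ hB))).mono ?_
    · have : u * s.ctr .size + s.ctr (.var x) + 1 ≤ (u + 1) * s.ctr .size := by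
        rw [Nat.succ_mul]; lia
      calc _ ≤ (u + 1) * s.ctr .size * s.ctr .size ^ xs.length := Nat.mul_le_mul_right _ this
        _ = _ := by rw [List.length_cons, pow_succ]; ring
    · rw [List.length_cons, Nat.succ_mul]
      have h₁ : u * (s.ctr .size * 7 + 4) + u * s.ctr .size * 3 ≤ B * (s.ctr .size * 10 + 4) := by
        calc _ = u * (s.ctr .size * 10 + 4) := by ring
          _ ≤ _ := Nat.mul_le_mul_right _ hu
      lia

/-- The store in which the tape `a` is replaced by the two given halves. -/
def Store.setTape (s : Store I A X) (a : A) (l r : List Bool) : Store I A X :=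
  { s with before := update s.before a l, after := update s.after a r }

theorem stk_setTape (s : Store I A X) (a : A) (l r : List Bool) :
    (s.setTape a l r).stk = update (update s.stk (.before a) l) (.after a) r :=
  (stk_setAfter { s with before := update s.before a l } a r).trans (by rw [stk_setBefore])

@[simp] theorem Store.setTape_self (s : Store I A X) (a : A) :
    s.setTape a (s.before a) (s.after a) = s := by
  simp [Store.setTape]

theorem Store.setTape_setCtr (s : Store I A X) (a : A) (l r : List Bool) (c : Ctr X) (n : ℕ) :
    (s.setTape a l r).setCtr c n = (s.setCtr c n).setTape a l r := rfl

/-- Move one symbol from the stack `k` to the stack `k'`, or the bit `false` if `k` is empty. -/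
def moveBit (k k' : Stack A X) (h : Symbol I k = Bool) (h' : Symbol I k' = Bool) : SProg I A X :=
  .ite k (fun b => (b.map (cast h)).getD false) (.seq (.pop k) (.push k' (cast h'.symm true)))
    (.seq (.pop k) (.push k' (cast h'.symm false)))

/-- Move the position on tape `a` by one cell; behind the end of the tape, this extends the tape
with the bit `false`. -/
def forward (a : A) : SProg I A X := moveBit (.after a) (.before a) rfl rfl

/-- Move the position on tape `a` back by one cell. -/
def backward (a : A) : SProg I A X := moveBit (.before a) (.after a) rfl rfl

theorem exec_forward (s : Store I A X) (a : A) (l r : List Bool) :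
    Exec (forward a) (s.setTape a l r) (s.setTape a (r.headD false :: l) r.tail) 3 := by
  have h : ∀ b : Bool, Exec (.seq (.pop (.after a)) (.push (.before a) b)) (s.setTape a l r)
      (s.setTape a (b :: l) r.tail) 2 := fun b => by
    refine Exec.seq (s' := s.setTape a l r.tail) (.pop ?_) (.push ?_)
    · simp [stk_setTape]
    · have : (Stack.before a : Stack A X) ≠ .after a := by simp
      simp [stk_setTape, update_comm this]
  rcases r with _ | ⟨_ | _, r⟩
  · exact .iteFalse (by simp [stk_setTape]) (h false)
  · exact .iteFalse (by simp [stk_setTape]) (h false)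
  · exact .iteTrue (by simp [stk_setTape]) (h true)

theorem exec_backward (s : Store I A X) (a : A) (b : Bool) (l r : List Bool) :
    Exec (backward a) (s.setTape a (b :: l) r) (s.setTape a l (b :: r)) 3 := by
  have hne : (Stack.before a : Stack A X) ≠ .after a := by simp
  have h : Exec (.seq (.pop (.before a)) (.push (.after a) b)) (s.setTape a (b :: l) r)
      (s.setTape a l (b :: r)) 2 := by
    refine Exec.seq (s' := s.setTape a l r) (.pop ?_) (.push ?_)
    · simp [stk_setTape, update_comm hne]
    · simp [stk_setTape]
  cases b
  · exact .iteFalse (by simp [stk_setTape]) h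
  · exact .iteTrue (by simp [stk_setTape]) h

/-- The first `i` cells of a tape, filled up with the bit `false`. -/
def prefixCells (l : List Bool) (i : ℕ) : List Bool := (List.range i).map (l.getD · false)

@[simp] theorem length_prefixCells (l : List Bool) (i : ℕ) : (prefixCells l i).length = i := by
  simp [prefixCells]

theorem prefixCells_succ (l : List Bool) (i : ℕ) :
    (prefixCells l (i + 1)).reverse = (l.drop i).headD false :: (prefixCells l i).reverse := by
  simp [prefixCells, List.range_succ]

/-- Move to the cell of tape `a` with the address in `Ctr.addr`, which becomes zero. -/
def seek (a : A) : SProg I A X := loopCtr .addr (forward a)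

theorem exec_seek (s : Store I A X) (a : A) (hs : s.before a = []) :
    Exec (seek a) s ((s.setCtr .addr 0).setTape a (prefixCells (s.after a) (s.ctr .addr)).reverse
      ((s.after a).drop (s.ctr .addr))) (s.ctr .addr * 5 + 1) := by
  have := exec_loopCtr' (c := .addr) (p := forward a) (m := s.ctr .addr) (n := 3)
    (fun i => s.setTape a (prefixCells (s.after a) i).reverse ((s.after a).drop i))
    (fun i _ => by
      rw [prefixCells_succ, Store.setTape_setCtr, Store.setTape_setCtr, ← List.tail_drop]
      exact exec_forward _ _ _ _)
  have e : s.setTape a (prefixCells (s.after a) 0).reverse ((s.after a).drop 0) = s := by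
    conv_rhs => rw [← s.setTape_self a, hs]
    simp [prefixCells]
  rwa [e, Store.setCtr_self, Store.setTape_setCtr] at this

/-- Move to the first cell of tape `a`. -/
def rewind (a : A) : SProg I A X := .loop (.before a) Option.isSome (backward a)

theorem exec_rewind (s : Store I A X) (a : A) (l r : List Bool) :
    Exec (rewind a) (s.setTape a l r) (s.setTape a [] (l.reverse ++ r)) (l.length * 4 + 1) := by
  have hne : (Stack.before a : Stack A X) ≠ .after a := by simp
  induction l generalizing r with
  | nil => exact (Exec.loopStop (by simp [stk_setTape])).mono (by simp)
  | cons b l ih =>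
    have := Exec.loopStep (by simp [stk_setTape]) (exec_backward s a b l r) (ih (b :: r))
    exact Exec.mono (by simpa [rewind] using this) (by simp; lia)

/-- Push the bit of tape `a` at the address in `Ctr.addr` on the stack of results. -/
def readCode (a : A) : SProg I A X :=
  .seq (seek a) (.seq (.ite (.after a) (fun b => b.getD false) (pushRes true) (pushRes false))
    (rewind a))

theorem exec_readCode (s : Store I A X) (a : A) (hs : s.before a = []) :
    Exec (readCode a) s
      { (s.setCtr .addr 0).setTape a []
          (prefixCells (s.after a) (s.ctr .addr) ++ (s.after a).drop (s.ctr .addr)) with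
        res := (s.after a).getD (s.ctr .addr) false :: s.res }
      (s.ctr .addr * 9 + 4) := by
  have h₁ := exec_seek s a hs
  set s' := (s.setCtr .addr 0).setTape a (prefixCells (s.after a) (s.ctr .addr)).reverse
      ((s.after a).drop (s.ctr .addr)) with hs'
  have h₂ : Exec (.ite (.after a) (fun b => b.getD false) (pushRes true) (pushRes false)) s'
      { s' with res := (s.after a).getD (s.ctr .addr) false :: s.res } 2 := by
    have e : (s'.stk (.after a)).head?.getD false = (s.after a).getD (s.ctr .addr) false := by
      simp [hs', stk_setTape]
    have := fun b => exec_pushRes s' b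
    cases hb : (s.after a).getD (s.ctr .addr) false
    · exact .iteFalse (e.trans hb) (exec_pushRes s' false)
    · exact .iteTrue (e.trans hb) (exec_pushRes s' true)
  have h₃ := exec_rewind { s' with res := (s.after a).getD (s.ctr .addr) false :: s.res } a
    (prefixCells (s.after a) (s.ctr .addr)).reverse ((s.after a).drop (s.ctr .addr))
  rw [show Store.setTape { s' with res := (s.after a).getD (s.ctr .addr) false :: s.res } a
    (prefixCells (s.after a) (s.ctr .addr)).reverse ((s.after a).drop (s.ctr .addr)) =
      { s' with res := (s.after a).getD (s.ctr .addr) false :: s.res } by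
    simp [hs', Store.setTape]] at h₃
  rw [show Store.setTape { s' with res := (s.after a).getD (s.ctr .addr) false :: s.res } a []
      ((prefixCells (s.after a) (s.ctr .addr)).reverse.reverse ++ (s.after a).drop (s.ctr .addr)) =
      { (s.setCtr .addr 0).setTape a []
          (prefixCells (s.after a) (s.ctr .addr) ++ (s.after a).drop (s.ctr .addr)) with
        res := (s.after a).getD (s.ctr .addr) false :: s.res } by
    simp [hs', Store.setTape]] at h₃
  exact (h₁.seq (h₂.seq h₃)).mono (by simp; lia)

/-- Pop a result, and if it is `true`, set the bit of tape `a` at the address in `Ctr.addr`. -/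
def setCode (a : A) : SProg I A X :=
  .seq (seek a) (.seq (iteRes (.seq (.pop (.after a)) (.push (.after a) true)) .skip)
    (.seq popRes (rewind a)))

theorem exec_setCode (s : Store I A X) (a : A) (hs : s.before a = []) {b : Bool} {r : List Bool}
    (hr : s.res = b :: r) :
    Exec (setCode a) s
      { (s.setCtr .addr 0).setTape a []
          (prefixCells (s.after a) (s.ctr .addr) ++
            if b then true :: (s.after a).drop (s.ctr .addr + 1)
            else (s.after a).drop (s.ctr .addr)) with
        res := r }
      (s.ctr .addr * 9 + 6) := by
  have h₁ := exec_seek s a hs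
  set l := (prefixCells (s.after a) (s.ctr .addr)).reverse with hl
  set t := if b then true :: (s.after a).drop (s.ctr .addr + 1)
    else (s.after a).drop (s.ctr .addr) with ht
  have h₂ : Exec (iteRes (.seq (.pop (.after a)) (.push (.after a) true)) .skip)
      ((s.setCtr .addr 0).setTape a l ((s.after a).drop (s.ctr .addr)))
      ((s.setCtr .addr 0).setTape a l t) 3 := by
    refine exec_iteRes (b := b) (r := r) (by simpa [Store.setTape, Store.setCtr] using hr) ?_
    cases b
    · exact (Exec.skip _).mono (by simp)
    · refine Exec.seq (s' := (s.setCtr .addr 0).setTape a l ((s.after a).drop (s.ctr .addr + 1)))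
        (m := 1) (n := 1) (.pop ?_) (.push ?_)
      · simp [stk_setTape]
      · simp [stk_setTape, ht]
  have h₃ := exec_popRes ((s.setCtr .addr 0).setTape a l t)
  have h₄ := exec_rewind { s.setCtr .addr 0 with res := r } a l t
  rw [show { (s.setCtr .addr 0).setTape a l t with
      res := ((s.setCtr .addr 0).setTape a l t).res.tail } =
      Store.setTape { s.setCtr .addr 0 with res := r } a l t by
    simp [Store.setTape, Store.setCtr, hr]] at h₃
  have h₅ := h₁.seq (h₂.seq (h₃.seq h₄))
  rw [hl, List.reverse_reverse] at h₅
  exact h₅.mono (by simp; lia)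

end StackProgram

namespace StackProgram

open Function

variable {I A X : Type} [DecidableEq A] [DecidableEq X]

/-! ### Formulas and fixpoint programs -/

/-- First-order formulas over the ordered domain `0, …, N - 1`, with relations named by `A`. -/
inductive Fm (A X : Type)
  | lt (x y : X)
  | rel (a : A) (xs : List X)
  | neg (φ : Fm A X)
  | and (φ ψ : Fm A X)
  | ex (x : X) (φ : Fm A X)

/-- The variables that are quantified in a formula. -/
def Fm.binds : Fm A X → List X
  | .lt _ _ => []
  | .rel _ _ => []
  | .neg φ => φ.binds
  | .and φ ψ => φ.binds ++ ψ.binds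
  | .ex x φ => x :: φ.binds

/-- No variable is quantified in the scope of a quantifier over the same variable, and all relations
have arity at most `d`. -/
def Fm.wf (d : ℕ) : Fm A X → Bool
  | .lt _ _ => true
  | .rel _ xs => decide (xs.length ≤ d)
  | .neg φ => φ.wf d
  | .and φ ψ => φ.wf d && ψ.wf d
  | .ex x φ => decide (x ∉ φ.binds) && φ.wf d

/-- Truth of a formula, where the relation `a` holds of those tuples whose address is marked
in `M a`. -/
def Fm.Holds (N : ℕ) (M : A → ℕ → Bool) : Fm A X → (X → ℕ) → Prop
  | .lt x y, ρ => ρ x < ρ y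
  | .rel a xs, ρ => M a (address N (xs.map ρ)) = true
  | .neg φ, ρ => ¬ φ.Holds N M ρ
  | .and φ ψ, ρ => φ.Holds N M ρ ∧ ψ.Holds N M ρ
  | .ex x φ, ρ => ∃ i < N, φ.Holds N M (update ρ x i)

/-- Programs that enlarge relations by first-order definable sets. -/
inductive Cmd (A X : Type)
  /-- add the tuple `xs` to the relation `a` if `φ` holds -/
  | upd (a : A) (xs : List X) (φ : Fm A X)
  | seq (c c' : Cmd A X)
  /-- run `c` for `x = 0, …, N - 1` -/
  | loop (x : X) (c : Cmd A X)
  /-- run `c` as often as the size `N` of the domain; the variable `x`, whose value is not touched,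
  serves as a name for the loop counter -/
  | rept (x : X) (c : Cmd A X)

/-- The variables that are bound by the loops and quantifiers of a program. -/
def Cmd.binds : Cmd A X → List X
  | .upd _ _ φ => φ.binds
  | .seq c c' => c.binds ++ c'.binds
  | .loop x c => x :: c.binds
  | .rept x c => x :: c.binds

/-- No variable is bound in the scope of a loop or quantifier over the same variable, and all
relations have arity at most `d`. -/
def Cmd.wf (d : ℕ) : Cmd A X → Bool
  | .upd _ xs φ => decide (xs.length ≤ d) && φ.wf d
  | .seq c c' => c.wf d && c'.wf d
  | .loop x c => decide (x ∉ c.binds) && c.wf d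
  | .rept x c => decide (x ∉ c.binds) && c.wf d

open Classical in
/-- The effect of a program on the relations. -/
noncomputable def Cmd.eval (N : ℕ) : Cmd A X → (X → ℕ) → (A → ℕ → Bool) → A → ℕ → Bool
  | .upd a xs φ, ρ, M => fun b j =>
      if b = a ∧ j = address N (xs.map ρ) ∧ φ.Holds N M ρ then true else M b j
  | .seq c c', ρ, M => c'.eval N ρ (c.eval N ρ M)
  | .loop x c, ρ, M => (List.range N).foldl (fun M i => c.eval N (update ρ x i) M) M
  | .rept _ c, ρ, M => (c.eval N ρ)^[N] M

open Classical in
/-- The truth value of a proposition as a bit. -/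
noncomputable def truthValue (p : Prop) : Bool := decide p

theorem truthValue_of {p : Prop} (h : p) : truthValue p = true := by simp [truthValue, h]

theorem truthValue_of_not {p : Prop} (h : ¬ p) : truthValue p = false := by simp [truthValue, h]

@[simp] theorem truthValue_eq_true {p : Prop} : truthValue p = true ↔ p := by
  simp [truthValue]

/-! ### Evaluation of formulas and programs by stack programs -/

/-- The store between two operations: all tapes are rewound and all auxiliary counters are zero.
The variables have the values `ρ`, and `lv` counts the iterations left in the loops. -/
def idle (N : ℕ) (ρ lv : X → ℕ) (T : A → List Bool) (r : List Bool) : Store I A X where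
  ctr
    | .size => N
    | .var x => ρ x
    | .left x => lv x
    | _ => 0
  before _ := []
  after := T
  res := r
  inp := []
  out := []

/-- The tapes `T` hold the relations `M`. The bound on their length allows for tuples of length at
most `d` and for the symbols of the input. -/
def Stores (N d : ℕ) (T : A → List Bool) (M : A → ℕ → Bool) : Prop :=
  ∀ a, (T a).length ≤ N ^ d + N ∧ ∀ j, (T a).getD j false = M a j

theorem idle_setVar (N : ℕ) (ρ lv : X → ℕ) (T : A → List Bool) (r : List Bool) (x : X) (n : ℕ) :
    (idle N ρ lv T r : Store I A X).setCtr (.var x) n = idle N (update ρ x n) lv T r := by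
  simp only [idle, Store.setCtr, Store.mk.injEq, and_true, and_self]
  funext c
  cases c <;> simp [update_apply]

theorem idle_setLeft (N : ℕ) (ρ lv : X → ℕ) (T : A → List Bool) (r : List Bool) (x : X) (n : ℕ) :
    (idle N ρ lv T r : Store I A X).setCtr (.left x) n = idle N ρ (update lv x n) T r := by
  simp only [idle, Store.setCtr, Store.mk.injEq, and_true, and_self]
  funext c
  cases c <;> simp [update_apply]

theorem idle_setAddr (N : ℕ) (ρ lv : X → ℕ) (T : A → List Bool) (r : List Bool) :
    (idle N ρ lv T r : Store I A X).setCtr .addr 0 = idle N ρ lv T r :=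
  (idle N ρ lv T r : Store I A X).setCtr_self .addr

theorem idle_setTape (N : ℕ) (ρ lv : X → ℕ) (T : A → List Bool) (r : List Bool) (a : A)
    (l : List Bool) :
    (idle N ρ lv T r : Store I A X).setTape a [] l = idle N ρ lv (update T a l) r := by
  simp [idle, Store.setTape]

theorem exec_pushRes_idle (N : ℕ) (ρ lv : X → ℕ) (T : A → List Bool) (r : List Bool) (b : Bool) :
    Exec (I := I) (pushRes b) (idle N ρ lv T r) (idle N ρ lv T (b :: r)) 1 :=
  exec_pushRes _ b

theorem exec_popRes_idle (N : ℕ) (ρ lv : X → ℕ) (T : A → List Bool) (r : List Bool) (b : Bool) :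
    Exec (I := I) popRes (idle N ρ lv T (b :: r)) (idle N ρ lv T r) 1 :=
  exec_popRes _

/-- Repeat `p` as often as `Ctr.size` says, with `Ctr.left x` as loop counter. -/
def reptCode (x : X) (p : SProg I A X) : SProg I A X :=
  .seq (rep .size (inc (.left x))) (loopCtr (.left x) p)

theorem exec_reptCode {p : SProg I A X} {x : X} {N n : ℕ} {ρ lv : X → ℕ} (hx : lv x = 0)
    (Φ : ℕ → (A → List Bool) → Prop) (r : List Bool)
    (h : ∀ i < N, ∀ T, Φ i T → ∀ k, ∃ T', Φ (i + 1) T' ∧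
      Exec p (idle N ρ (update lv x k) T r) (idle N ρ (update lv x k) T' r) n)
    {T : A → List Bool} (hT : Φ 0 T) :
    ∃ T', Φ N T' ∧ Exec (reptCode x p) (idle N ρ lv T r) (idle N ρ lv T' r)
      (N * (n + 9) + 3) := by
  have h₁ := exec_rep_inc (I := I) (A := A) (X := X) (c := .size) (d := .left x) (by simp)
    (by simp) (by simp) (idle N ρ lv T r) rfl
  obtain ⟨s', ⟨T', hT', rfl⟩, h₂⟩ := exec_loopCtr (c := .left x) (p := p) (m := N) (n := n)
    (fun i s => ∃ T, Φ i T ∧ s = idle N ρ lv T r) (by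
      rintro i hi s ⟨T, hT, rfl⟩
      obtain ⟨T', hT', h'⟩ := h i hi T hT (N - 1 - i)
      exact ⟨_, ⟨T', hT', rfl⟩, by simpa only [idle_setLeft] using h'⟩) ⟨T, hT, rfl⟩
  refine ⟨T', hT', ?_⟩
  rw [show (idle N ρ lv T r : Store I A X).ctr (.left x) +
    (idle N ρ lv T r : Store I A X).ctr .size = N by simp [idle, hx]] at h₁
  rw [idle_setLeft _ _ _ _ _ _ 0, show update lv x 0 = lv by rw [← hx, update_eq_self]] at h₂
  refine (h₁.seq h₂).mono ?_
  change N * 7 + 2 + (N * (n + 2) + 1) ≤ _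
  ring_nf
  lia

/-- Run `p` for all values of the variable `x` that are less than `Ctr.size`. -/
def forCode (x : X) (p : SProg I A X) : SProg I A X :=
  .seq (rep .size (inc (.left x))) (.seq (loopCtr (.left x) (.seq p (inc (.var x))))
    (clearCtr (.var x)))

theorem exec_forCode {p : SProg I A X} {x : X} {N n : ℕ} {ρ lv : X → ℕ} (hx : lv x = 0)
    (hx' : ρ x = 0) (Φ : ℕ → (A → List Bool) → List Bool → Prop)
    (h : ∀ i < N, ∀ T r, Φ i T r → ∀ k, ∃ T' r', Φ (i + 1) T' r' ∧
      Exec p (idle N (update ρ x i) (update lv x k) T r)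
        (idle N (update ρ x i) (update lv x k) T' r') n)
    {T : A → List Bool} {r : List Bool} (hT : Φ 0 T r) :
    ∃ T' r', Φ N T' r' ∧ Exec (forCode x p) (idle N ρ lv T r) (idle N ρ lv T' r')
      (N * (n + 13) + 4) := by
  have h₁ := exec_rep_inc (I := I) (A := A) (X := X) (c := .size) (d := .left x) (by simp)
    (by simp) (by simp) (idle N ρ lv T r) rfl
  obtain ⟨s', ⟨T', r', hT', rfl⟩, h₂⟩ := exec_loopCtr (c := .left x) (p := .seq p (inc (.var x)))
    (m := N) (n := n + 1) (fun i s => ∃ T r, Φ i T r ∧ s = idle N (update ρ x i) lv T r) (by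
      rintro i hi s ⟨T, r, hT, rfl⟩
      obtain ⟨T', r', hT', h'⟩ := h i hi T r hT (N - 1 - i)
      refine ⟨_, ⟨T', r', hT', rfl⟩, ?_⟩
      have := h'.seq (exec_inc _ (.var x))
      rw [idle_setVar, update_idem] at this
      rw [idle_setLeft, idle_setLeft]
      simpa [idle] using this) ⟨T, r, hT, rfl⟩
  refine ⟨T', r', hT', ?_⟩
  rw [show (idle N ρ lv T r : Store I A X).ctr (.left x) +
    (idle N ρ lv T r : Store I A X).ctr .size = N by simp [idle, hx]] at h₁
  have h₃ := exec_clearCtr (idle N (update ρ x N) lv T' r' : Store I A X) (.var x)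
  rw [idle_setVar, update_idem] at h₃
  have e : update ρ x 0 = ρ := by rw [← hx', update_eq_self]
  rw [idle_setLeft _ _ _ _ _ _ 0, show update lv x 0 = lv by rw [← hx, update_eq_self], e] at h₂
  rw [e] at h₃
  refine (h₁.seq (h₂.seq h₃)).mono ?_
  rw [show (idle N (update ρ x N) lv T' r' : Store I A X).ctr (.var x) = N by simp [idle]]
  change N * 7 + 2 + (N * (n + 1 + 2) + 1 + (N * 3 + 1)) ≤ _
  ring_nf
  lia

/-- Push the truth value of a formula on the stack of results. -/
def Fm.code : Fm A X → SProg I A X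
  | .lt x y => .seq (rep (.var y) (inc .addr)) (.seq (rep (.var x) (dec .addr))
      (.seq (.ite (.ctr .addr) Option.isSome (pushRes true) (pushRes false)) (clearCtr .addr)))
  | .rel a xs => .seq (addressCode xs) (readCode a)
  | .neg φ => .seq φ.code (iteRes (.seq popRes (pushRes false)) (.seq popRes (pushRes true)))
  | .and φ ψ => .seq φ.code (.seq ψ.code (iteRes popRes
      (.seq popRes (.seq popRes (pushRes false)))))
  | .ex x φ => .seq (pushRes false) (forCode x (.seq φ.code
      (iteRes (.seq popRes (.seq popRes (pushRes true))) popRes)))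

theorem getD_prefixCells_append (l : List Bool) (u : ℕ) (t : List Bool) (j : ℕ) :
    (prefixCells l u ++ t).getD j false =
      if j < u then l.getD j false else t.getD (j - u) false := by
  simp only [List.getD_eq_getElem?_getD, List.getElem?_append, length_prefixCells]
  split_ifs with h
  · simp [prefixCells, h]
  · rfl

theorem getD_drop_eq (l : List Bool) (u j : ℕ) (h : u ≤ j) :
    (l.drop u).getD (j - u) false = l.getD j false := by
  simp [List.getD_eq_getElem?_getD, List.getElem?_drop, Nat.add_sub_cancel' h]

theorem exec_addressCode_idle {N d : ℕ} (hN : 0 < N) {ρ lv : X → ℕ} (hρ : ∀ x, ρ x < N)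
    (T : A → List Bool) (r : List Bool) (xs : List X) (hxs : xs.length ≤ d) :
    Exec (I := I) (addressCode xs) (idle N ρ lv T r)
      ((idle N ρ lv T r).setCtr .addr (address N (xs.map ρ)))
      (d * (N ^ d * (N * 10 + 4) + N * 7 + 4) + 1) := by
  have h := exec_addressCode (idle N ρ lv T r : Store I A X) rfl rfl (N ^ d) hN xs
    (fun x _ => hρ x) 0 (by simpa [idle] using Nat.pow_le_pow_right hN hxs)
  rw [idle_setAddr] at h
  exact h.mono (Nat.add_le_add_right (Nat.mul_le_mul_right _ hxs) _)

theorem Fm.exec_code {d : ℕ} (φ : Fm A X) (hφ : φ.wf d = true) :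
    ∃ P : Polynomial ℕ, ∀ N, 0 < N → ∀ (M : A → ℕ → Bool) (ρ lv : X → ℕ), (∀ x, ρ x < N) →
      (∀ x ∈ φ.binds, ρ x = 0 ∧ lv x = 0) → ∀ T r, Stores N d T M → ∃ T', Stores N d T' M ∧
        Exec (I := I) φ.code (idle N ρ lv T r) (idle N ρ lv T' (truthValue (φ.Holds N M ρ) :: r))
          (P.eval N) := by
  induction φ with
  | lt x y =>
    refine ⟨.C 17 * .X + 7, fun N hN M ρ lv hρ _ T r hT => ⟨T, hT, ?_⟩⟩
    have h₁ := exec_rep_inc (I := I) (c := .var y) (d := .addr) (by simp) (by simp) (by simp)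
      (idle N ρ lv T r) rfl
    have h₂ := exec_rep_dec (I := I) (c := .var x) (d := .addr) (by simp) (by simp) (by simp)
      ((idle N ρ lv T r).setCtr .addr (ρ y)) rfl
    rw [Store.setCtr_setCtr, Store.ctr_setCtr_self, Store.ctr_setCtr_of_ne _ (by simp)] at h₂
    rw [show (idle N ρ lv T r : Store I A X).ctr .addr +
        (idle N ρ lv T r : Store I A X).ctr (.var y)
      = ρ y from Nat.zero_add _] at h₁
    have h₃ : Exec (I := I) (.ite (.ctr .addr) Option.isSome (pushRes true) (pushRes false))
        ((idle N ρ lv T r).setCtr .addr (ρ y - ρ x))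
        ((idle N ρ lv T (truthValue (ρ x < ρ y) :: r)).setCtr .addr (ρ y - ρ x)) 2 := by
      by_cases hxy : ρ x < ρ y
      · rw [truthValue_of hxy]
        refine .iteTrue ?_ (exec_pushRes _ true)
        simp [Store.stk, List.head?_replicate, Nat.sub_eq_zero_iff_le, hxy]
      · rw [truthValue_of_not hxy]
        refine .iteFalse ?_ (exec_pushRes _ false)
        simp [Store.stk, Nat.sub_eq_zero_of_le (not_lt.1 hxy)]
    have h₄ := exec_clearCtr (I := I)
      ((idle N ρ lv T (truthValue (ρ x < ρ y) :: r)).setCtr .addr (ρ y - ρ x)) .addr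
    rw [Store.setCtr_setCtr, Store.ctr_setCtr_self, idle_setAddr] at h₄
    refine (h₁.seq (h₂.seq (h₃.seq h₄))).mono ?_
    have hx := hρ x
    have hy := hρ y
    simp only [idle, Polynomial.eval_add, Polynomial.eval_mul, Polynomial.eval_C,
      Polynomial.eval_X, Polynomial.eval_ofNat]
    lia
  | rel a xs =>
    have hxs : xs.length ≤ d := by simpa [Fm.wf] using hφ
    refine ⟨.C d * (.X ^ d * (.X * 10 + 4) + .X * 7 + 4) + 1 + (.X ^ d * 9 + 4),
      fun N hN M ρ lv hρ _ T r hT => ?_⟩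
    have h₁ := exec_addressCode_idle (I := I) (d := d) (lv := lv) hN hρ T r xs hxs
    have hu : address N (xs.map ρ) < N ^ d :=
      (address_lt (by simpa using fun x _ => hρ x)).trans_le
        (by simpa using Nat.pow_le_pow_right hN hxs)
    set u := address N (xs.map ρ) with hu'
    have h₂ := exec_readCode ((idle N ρ lv T r : Store I A X).setCtr .addr u) a rfl
    refine ⟨update T a (prefixCells (T a) u ++ (T a).drop u), fun b => ?_, ?_⟩
    · rcases eq_or_ne b a with rfl | hb
      · refine ⟨?_, fun j => ?_⟩
        · have := (hT b).1
          simp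
          lia
        · rw [← (hT b).2, update_self, getD_prefixCells_append]
          split_ifs with hj
          · rfl
          · exact getD_drop_eq _ _ _ (not_lt.1 hj)
      · simpa [hb] using hT b
    · rw [Store.setCtr_setCtr, Store.ctr_setCtr_self, idle_setAddr] at h₂
      have e : (T a).getD u false = truthValue ((Fm.rel a xs).Holds N M ρ) := by
        rw [(hT a).2]
        simp [Fm.Holds, truthValue, ← hu']
      have h₃ := h₁.seq h₂
      rw [show (Store.setCtr (idle N ρ lv T r : Store I A X) .addr u).after a = T a from rfl, e,
        idle_setTape] at h₃
      have h₄ : u * 9 + 4 ≤ N ^ d * 9 + 4 := by lia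
      have h₅ := h₃.mono (Nat.add_le_add_left h₄ _)
      exact h₅.mono (by simp)
  | neg φ ih =>
    obtain ⟨P, hP⟩ := ih hφ
    refine ⟨P + 3, fun N hN M ρ lv hρ hb T r hT => ?_⟩
    obtain ⟨T', hT', h⟩ := hP N hN M ρ lv hρ hb T r hT
    refine ⟨T', hT', (h.seq (exec_iteRes (n := 2) rfl ?_)).mono (by simp)⟩
    by_cases hφ' : φ.Holds N M ρ
    · simpa [Fm.Holds, truthValue, hφ'] using
        (exec_popRes_idle N ρ lv T' r _).seq (exec_pushRes_idle ..)
    · simpa [Fm.Holds, truthValue, hφ'] using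
        (exec_popRes_idle N ρ lv T' r _).seq (exec_pushRes_idle ..)
  | and φ ψ ih₁ ih₂ =>
    simp only [Fm.wf, Bool.and_eq_true] at hφ
    obtain ⟨P, hP⟩ := ih₁ hφ.1
    obtain ⟨Q, hQ⟩ := ih₂ hφ.2
    refine ⟨P + (Q + 4), fun N hN M ρ lv hρ hb T r hT => ?_⟩
    simp only [Fm.binds, List.mem_append] at hb
    obtain ⟨T', hT', h⟩ := hP N hN M ρ lv hρ (fun x hx => hb x (.inl hx)) T r hT
    obtain ⟨T'', hT'', h'⟩ := hQ N hN M ρ lv hρ (fun x hx => hb x (.inr hx)) T' _ hT'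
    refine ⟨T'', hT'', (h.seq (h'.seq (exec_iteRes (n := 3) rfl ?_))).mono (by simp)⟩
    by_cases hψ' : ψ.Holds N M ρ
    · rw [show truthValue ((Fm.and φ ψ).Holds N M ρ) = truthValue (φ.Holds N M ρ) from
        congrArg _ (propext ⟨And.left, fun h => ⟨h, hψ'⟩⟩), truthValue_of hψ']
      exact (exec_popRes_idle N ρ lv T'' _ _).mono (show 1 ≤ 3 by simp)
    · simpa [Fm.Holds, truthValue, hψ'] using (exec_popRes_idle N ρ lv T'' _ _).seq
        ((exec_popRes_idle N ρ lv T'' r _).seq (exec_pushRes_idle ..))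
  | ex x φ ih =>
    simp only [Fm.wf, Bool.and_eq_true, decide_eq_true_eq] at hφ
    obtain ⟨P, hP⟩ := ih hφ.2
    refine ⟨1 + (.X * (P + 4 + 13) + 4), fun N hN M ρ lv hρ hb T r hT => ?_⟩
    simp only [Fm.binds, List.mem_cons, forall_eq_or_imp] at hb
    have h₁ := exec_pushRes_idle (I := I) N ρ lv T r false
    obtain ⟨T', r', ⟨hT', rfl⟩, h₂⟩ := exec_forCode (I := I)
      (p := .seq φ.code (iteRes (.seq popRes (.seq popRes (pushRes true))) popRes))
      (N := N) (n := P.eval N + 4) hb.1.2 hb.1.1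
      (fun i T' r' => Stores N d T' M ∧ r' = truthValue (∃ j < i, φ.Holds N M (update ρ x j)) :: r)
      (by
        rintro i hi T r' ⟨hT, rfl⟩ k
        obtain ⟨T', hT', h⟩ := hP N hN M (update ρ x i) (update lv x k)
          (fun y => by rw [update_apply]; split_ifs; exacts [hi, hρ y])
          (fun y hy => by
            have : y ≠ x := fun h => hφ.1 (h ▸ hy)
            simpa [this] using hb.2 y hy) T _ hT
        refine ⟨T', _, ⟨hT', rfl⟩, (h.seq (exec_iteRes (n := 3) rfl ?_)).mono (by simp)⟩
        by_cases hφ' : φ.Holds N M (update ρ x i)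
        · have : truthValue (∃ j < i + 1, φ.Holds N M (update ρ x j)) = true :=
            truthValue_of ⟨i, by simp, hφ'⟩
          rw [this, truthValue_of hφ']
          exact (exec_popRes_idle N _ _ T' _ _).seq
            ((exec_popRes_idle N _ _ T' r _).seq (exec_pushRes_idle ..))
        · have : truthValue (∃ j < i + 1, φ.Holds N M (update ρ x j)) =
              truthValue (∃ j < i, φ.Holds N M (update ρ x j)) := by
            refine congrArg truthValue (propext ⟨fun ⟨j, hj, h⟩ => ⟨j, ?_, h⟩, fun ⟨j, hj, h⟩ =>
              ⟨j, by lia, h⟩⟩)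
            refine lt_of_le_of_ne (by lia) ?_
            rintro rfl
            exact hφ' ‹_›
          rw [this, truthValue_of_not hφ']
          exact (exec_popRes_idle N _ _ T' _ _).mono (by simp))
      (T := T) (r := false :: r) ⟨hT, by rw [truthValue_of_not (by simp)]⟩
    exact ⟨T', hT', (h₁.seq h₂).mono (by simp)⟩

/-- The stack program that carries out a fixpoint program. -/
def Cmd.code : Cmd A X → SProg I A X
  | .upd a xs φ => .seq φ.code (.seq (addressCode xs) (setCode a))
  | .seq c c' => .seq c.code c'.code
  | .loop x c => forCode x c.code
  | .rept x c => reptCode x c.code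

theorem Cmd.exec_code {d : ℕ} (c : Cmd A X) (hc : c.wf d = true) :
    ∃ P : Polynomial ℕ, ∀ N, 0 < N → ∀ (M : A → ℕ → Bool) (ρ lv : X → ℕ), (∀ x, ρ x < N) →
      (∀ x ∈ c.binds, ρ x = 0 ∧ lv x = 0) → ∀ T, Stores N d T M →
        ∃ T', Stores N d T' (c.eval N ρ M) ∧
          Exec (I := I) c.code (idle N ρ lv T []) (idle N ρ lv T' []) (P.eval N) := by
  induction c with
  | upd a xs φ =>
    simp only [Cmd.wf, Bool.and_eq_true, decide_eq_true_eq] at hc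
    obtain ⟨hxs, hφ⟩ := hc
    obtain ⟨P, hP⟩ := φ.exec_code (I := I) hφ
    refine ⟨P + (.C d * (.X ^ d * (.X * 10 + 4) + .X * 7 + 4) + 1 + (.X ^ d * 9 + 6)),
      fun N hN M ρ lv hρ hb T hT => ?_⟩
    obtain ⟨T', hT', h⟩ := hP N hN M ρ lv hρ hb T [] hT
    have h₁ := exec_addressCode_idle (I := I) (d := d) (lv := lv) hN hρ T'
      [truthValue (φ.Holds N M ρ)] xs hxs
    have hu : address N (xs.map ρ) < N ^ d :=
      (address_lt (by simpa using fun x _ => hρ x)).trans_le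
        (by simpa using Nat.pow_le_pow_right hN hxs)
    set u := address N (xs.map ρ) with hu'
    set b := truthValue (φ.Holds N M ρ) with hb'
    have h₂ := exec_setCode ((idle N ρ lv T' [b] : Store I A X).setCtr .addr u) a rfl rfl
    rw [Store.setCtr_setCtr, Store.ctr_setCtr_self, idle_setAddr, idle_setTape,
      show (Store.setCtr (idle N ρ lv T' [b] : Store I A X) .addr u).after a = T' a from rfl] at h₂
    refine ⟨update T' a (prefixCells (T' a) u ++
      if b = true then true :: (T' a).drop (u + 1) else (T' a).drop u), fun a' => ?_, ?_⟩
    · rcases eq_or_ne a' a with rfl | ha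
      · refine ⟨?_, fun j => ?_⟩
        · have := (hT' a').1
          cases b <;> simp <;> lia
        · rw [update_self, getD_prefixCells_append]
          simp only [Cmd.eval, true_and]
          by_cases hφ' : φ.Holds N M ρ
          · rw [truthValue_of hφ'] at hb'
            simp only [hb', if_true, hφ', and_true, ← hu']
            rcases lt_trichotomy j u with hj | rfl | hj
            · rw [if_pos hj, if_neg (by simp [hj.ne]), (hT' a').2]
            · simp
            · rw [if_neg (by lia), if_neg (by simp [hj.ne']), ← (hT' a').2,
                show j - u = j - (u + 1) + 1 by lia,
                List.getD_cons_succ, getD_drop_eq _ _ _ hj]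
          · rw [truthValue_of_not hφ'] at hb'
            simp only [hb', hφ', and_false, if_false, Bool.false_eq_true]
            rw [← (hT' a').2]
            split_ifs with hj
            · rfl
            · exact getD_drop_eq _ _ _ (not_lt.1 hj)
      · simpa [ha, Cmd.eval] using hT' a'
    · have h₃ : Exec (I := I) (Cmd.upd a xs φ).code _ _ _ := h.seq (h₁.seq h₂)
      have h₄ : u * 9 + 6 ≤ N ^ d * 9 + 6 := by lia
      have h₅ := h₃.mono (Nat.add_le_add_left (Nat.add_le_add_left h₄ _) _)
      exact h₅.mono (by simp)
  | seq c c' ih₁ ih₂ =>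
    simp only [Cmd.wf, Bool.and_eq_true] at hc
    obtain ⟨P, hP⟩ := ih₁ hc.1
    obtain ⟨Q, hQ⟩ := ih₂ hc.2
    refine ⟨P + Q, fun N hN M ρ lv hρ hb T hT => ?_⟩
    simp only [Cmd.binds, List.mem_append] at hb
    obtain ⟨T', hT', h⟩ := hP N hN M ρ lv hρ (fun x hx => hb x (.inl hx)) T hT
    obtain ⟨T'', hT'', h'⟩ := hQ N hN _ ρ lv hρ (fun x hx => hb x (.inr hx)) T' hT'
    exact ⟨T'', hT'', (h.seq h').mono (by simp)⟩
  | loop x c ih =>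
    simp only [Cmd.wf, Bool.and_eq_true, decide_eq_true_eq] at hc
    obtain ⟨P, hP⟩ := ih hc.2
    refine ⟨.X * (P + 13) + 4, fun N hN M ρ lv hρ hb T hT => ?_⟩
    simp only [Cmd.binds, List.mem_cons, forall_eq_or_imp] at hb
    obtain ⟨T', r', ⟨hT', rfl⟩, h⟩ := exec_forCode (I := I) (p := c.code) (N := N) (n := P.eval N)
      hb.1.2 hb.1.1 (fun i T r => Stores N d T
        ((List.range i).foldl (fun M i => c.eval N (update ρ x i) M) M) ∧ r = [])
      (by
        rintro i hi T r ⟨hT, rfl⟩ k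
        obtain ⟨T', hT', h⟩ := hP N hN _ (update ρ x i) (update lv x k)
          (fun y => by rw [update_apply]; split_ifs; exacts [hi, hρ y])
          (fun y hy => by
            have : y ≠ x := fun h => hc.1 (h ▸ hy)
            simpa [this] using hb.2 y hy) T hT
        exact ⟨T', [], ⟨by simpa [List.range_succ] using hT', rfl⟩, h⟩) (T := T) (r := [])
      ⟨hT, rfl⟩
    exact ⟨T', hT', h.mono (by simp)⟩
  | rept x c ih =>
    simp only [Cmd.wf, Bool.and_eq_true, decide_eq_true_eq] at hc
    obtain ⟨P, hP⟩ := ih hc.2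
    refine ⟨.X * (P + 9) + 3, fun N hN M ρ lv hρ hb T hT => ?_⟩
    simp only [Cmd.binds, List.mem_cons, forall_eq_or_imp] at hb
    obtain ⟨T', hT', h⟩ := exec_reptCode (I := I) (p := c.code) (N := N) (n := P.eval N)
      hb.1.2 (fun i T => Stores N d T ((c.eval N ρ)^[i] M)) []
      (by
        rintro i hi T hT k
        obtain ⟨T', hT', h⟩ := hP N hN _ ρ (update lv x k) hρ
          (fun y hy => by
            have : y ≠ x := fun h => hc.1 (h ▸ hy)
            simpa [this] using hb.2 y hy) T hT
        exact ⟨T', by simpa only [iterate_succ_apply'] using hT', h⟩) (T := T) hT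
    exact ⟨T', hT', h.mono (by simp)⟩

end StackProgram

namespace StackProgram

open Function Turing

/-! ### Problems defined by fixpoint programs are decidable in polynomial time -/

section Sequences

variable {I A X : Type} [DecidableEq A] [DecidableEq X]

/-- Run the programs `f a` for the members `a` of a list. -/
def seqList {ι : Type} (f : ι → SProg I A X) : List ι → SProg I A X
  | [] => .skip
  | a :: l => .seq (f a) (seqList f l)

/-- The rule for `seqList`: `F l₁` is the store when the members of `l₁` have been dealt with. -/
theorem exec_seqList {ι : Type} {f : ι → SProg I A X} {n : ℕ} (F : List ι → Store I A X)
    (l : List ι) (h : ∀ l₁ a l₂, l = l₁ ++ a :: l₂ → Exec (f a) (F l₁) (F (l₁ ++ [a])) n) :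
    Exec (seqList f l) (F []) (F l) (l.length * n + 1) := by
  induction l generalizing F with
  | nil => exact (Exec.skip _).mono (by simp)
  | cons a l ih =>
    have h₁ := h [] a l rfl
    have h₂ := ih (fun l₁ => F (a :: l₁)) (fun l₁ b l₂ hl => h (a :: l₁) b l₂ (by simp [hl]))
    exact (h₁.seq h₂).mono (by rw [List.length_cons, Nat.succ_mul]; lia)

/-- Erase tape `a`, which has to be rewound. -/
def eraseTape (a : A) : SProg I A X := .loop (.after a) Option.isSome (.pop (.after a))

theorem exec_eraseTape (s : Store I A X) (a : A) (l : List Bool) :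
    Exec (eraseTape a) { s with after := update s.after a l }
      { s with after := update s.after a [] } (l.length * 2 + 1) := by
  induction l with
  | nil => exact (Exec.loopStop (by simp [stk_setAfter])).mono (by simp)
  | cons b l ih =>
    refine Exec.mono (Exec.loopStep (m := 1) (by simp [stk_setAfter]) (.pop ?_) ih)
      (by simp; lia)
    simp [stk_setAfter]

end Sequences

variable {I R X : Type} [DecidableEq I] [DecidableEq R] [DecidableEq X]

/-- Write on the tape of symbol `a` whether the next input symbol is `a`. -/
def recordSymbol (a : I) : SProg I (I ⊕ R) X :=
  .ite .inp (fun b => decide (b = some a)) (.push (.before (.inl a)) true)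
    (.push (.before (.inl a)) false)

/-- The store while the input is read: `u` is the part that has been read, in reverse order, and `v`
the part that is left. On top of that, the next symbol `b` has been recorded for the symbols in
`l`. -/
def readStore (u v : List I) (b : I) (l : List I) : Store I (I ⊕ R) X where
  ctr
    | .size => u.length
    | _ => 0
  before
    | .inl a => (if a ∈ l then [decide (b = a)] else []) ++ u.map fun c => decide (c = a)
    | .inr _ => []
  after _ := []
  res := []
  inp := v
  out := []

/-- Read the input, count its length, and write for each symbol on a tape of its own where in the
input it occurs. -/
def readInput (l : List I) : SProg I (I ⊕ R) X :=
  .loop .inp Option.isSome (.seq (seqList recordSymbol l) (.seq (.pop .inp) (inc .size)))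

theorem exec_readInput (l : List I) (hl : l.Nodup) (hl' : ∀ a, a ∈ l) (u v : List I) (b : I) :
    Exec (readInput l) (readStore u v b [] : Store I (I ⊕ R) X)
      (readStore (v.reverse ++ u) [] b []) (v.length * (l.length * 2 + 4) + 1) := by
  induction v generalizing u with
  | nil => exact (Exec.loopStop (by simp [Store.stk, readStore])).mono (by simp)
  | cons c v ih =>
    have h₁ := exec_seqList (f := recordSymbol) (n := 2)
      (fun l₁ => (readStore u (c :: v) c l₁ : Store I (I ⊕ R) X)) l (by
        rintro l₁ a l₂ rfl
        have ha : a ∉ l₁ := by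
          rw [List.nodup_append] at hl
          exact fun h => hl.2.2 a h a (by simp) rfl
        have h : ∀ e : Bool, decide (c = a) = e → Exec (.push (.before (.inl a)) e)
            (readStore u (c :: v) c l₁ : Store I (I ⊕ R) X)
            (readStore u (c :: v) c (l₁ ++ [a])) 1 := by
          rintro _ rfl
          refine .push ?_
          rw [show (readStore u (c :: v) c (l₁ ++ [a]) : Store I (I ⊕ R) X) =
            { (readStore u (c :: v) c l₁ : Store I (I ⊕ R) X) with
              before := update (readStore u (c :: v) c l₁ : Store I (I ⊕ R) X).before (.inl a)
                (decide (c = a) :: (readStore u (c :: v) c l₁ : Store I (I ⊕ R) X).before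
                  (.inl a)) } by
            simp only [readStore, Store.mk.injEq, and_true, true_and]
            funext x
            rcases x with x | x
            · rcases eq_or_ne x a with rfl | hx
              · simp [ha]
              · simp [hx]
            · simp, stk_setBefore]
          rfl
        by_cases hc : c = a
        · exact .iteTrue (by simp [Store.stk, readStore, hc]) (h true (by simp [hc]))
        · exact .iteFalse (by simp [Store.stk, readStore, hc]) (h false (by simp [hc])))
    have h₂ : Exec (.pop .inp) (readStore u (c :: v) c l : Store I (I ⊕ R) X)
        { (readStore u (c :: v) c l : Store I (I ⊕ R) X) with inp := v } 1 :=
      .pop (by rw [stk_setInp]; rfl)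
    have h₃ := exec_inc { (readStore u (c :: v) c l : Store I (I ⊕ R) X) with inp := v } .size
    have e₁ : (readStore u (c :: v) b [] : Store I (I ⊕ R) X) = readStore u (c :: v) c [] := by
      simp [readStore]
    have e₂ : Store.setCtr { (readStore u (c :: v) c l : Store I (I ⊕ R) X) with inp := v } .size
        (Store.ctr { (readStore u (c :: v) c l : Store I (I ⊕ R) X) with inp := v } .size + 1) =
        readStore (c :: u) v b [] := by
      simp only [readStore, Store.setCtr, Store.mk.injEq, and_true]
      refine ⟨?_, ?_⟩
      · funext x
        cases x <;> simp
      · funext x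
        cases x <;> simp [hl']
    rw [e₂] at h₃
    rw [e₁]
    have h₄ := ih (c :: u)
    have h₅ := Exec.loopStep (k := Stack.inp) (f := Option.isSome)
      (s := (readStore u (c :: v) c [] : Store I (I ⊕ R) X)) (by simp [Store.stk, readStore])
      (h₁.seq (h₂.seq h₃)) h₄
    rw [show (c :: v).reverse ++ u = v.reverse ++ c :: u by simp]
    exact Exec.mono h₅ (by rw [List.length_cons, Nat.succ_mul]; lia)

/-- The relations given by an input word: for each symbol, the set of its positions. All other
relations are empty. -/
def inputRel (w : List I) : I ⊕ R → ℕ → Bool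
  | .inl a => fun j => decide (w[j]? = some a)
  | .inr _ => fun _ => false

/-- The tapes that hold the relations given by an input word. -/
def inputTape (w : List I) : I ⊕ R → List Bool
  | .inl a => w.map fun c => decide (c = a)
  | .inr _ => []

theorem stores_inputTape (w : List I) (d : ℕ) :
    Stores w.length d (inputTape w : I ⊕ R → List Bool) (inputRel w) := by
  rintro (a | r)
  · refine ⟨by simp [inputTape], fun j => ?_⟩
    simp only [inputTape, inputRel, List.getD_eq_getElem?_getD, List.getElem?_map]
    cases w[j]? <;> simp
  · simp [inputTape, inputRel]

theorem exec_rewindInput (l : List I) (hl : l.Nodup) (hl' : ∀ a, a ∈ l) (w : List I) (b : I) :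
    Exec (seqList (fun a => rewind (.inl a)) l)
      (readStore w.reverse [] b [] : Store I (I ⊕ R) X)
      (idle w.length (fun _ => 0) (fun _ => 0) (inputTape w) [])
      (l.length * (w.length * 4 + 1) + 1) := by
  set F : List I → Store I (I ⊕ R) X := fun l₁ =>
    { (readStore w.reverse [] b [] : Store I (I ⊕ R) X) with
      before := fun
        | .inl a => if a ∈ l₁ then [] else w.reverse.map fun c => decide (c = a)
        | .inr _ => []
      after := fun
        | .inl a => if a ∈ l₁ then w.map fun c => decide (c = a) else []
        | .inr _ => [] } with hF
  have h := exec_seqList (f := fun a => rewind (.inl a)) (n := w.length * 4 + 1) F l (by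
    rintro l₁ a l₂ rfl
    have ha : a ∉ l₁ := by
      rw [List.nodup_append] at hl
      exact fun h => hl.2.2 a h a (by simp) rfl
    have h := exec_rewind (F l₁) (.inl a) ((F l₁).before (.inl a)) ((F l₁).after (.inl a))
    rw [Store.setTape_self] at h
    refine Exec.mono (?_ : Exec _ _ _ _) (?_ : ((F l₁).before (.inl a)).length * 4 + 1 ≤ _)
    · convert h using 1
      simp only [hF, Store.setTape, Store.mk.injEq, and_true, true_and]
      refine ⟨?_, ?_⟩ <;> funext x <;> rcases x with x | x
      · rcases eq_or_ne x a with rfl | hx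
        · simp
        · simp [hx]
      · simp
      · rcases eq_or_ne x a with rfl | hx
        · simp [ha]
        · simp [hx]
      · simp
    · simp [hF, ha])
  have e₁ : F [] = readStore w.reverse [] b [] := by
    simp only [hF, readStore, Store.mk.injEq, and_true, true_and]
    refine ⟨?_, ?_⟩ <;> funext x <;> cases x <;> simp
  have e₂ : F l = idle w.length (fun _ => 0) (fun _ => 0) (inputTape w) [] := by
    simp only [hF, readStore, idle, Store.mk.injEq, and_true]
    refine ⟨?_, ?_, ?_⟩ <;> funext x <;> cases x <;> simp [hl', inputTape]
  rwa [e₁, e₂] at h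

/-- Write the last result on the output stack, and empty all other stacks. -/
def writeOutput (l : List (I ⊕ R)) : SProg I (I ⊕ R) X :=
  .seq (iteRes (.push .out true) (.push .out false)) (.seq popRes (.seq (clearCtr .size)
    (seqList eraseTape l)))

open Classical in
theorem exec_writeOutput (l : List (I ⊕ R)) (hl : ∀ a, a ∈ l) (N B : ℕ)
    (T : I ⊕ R → List Bool) (hT : ∀ a, (T a).length ≤ B) (b : Bool) :
    Exec (writeOutput l) (idle N (fun _ => 0) (fun _ => 0) T [b] : Store I (I ⊕ R) X)
      { idle 0 (fun _ => 0) (fun _ => 0) (fun _ => []) [] with out := [b] }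
      (N * 3 + 5 + l.length * (B * 2 + 1)) := by
  have h₁ : Exec (iteRes (.push .out true) (.push .out false))
      (idle N (fun _ => 0) (fun _ => 0) T [b] : Store I (I ⊕ R) X)
      { idle N (fun _ => 0) (fun _ => 0) T [b] with out := [b] } 2 := by
    refine exec_iteRes (b := b) (r := []) rfl ?_
    cases b
    · exact .push (by rw [stk_setOut]; rfl)
    · exact .push (by rw [stk_setOut]; rfl)
  have h₂ := exec_popRes { (idle N (fun _ => 0) (fun _ => 0) T [b] : Store I (I ⊕ R) X) with
    out := [b] }
  have h₃ := exec_clearCtr { (idle N (fun _ => 0) (fun _ => 0) T [] : Store I (I ⊕ R) X) with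
    out := [b] } .size
  have h₄ := exec_seqList (f := eraseTape) (n := B * 2 + 1)
    (fun l₁ => { (idle 0 (fun _ => 0) (fun _ => 0)
        (fun a : I ⊕ R => if a ∈ l₁ then [] else T a) [] :
      Store I (I ⊕ R) X) with out := [b] }) l (by
    rintro l₁ a l₂ rfl
    set s : Store I (I ⊕ R) X :=
      { (idle 0 (fun _ => 0) (fun _ => 0) (fun a : I ⊕ R => if a ∈ l₁ then [] else T a) [] :
        Store I (I ⊕ R) X) with out := [b] } with hs
    have h := exec_eraseTape s a (s.after a)
    rw [show { s with after := update s.after a (s.after a) } = s by simp] at h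
    refine Exec.mono (?_ : Exec _ _ _ _) (?_ : (s.after a).length * 2 + 1 ≤ _)
    · convert h using 1
      simp only [hs, idle, Store.mk.injEq, and_true, true_and]
      funext x
      rcases eq_or_ne x a with rfl | hx
      · simp
      · simp [hx]
    · have := hT a
      simp only [hs, idle]
      split_ifs
      · simp
      · lia)
  have e₁ : Store.setCtr { (idle N (fun _ => 0) (fun _ => 0) T [] : Store I (I ⊕ R) X) with
      out := [b] } .size 0 = { (idle 0 (fun _ => 0) (fun _ => 0)
        (fun a : I ⊕ R => if a ∈ ([] : List (I ⊕ R)) then [] else T a) [] :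
        Store I (I ⊕ R) X) with out := [b] } := by
    simp only [idle, Store.setCtr, Store.mk.injEq, and_true]
    refine ⟨?_, ?_⟩
    · funext x
      cases x <;> simp
    · simp
  rw [e₁] at h₃
  simp only [hl, if_true] at h₄
  refine (h₁.seq (h₂.seq (h₃.seq h₄))).mono ?_
  simp only [idle]
  lia

/-- The stack program that decides the problem given by a fixpoint program and a formula. -/
noncomputable def decideProg [Fintype I] [Fintype R] (c : Cmd (I ⊕ R) X) (φ : Fm (I ⊕ R) X) :
    SProg I (I ⊕ R) X :=
  .seq (readInput Finset.univ.toList) (.seq (seqList (fun a => rewind (.inl a)) Finset.univ.toList)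
    (.seq c.code (.seq φ.code (writeOutput Finset.univ.toList))))

/-- A problem is decidable in polynomial time if it is given by a fixpoint program and a formula on
the positions of the (non-empty) input word, with a relation for each symbol. -/
theorem nonempty_tm2ComputableInPolyTime [Fintype I] [Fintype R] [Fintype X] {α : Type}
    (enc : α → List I) (f : α → Bool) (c : Cmd (I ⊕ R) X) (φ : Fm (I ⊕ R) X) (d : ℕ)
    (hc : c.wf d = true) (hφ : φ.wf d = true) (henc : ∀ a, enc a ≠ [])
    (hf : ∀ a, f a = true ↔ φ.Holds (enc a).length
      (c.eval (enc a).length (fun _ => 0) (inputRel (enc a))) fun _ => 0) :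
    Nonempty (TM2ComputableInPolyTime enc Computability.encodeBool f) := by
  obtain ⟨P, hP⟩ := c.exec_code (I := I) hc
  obtain ⟨Q, hQ⟩ := φ.exec_code (I := I) hφ
  obtain ⟨time, H⟩ : ∃ time : Polynomial ℕ, ∀ a, Nonempty (TM2OutputsInTime
      (machine (decideProg c φ) .inp .out) (enc a) (some [f a]) (time.eval (enc a).length)) := by
    refine ⟨(.X * .C ((Finset.univ : Finset I).toList.length * 2 + 4) + 1) +
      (.C (Finset.univ : Finset I).toList.length * (.X * 4 + 1) + 1) + P + Q +
      (.X * 3 + 5 + .C (Finset.univ : Finset (I ⊕ R)).toList.length * ((.X ^ d + .X) * 2 + 1)) + 1,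
      fun a => ?_⟩
    set w := enc a with hw
    have hN : 0 < w.length := List.length_pos_of_ne_nil (henc a)
    obtain ⟨b, -⟩ := List.exists_mem_of_ne_nil _ (henc a)
    have h₁ := exec_readInput (R := R) (X := X) Finset.univ.toList (Finset.nodup_toList _)
      (by simp) [] w b
    rw [List.append_nil] at h₁
    have h₂ := exec_rewindInput (R := R) (X := X) Finset.univ.toList (Finset.nodup_toList _)
      (by simp) w b
    obtain ⟨T, hT, h₃⟩ := hP w.length hN (inputRel w) (fun _ => 0) (fun _ => 0) (fun _ => hN)
      (by simp) (inputTape w) (stores_inputTape w d)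
    obtain ⟨T', hT', h₄⟩ := hQ w.length hN _ (fun _ => 0) (fun _ => 0) (fun _ => hN)
      (by simp) T [] hT
    rw [show truthValue _ = f a from Bool.eq_iff_iff.2 (truthValue_eq_true.trans (hf a).symm)] at h₄
    have h₅ := exec_writeOutput (R := R) (X := X) (I := I) Finset.univ.toList (by simp) w.length
      (w.length ^ d + w.length) T' (fun a => (hT' a).1) (f a)
    obtain ⟨t, ht, h⟩ := h₁.seq (h₂.seq (h₃.seq (h₄.seq h₅)))
    refine machine_outputs _ _ _ _ _ (t := t) ?_ ?_
    · simp only [Polynomial.eval_add, Polynomial.eval_mul, Polynomial.eval_C, Polynomial.eval_X,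
        Polynomial.eval_one, Polynomial.eval_pow, Polynomial.eval_ofNat]
      lia
    · convert h using 1
      · rfl
      · funext k
        cases k with
        | ctr c => cases c <;> simp [Store.stk, readStore]
        | before a => cases a <;> simp [Store.stk, readStore]
        | _ => simp [Store.stk, readStore]
      · rw [stk_setOut]
        congr 1
        funext k
        cases k with
        | ctr c => cases c <;> rfl
        | _ => rfl
  exact ⟨{
    tm := machine (decideProg c φ) .inp .out
    inputAlphabet := Equiv.refl I
    outputAlphabet := Equiv.refl Bool
    time := time
    outputsFun := fun a => (List.map_id (enc a)).symm ▸ (H a).some }⟩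

end StackProgram

namespace StackProgram

open Function

variable {A X : Type} [DecidableEq A] [DecidableEq X]

/-! ### Inflationary fixpoints -/

/-- Run `c` for all tuples of values of the variables `xs`. -/
def Cmd.loops (xs : List X) (c : Cmd A X) : Cmd A X := xs.foldr .loop c

/-- Run `c` as often as there are tuples of length `rs.length`. -/
def Cmd.repts (rs : List X) (c : Cmd A X) : Cmd A X := rs.foldr .rept c

/-- Compute the inflationary fixpoint of the operator on the relation `a` that adds all tuples `xs`
for which `φ` holds. The list `rs`, of the same length as `xs`, names the counters of the rounds. -/
def Cmd.fix (rs : List X) (a : A) (xs : List X) (φ : Fm A X) : Cmd A X :=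
  .repts rs (.loops xs (.upd a xs φ))

/-- The assignment in which the variables `xs` have the values `is`. -/
def assign (ρ : X → ℕ) : List X → List ℕ → X → ℕ
  | x :: xs, i :: is => assign (update ρ x i) xs is
  | _, _ => ρ

/-- The tuples of length `k` over the domain `0, …, N - 1`. -/
def IsTuple (N k : ℕ) (is : List ℕ) : Prop := is.length = k ∧ ∀ i ∈ is, i < N

theorem assign_of_notMem {ρ : X → ℕ} {xs : List X} {is : List ℕ} {x : X} (hx : x ∉ xs) :
    assign ρ xs is x = ρ x := by
  induction xs generalizing ρ is with
  | nil => rfl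
  | cons y xs ih =>
    simp only [List.mem_cons, not_or] at hx
    cases is with
    | nil => rfl
    | cons i is => rw [assign, ih hx.2, update_of_ne hx.1]

theorem map_assign {N : ℕ} {ρ : X → ℕ} {xs : List X} {is : List ℕ} (hxs : xs.Nodup)
    (his : IsTuple N xs.length is) : xs.map (assign ρ xs is) = is := by
  obtain ⟨hl, -⟩ := his
  induction xs generalizing ρ is with
  | nil => cases is <;> simp_all
  | cons x xs ih =>
    cases is with
    | nil => simp at hl
    | cons i is =>
      rw [List.nodup_cons] at hxs
      rw [List.map_cons, assign, assign_of_notMem hxs.1, update_self, ih hxs.2 (by simpa using hl)]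

theorem Cmd.eval_loops_induction {N : ℕ} {c : Cmd A X} {xs : List X}
    (Inv : (A → ℕ → Bool) → Prop) {ρ : X → ℕ}
    (h : ∀ is, IsTuple N xs.length is → ∀ M, Inv M → Inv (c.eval N (assign ρ xs is) M))
    {M : A → ℕ → Bool} (hM : Inv M) : Inv ((Cmd.loops xs c).eval N ρ M) := by
  induction xs generalizing ρ M with
  | nil => exact h [] ⟨rfl, by simp⟩ M hM
  | cons x xs ih =>
    change Inv ((List.range N).foldl _ M)
    have : ∀ l : List ℕ, (∀ i ∈ l, i < N) → ∀ M, Inv M →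
        Inv (l.foldl (fun M i => (Cmd.loops xs c).eval N (update ρ x i) M) M) := by
      intro l hl
      induction l with
      | nil => exact fun M hM => hM
      | cons i l ihl =>
        refine fun M hM => ihl (fun j hj => hl j (by simp [hj])) _ (ih (fun is his M hM => ?_) hM)
        exact h (i :: is) ⟨by simp [his.1], by simpa [hl i (by simp)] using his.2⟩ M hM
    exact this _ (by simp) M hM

theorem foldl_eq_self {α ι : Type} [PartialOrder α] (f : ι → α → α) (hf : ∀ i x, x ≤ f i x)
    (l : List ι) (x : α) (h : l.foldl (fun x i => f i x) x = x) : ∀ i ∈ l, f i x = x := by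
  have hle : ∀ (l : List ι) (x : α), x ≤ l.foldl (fun x i => f i x) x := by
    intro l
    induction l with
    | nil => exact fun x => le_rfl
    | cons i l ih => exact fun x => (hf i x).trans (ih _)
  induction l with
  | nil => simp
  | cons i l ih =>
    have h₁ : f i x = x := le_antisymm ((hle l (f i x)).trans_eq h) (hf i x)
    intro j hj
    rw [List.mem_cons] at hj
    rcases hj with rfl | hj
    · exact h₁
    · refine ih ?_ j hj
      rwa [List.foldl_cons, h₁] at h

theorem Cmd.le_eval_upd (N : ℕ) (a : A) (xs : List X) (φ : Fm A X) (ρ : X → ℕ)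
    (M : A → ℕ → Bool) : M ≤ (Cmd.upd a xs φ).eval N ρ M := by
  intro b j
  simp only [Cmd.eval]
  split_ifs
  · exact Bool.le_true _
  · exact le_rfl

theorem Cmd.le_eval_loops (N : ℕ) {c : Cmd A X} (hc : ∀ ρ M, M ≤ c.eval N ρ M) (xs : List X)
    (ρ : X → ℕ) (M : A → ℕ → Bool) : M ≤ (Cmd.loops xs c).eval N ρ M :=
  Cmd.eval_loops_induction (fun M' => M ≤ M') (fun _ _ M' h => h.trans (hc _ M')) le_rfl

/-- If a nest of loops with an inflationary body does not change the relations, then no execution of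
the body does. -/
theorem Cmd.eval_eq_self_of_loops {N : ℕ} {c : Cmd A X} (hc : ∀ ρ M, M ≤ c.eval N ρ M)
    {xs : List X} {ρ : X → ℕ} {M : A → ℕ → Bool} (h : (Cmd.loops xs c).eval N ρ M = M)
    {is : List ℕ} (his : IsTuple N xs.length is) : c.eval N (assign ρ xs is) M = M := by
  induction xs generalizing ρ is with
  | nil => exact h
  | cons x xs ih =>
    cases is with
    | nil => simp [IsTuple] at his
    | cons i is =>
      refine ih (foldl_eq_self (fun i M => (Cmd.loops xs c).eval N (update ρ x i) M)
        (fun i M => le_eval_loops N hc xs _ M) (List.range N) M h i ?_) ⟨?_, ?_⟩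
      · simpa using his.2 i (by simp)
      · simpa using his.1
      · exact fun j hj => his.2 j (by simp [hj])

theorem Cmd.eval_repts (N : ℕ) (rs : List X) (c : Cmd A X) (ρ : X → ℕ) (M : A → ℕ → Bool) :
    (Cmd.repts rs c).eval N ρ M = (c.eval N ρ)^[N ^ rs.length] M := by
  induction rs generalizing M with
  | nil => rfl
  | cons r rs ih =>
    change ((Cmd.repts rs c).eval N ρ)^[N] M = _
    rw [show (Cmd.repts rs c).eval N ρ = (c.eval N ρ)^[N ^ rs.length] from funext ih,
      ← iterate_mul, List.length_cons, pow_succ]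

/-- An iteration on which a bounded measure increases until it gets stationary is stationary after
as many steps as the bound says. -/
theorem isFixedPt_iterate_of_measure {α : Type} (f : α → α) (t : α → ℕ) (B : ℕ)
    (hB : ∀ x, t x ≤ B) (hf : ∀ x, f x ≠ x → t x < t (f x)) (x : α) : f (f^[B] x) = f^[B] x := by
  have h : ∀ n, f (f^[n] x) = f^[n] x ∨ n ≤ t (f^[n] x) := by
    intro n
    induction n with
    | zero => exact .inr (Nat.zero_le _)
    | succ n ih =>
      rw [iterate_succ_apply']
      by_cases hn : f (f^[n] x) = f^[n] x
      · exact .inl (by rw [hn, hn])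
      · have := hf _ hn
        have := ih.resolve_left hn
        exact .inr (by lia)
  by_contra hne
  have h₁ := hf _ hne
  have h₂ := (h B).resolve_left hne
  have h₃ := hB (f (f^[B] x))
  lia

/-- The fixpoint of a definition computes the intended relation `Sem` if one round of the definition
is sound for `Sem`, and if `Sem` is contained in all relations that are closed under the
definition. -/
theorem Cmd.eval_fix {N : ℕ} {rs : List X} {a : A} {xs : List X} {φ : Fm A X}
    (hl : rs.length = xs.length) (hxs : xs.Nodup) {ρ : X → ℕ} {M : A → ℕ → Bool}
    (hM : ∀ j, M a j = false) (Sem : List ℕ → Prop)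
    (sound : ∀ M' : A → ℕ → Bool, (∀ b ≠ a, M' b = M b) →
      (∀ is, IsTuple N xs.length is → M' a (address N is) = true → Sem is) →
      ∀ is, IsTuple N xs.length is → φ.Holds N M' (assign ρ xs is) → Sem is)
    (complete : ∀ M' : A → ℕ → Bool, (∀ b ≠ a, M' b = M b) →
      (∀ is, IsTuple N xs.length is → φ.Holds N M' (assign ρ xs is) →
        M' a (address N is) = true) →
      ∀ is, IsTuple N xs.length is → Sem is → M' a (address N is) = true) :
    (∀ b ≠ a, (Cmd.fix rs a xs φ).eval N ρ M b = M b) ∧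
      ∀ is, IsTuple N xs.length is →
        ((Cmd.fix rs a xs φ).eval N ρ M a (address N is) = true ↔ Sem is) := by
  classical
  set f := (Cmd.loops xs (.upd a xs φ)).eval N ρ with hf
  set M₁ := (Cmd.fix rs a xs φ).eval N ρ M with hM₁
  have hM₁' : M₁ = f^[N ^ xs.length] M := by rw [hM₁, Cmd.fix, Cmd.eval_repts, hl]
  have hle : ∀ M, M ≤ f M := fun M => le_eval_loops N (le_eval_upd N a xs φ) xs ρ M
  have hiter : ∀ Inv : (A → ℕ → Bool) → Prop, (∀ M, Inv M → Inv (f M)) → Inv M → Inv M₁ := by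
    intro Inv h₁ h₂
    rw [hM₁']
    exact Iterate.rec Inv h₂ h₁ _
  have hother : ∀ M : A → ℕ → Bool, ∀ b j, (b ≠ a ∨ N ^ xs.length ≤ j) → f M b j = M b j := by
    intro M b j hb
    refine eval_loops_induction (fun M' => M' b j = M b j) (fun is his M' hM' => ?_) rfl
    rw [← hM']
    simp only [Cmd.eval, map_assign hxs his]
    refine if_neg fun ⟨h₁, h₂, _⟩ => ?_
    have := address_lt his.2
    rw [his.1] at this
    rcases hb with hb | hb
    · exact hb h₁
    · lia
  have hfix : f M₁ = M₁ := by
    rw [hM₁']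
    refine isFixedPt_iterate_of_measure f
      (fun M => ((Finset.range (N ^ xs.length)).filter fun j => M a j = true).card) _
      (fun M => (Finset.card_filter_le _ _).trans (by simp)) (fun M hne => ?_) M
    refine Finset.card_lt_card ((Finset.ssubset_iff_of_subset fun j hj => ?_).2 ?_)
    · rw [Finset.mem_filter] at hj ⊢
      exact ⟨hj.1, Bool.eq_true_of_true_le (hj.2 ▸ hle M a j)⟩
    · by_contra! hcon
      refine hne (funext fun b => funext fun j => ?_)
      by_cases hb : b ≠ a ∨ N ^ xs.length ≤ j
      · exact hother M b j hb
      · push Not at hb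
        obtain ⟨rfl, hj⟩ := hb
        have h₁ := hle M b j
        have h₂ := hcon j
        simp only [Finset.mem_filter, Finset.mem_range, hj, true_and] at h₂
        cases hfj : f M b j
        · rw [hfj] at h₁
          exact (Bool.eq_false_of_le_false h₁).symm
        · exact (h₂ hfj).symm
  have hM₁b : ∀ b ≠ a, M₁ b = M b :=
    hiter (fun M' => ∀ b ≠ a, M' b = M b)
      (fun M' h b hb => (funext fun j => hother M' b j (.inl hb)).trans (h b hb)) fun _ _ => rfl
  refine ⟨hM₁b, fun is his => ⟨?_, ?_⟩⟩
  · revert is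
    refine (hiter (fun M' => (∀ b ≠ a, M' b = M b) ∧
      ∀ is, IsTuple N xs.length is → M' a (address N is) = true → Sem is) ?_ ?_).2
    · refine fun M' hM' => eval_loops_induction
        (fun M' => (∀ b ≠ a, M' b = M b) ∧
          ∀ is, IsTuple N xs.length is → M' a (address N is) = true → Sem is)
        (fun is his M' hM' => ⟨fun b hb => ?_, ?_⟩) hM'
      · rw [← hM'.1 b hb]
        exact funext fun j => if_neg fun h => hb h.1
      · intro is' his' h
        simp only [Cmd.eval, map_assign hxs his, true_and] at h
        split_ifs at h with h'
        · rw [address_inj his'.2 his.2 (his'.1.trans his.1.symm) h'.1]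
          exact sound M' hM'.1 hM'.2 is his h'.2
        · exact hM'.2 is' his' h
    · exact ⟨fun _ _ => rfl, fun is _ h => by simp [hM] at h⟩
  · refine complete M₁ hM₁b (fun is his hφ => ?_) is his
    have h := eval_eq_self_of_loops (le_eval_upd N a xs φ) hfix his
    rw [← h]
    simp [Cmd.eval, map_assign hxs his, hφ]

end StackProgram

namespace StackProgram

open Function

variable {A X : Type} [DecidableEq A] [DecidableEq X]

/-! ### Relations defined by a sequence of fixpoints -/

/-- Truth of a formula, where the relation symbols are interpreted by `R`. -/
def Fm.Sat (N : ℕ) (R : A → List ℕ → Prop) : Fm A X → (X → ℕ) → Prop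
  | .lt x y, ρ => ρ x < ρ y
  | .rel a xs, ρ => R a (xs.map ρ)
  | .neg φ, ρ => ¬ φ.Sat N R ρ
  | .and φ ψ, ρ => φ.Sat N R ρ ∧ ψ.Sat N R ρ
  | .ex x φ, ρ => ∃ i < N, φ.Sat N R (update ρ x i)

/-- Only relation symbols in `as` occur in the formula, and they have the arities `ar`. -/
def Fm.uses (ar : A → ℕ) (as : List A) : Fm A X → Bool
  | .lt _ _ => true
  | .rel a xs => decide (a ∈ as) && decide (xs.length = ar a)
  | .neg φ => φ.uses ar as
  | .and φ ψ => φ.uses ar as && ψ.uses ar as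
  | .ex _ φ => φ.uses ar as

theorem Fm.holds_iff_sat {N : ℕ} {M : A → ℕ → Bool} {φ : Fm A X} {ρ : X → ℕ} :
    φ.Holds N M ρ ↔ φ.Sat N (fun a is => M a (address N is) = true) ρ := by
  induction φ generalizing ρ with
  | lt x y => rfl
  | rel a xs => rfl
  | neg φ ih => exact not_congr ih
  | and φ ψ ih₁ ih₂ => exact and_congr ih₁ ih₂
  | ex x φ ih => exact exists_congr fun i => and_congr_right fun _ => ih

theorem Fm.sat_congr {N : ℕ} {ar : A → ℕ} {as : List A} {R R' : A → List ℕ → Prop} {φ : Fm A X}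
    (hφ : φ.uses ar as = true)
    (h : ∀ a ∈ as, ∀ is, IsTuple N (ar a) is → (R a is ↔ R' a is)) {ρ : X → ℕ}
    (hρ : ∀ x, ρ x < N) : φ.Sat N R ρ ↔ φ.Sat N R' ρ := by
  induction φ generalizing ρ with
  | lt x y => rfl
  | rel a xs =>
    simp only [uses, Bool.and_eq_true, decide_eq_true_eq] at hφ
    refine h a hφ.1 _ ⟨by simp [hφ.2], fun i hi => ?_⟩
    obtain ⟨x, -, rfl⟩ := List.mem_map.1 hi
    exact hρ x
  | neg φ ih => exact not_congr (ih hφ hρ)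
  | and φ ψ ih₁ ih₂ =>
    simp only [uses, Bool.and_eq_true] at hφ
    exact and_congr (ih₁ hφ.1 hρ) (ih₂ hφ.2 hρ)
  | ex x φ ih =>
    refine exists_congr fun i => and_congr_right fun hi => ih hφ fun y => ?_
    rw [update_apply]
    split_ifs
    exacts [hi, hρ y]

/-- The relations in `as` are as intended, and the others are still empty. -/
def Correct (N : ℕ) (ar : A → ℕ) (Sem : A → List ℕ → Prop) (as : List A) (M : A → ℕ → Bool) :
    Prop :=
  (∀ a ∈ as, ∀ is, IsTuple N (ar a) is → (M a (address N is) = true ↔ Sem a is)) ∧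
    ∀ a ∉ as, ∀ j, M a j = false

theorem assign_lt {N : ℕ} {ρ : X → ℕ} (hρ : ∀ x, ρ x < N) {xs : List X} {is : List ℕ}
    (his : ∀ i ∈ is, i < N) (x : X) : assign ρ xs is x < N := by
  induction xs generalizing ρ is with
  | nil => exact hρ x
  | cons y xs ih =>
    cases is with
    | nil => exact hρ x
    | cons i is =>
      refine ih (fun z => ?_) fun j hj => his j (by simp [hj])
      rw [update_apply]
      split_ifs
      exacts [his i (by simp), hρ z]

variable {N : ℕ} {ar : A → ℕ} {Sem : A → List ℕ → Prop} {as : List A} {a : A} {rs xs : List X}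
  {φ : Fm A X} {M : A → ℕ → Bool}

theorem Correct.sat_iff (hM : Correct N ar Sem as M) (hφ : φ.uses ar as = true) {ρ : X → ℕ}
    (hρ : ∀ x, ρ x < N) : φ.Holds N M ρ ↔ φ.Sat N Sem ρ :=
  Fm.holds_iff_sat.trans (Fm.sat_congr hφ hM.1 hρ)

/-- Computation of a recursively defined relation. -/
theorem Correct.fix (hM : Correct N ar Sem as M) (ha : a ∉ as) (hl : rs.length = xs.length)
    (hx : xs.length = ar a) (hxs : xs.Nodup) (hφ : φ.uses ar (a :: as) = true)
    {ρ : X → ℕ} (hρ : ∀ x, ρ x < N)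
    (sound : ∀ T : List ℕ → Prop, (∀ is, T is → Sem a is) → ∀ is, IsTuple N (ar a) is →
      φ.Sat N (update Sem a T) (assign ρ xs is) → Sem a is)
    (complete : ∀ T : List ℕ → Prop, (∀ is, IsTuple N (ar a) is →
      φ.Sat N (update Sem a T) (assign ρ xs is) → T is) →
      ∀ is, IsTuple N (ar a) is → Sem a is → T is) :
    Correct N ar Sem (a :: as) ((Cmd.fix rs a xs φ).eval N ρ M) := by
  have key : ∀ M' : A → ℕ → Bool, (∀ b ≠ a, M' b = M b) → ∀ T : List ℕ → Prop,
      (∀ is, IsTuple N (ar a) is → (T is ↔ M' a (address N is) = true)) →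
      ∀ is, IsTuple N (ar a) is →
        (φ.Holds N M' (assign ρ xs is) ↔ φ.Sat N (update Sem a T) (assign ρ xs is)) := by
    intro M' hM' T hT is his
    rw [Fm.holds_iff_sat]
    refine Fm.sat_congr hφ (fun b hb is' his' => ?_) (assign_lt hρ his.2)
    by_cases hba : b = a
    · subst hba
      rw [update_self, hT is' his']
    · rw [update_of_ne hba, hM' b hba]
      exact hM.1 b (List.mem_of_ne_of_mem hba hb) is' his'
  obtain ⟨h₁, h₂⟩ := Cmd.eval_fix (φ := φ) hl hxs (ρ := ρ) (hM.2 a ha) (Sem a)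
    (fun M' hM' hs is his h => by
      rw [hx] at hs his
      refine sound (fun is => IsTuple N (ar a) is ∧ M' a (address N is) = true)
        (fun is h => hs is h.1 h.2) is his ((key M' hM' _ (fun is his => ?_) is his).1 h)
      exact and_iff_right his)
    (fun M' hM' hc is his h => by
      rw [hx] at hc his
      refine complete (fun is => M' a (address N is) = true) (fun is his h => ?_) is his h
      exact hc is his ((key M' hM' _ (fun _ _ => Iff.rfl) is his).2 h))
  refine ⟨fun b hb is his => ?_, fun b hb j => ?_⟩
  · by_cases hba : b = a
    · subst hba
      exact h₂ is (hx ▸ his)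
    · rw [h₁ b hba]
      exact hM.1 b (List.mem_of_ne_of_mem hba hb) is his
  · rw [List.mem_cons, not_or] at hb
    rw [h₁ b hb.1]
    exact hM.2 b hb.2 j

/-- Computation of an explicitly defined relation. -/
theorem Correct.fix_of_iff (hM : Correct N ar Sem as M) (ha : a ∉ as)
    (hl : rs.length = xs.length) (hx : xs.length = ar a) (hxs : xs.Nodup)
    (hφ : φ.uses ar as = true) {ρ : X → ℕ} (hρ : ∀ x, ρ x < N)
    (h : ∀ is, IsTuple N (ar a) is → (φ.Sat N Sem (assign ρ xs is) ↔ Sem a is)) :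
    Correct N ar Sem (a :: as) ((Cmd.fix rs a xs φ).eval N ρ M) := by
  have hφ' : φ.uses ar (a :: as) = true := by
    clear h
    induction φ with
    | lt => rfl
    | rel b ys =>
      simp only [Fm.uses, Bool.and_eq_true, decide_eq_true_eq, List.mem_cons] at hφ ⊢
      exact ⟨.inr hφ.1, hφ.2⟩
    | neg φ ih => exact ih hφ
    | and φ ψ ih₁ ih₂ =>
      simp only [Fm.uses, Bool.and_eq_true] at hφ ⊢
      exact ⟨ih₁ hφ.1, ih₂ hφ.2⟩
    | ex x φ ih => exact ih hφ
  have key : ∀ T is, IsTuple N (ar a) is →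
      (φ.Sat N (update Sem a T) (assign ρ xs is) ↔ Sem a is) := fun T is his => by
    rw [← h is his]
    refine Fm.sat_congr hφ (fun b hb is' _ => ?_) (assign_lt hρ his.2)
    rw [update_of_ne (ne_of_mem_of_not_mem hb ha)]
  exact hM.fix ha hl hx hxs hφ' hρ (fun T _ is his => (key T is his).1)
    fun T hT is his hs => hT is his ((key T is his).2 hs)

theorem isTuple_one {is : List ℕ} : IsTuple N 1 is ↔ ∃ i < N, is = [i] := by
  constructor
  · rintro ⟨hl, h⟩
    obtain ⟨i, rfl⟩ := List.length_eq_one_iff.1 hl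
    exact ⟨i, by simpa using h, rfl⟩
  · rintro ⟨i, hi, rfl⟩
    simpa [IsTuple] using hi

theorem isTuple_succ {k : ℕ} {is : List ℕ} :
    IsTuple N (k + 1) is ↔ ∃ i < N, ∃ is', IsTuple N k is' ∧ is = i :: is' := by
  constructor
  · rintro ⟨hl, h⟩
    cases is with
    | nil => simp at hl
    | cons i is =>
      exact ⟨i, h i (by simp), is, ⟨by simpa using hl, fun j hj => h j (by simp [hj])⟩, rfl⟩
  · rintro ⟨i, hi, is, his, rfl⟩
    exact ⟨by simp [his.1], by simpa [hi] using his.2⟩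

theorem isTuple_two {is : List ℕ} : IsTuple N 2 is ↔ ∃ i < N, ∃ j < N, is = [i, j] := by
  rw [isTuple_succ]
  simp only [isTuple_one]
  constructor
  · rintro ⟨i, hi, _, ⟨j, hj, rfl⟩, rfl⟩
    exact ⟨i, hi, j, hj, rfl⟩
  · rintro ⟨i, hi, j, hj, rfl⟩
    exact ⟨i, hi, _, ⟨j, hj, rfl⟩, rfl⟩

theorem isTuple_three {is : List ℕ} :
    IsTuple N 3 is ↔ ∃ i < N, ∃ j < N, ∃ k < N, is = [i, j, k] := by
  rw [isTuple_succ]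
  simp only [isTuple_two]
  constructor
  · rintro ⟨i, hi, _, ⟨j, hj, k, hk, rfl⟩, rfl⟩
    exact ⟨i, hi, j, hj, k, hk, rfl⟩
  · rintro ⟨i, hi, j, hj, k, hk, rfl⟩
    exact ⟨i, hi, _, ⟨j, hj, k, hk, rfl⟩, rfl⟩

theorem isTuple_four {is : List ℕ} :
    IsTuple N 4 is ↔ ∃ i < N, ∃ j < N, ∃ k < N, ∃ l < N, is = [i, j, k, l] := by
  rw [isTuple_succ]
  simp only [isTuple_three]
  constructor
  · rintro ⟨i, hi, _, ⟨j, hj, k, hk, l, hl, rfl⟩, rfl⟩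
    exact ⟨i, hi, j, hj, k, hk, l, hl, rfl⟩
  · rintro ⟨i, hi, j, hj, k, hk, l, hl, rfl⟩
    exact ⟨i, hi, _, ⟨j, hj, k, hk, l, hl, rfl⟩, rfl⟩

/-! ### Derived connectives -/

/-- Disjunction. -/
def Fm.or (φ ψ : Fm A X) : Fm A X := .neg (.and (.neg φ) (.neg ψ))

/-- Implication. -/
def Fm.imp (φ ψ : Fm A X) : Fm A X := .neg (.and φ (.neg ψ))

/-- Universal quantification. -/
def Fm.all (x : X) (φ : Fm A X) : Fm A X := .neg (.ex x (.neg φ))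

/-- Equality. -/
def Fm.eq (x y : X) : Fm A X := .and (.neg (.lt x y)) (.neg (.lt y x))

section

variable {R : A → List ℕ → Prop} {φ ψ : Fm A X} {ρ : X → ℕ}

theorem Fm.sat_or : (φ.or ψ).Sat N R ρ ↔ φ.Sat N R ρ ∨ ψ.Sat N R ρ := by
  simp only [Fm.or, Sat]
  tauto

theorem Fm.sat_imp : (φ.imp ψ).Sat N R ρ ↔ (φ.Sat N R ρ → ψ.Sat N R ρ) := by
  simp only [Fm.imp, Sat]
  tauto

theorem Fm.sat_all {x : X} :
    (Fm.all x φ).Sat N R ρ ↔ ∀ i < N, φ.Sat N R (update ρ x i) := by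
  simp [Fm.all, Sat]

theorem Fm.sat_eq {x y : X} : (Fm.eq x y : Fm A X).Sat N R ρ ↔ ρ x = ρ y := by
  simp only [Fm.eq, Sat]
  lia

end

end StackProgram

namespace RobberCaptain

open scoped Hypergraph

/-! ### Components and frontiers -/

section

variable {V : Type*} {H₁ H₂ : Hypergraph V}

/-- The set of nodes that can be reached from `x` outside of `S`. -/
def reach (H₁ : Hypergraph V) (S : Set V) (x : V) : Set V := {y | HasPathOff H₁ S x y}

theorem HasPathOff.symm {S : Set V} {x y : V} (h : HasPathOff H₁ S x y) : HasPathOff H₁ S y x :=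
  have : Std.Symm (AdjOff H₁ S) := ⟨fun _ _ ⟨e, he, hx, hy⟩ => ⟨e, he, hy, hx⟩⟩
  (Relation.ReflTransGen.stdSymm (r := AdjOff H₁ S)).symm _ _ h

theorem HasPathOff.mono {S T : Set V} (hST : S ⊆ T) {x y : V} (h : HasPathOff H₁ T x y) :
    HasPathOff H₁ S x y :=
  Relation.ReflTransGen.mono (r := AdjOff H₁ T) (fun _ _ ⟨e, he, hx, hy⟩ =>
    ⟨e, he, ⟨hx.1, fun h => hx.2 (hST h)⟩, ⟨hy.1, fun h => hy.2 (hST h)⟩⟩) _ _ h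

theorem reach_subset {S : Set V} {x : V} (hx : x ∈ V(H₁) \ S) : reach H₁ S x ⊆ V(H₁) \ S := by
  intro y hy
  induction hy with
  | refl => exact hx
  | tail _ h _ =>
    obtain ⟨e, he, -, hy⟩ := h
    exact ⟨H₁.subset_vertexSet_of_mem_edgeSet' he hy.1, hy.2⟩

theorem isComponentOff_reach {S : Set V} {x : V} (hx : x ∈ V(H₁) \ S) :
    IsComponentOff H₁ S (reach H₁ S x) := by
  refine ⟨⟨⟨x, .refl⟩, reach_subset hx, fun y hy z hz => hy.symm.trans hz⟩, fun W hW hle y hy => ?_⟩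
  exact hW.2.2 x (hle .refl) y hy

theorem IsComponentOff.eq_reach {S C : Set V} (hC : IsComponentOff H₁ S C) {x : V} (hx : x ∈ C) :
    C = reach H₁ S x := by
  have hsub : C ⊆ reach H₁ S x := fun y hy => hC.1.2.2 x hx y hy
  exact hsub.antisymm (hC.2 (isComponentOff_reach (hC.1.2.1 hx)).1 hsub)

/-- The nodes of the frontier of `C` outside of `C` separate `C` from the rest. -/
def border (H₁ : Hypergraph V) (C : Set V) : Set V := frontierOf H₁ C \ C

theorem IsComponentOff.border_subset {S C : Set V} (hC : IsComponentOff H₁ S C) :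
    border H₁ C ⊆ S := by
  rintro y ⟨⟨e, he, ⟨c, hce, hc⟩, hy⟩, hyC⟩
  by_contra hyS
  rw [hC.eq_reach hc] at hyC
  exact hyC (.single ⟨e, he, ⟨hce, (hC.1.2.1 hc).2⟩, hy, hyS⟩)

theorem mem_of_hasPathOff {S C : Set V} (hC : border H₁ C ⊆ S) {x y : V} (hx : x ∈ C)
    (h : HasPathOff H₁ S x y) : y ∈ C := by
  induction h with
  | refl => exact hx
  | tail _ h ih =>
    obtain ⟨e, he, hx, hy⟩ := h
    by_contra hyC
    exact hy.2 (hC ⟨⟨e, he, ⟨_, hx.1, ih⟩, hy.1⟩, hyC⟩)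

/-- Blocking more nodes outside of a component does not change it. -/
theorem IsComponentOff.of_disjoint {S T C : Set V} (hC : IsComponentOff H₁ S C) (hST : S ⊆ T)
    (hT : ∀ x ∈ C, x ∉ T) : IsComponentOff H₁ T C := by
  obtain ⟨x, hx⟩ := hC.1.1
  have hx' : x ∈ V(H₁) \ T := ⟨(hC.1.2.1 hx).1, hT x hx⟩
  convert isComponentOff_reach hx' using 1
  refine Set.Subset.antisymm (fun y hy => ?_) fun y hy => ?_
  · have h : HasPathOff H₁ S x y := hC.1.2.2 x hx y hy
    clear hy
    suffices y ∈ C ∧ HasPathOff H₁ T x y from this.2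
    induction h with
    | refl => exact ⟨hx, .refl⟩
    | tail hp h ih =>
      have hz := mem_of_hasPathOff hC.border_subset ih.1 (.single h)
      obtain ⟨e, he, h₁, h₂⟩ := h
      exact ⟨hz, ih.2.tail ⟨e, he, ⟨h₁.1, hT _ ih.1⟩, h₂.1, hT _ hz⟩⟩
  · rw [hC.eq_reach hx]
    exact HasPathOff.mono hST hy

/-! ### Winning configurations -/

/-- The Captain wins from the configuration `v` within `n` greedy moves. -/
def WinIn (H₁ H₂ : Hypergraph V) : ℕ → Config V → Prop
  | 0, _ => False
  | n + 1, v => ∃ k ∈ E(H₂), ((v.squad ∩ v.robber).Nonempty → k = v.squad) ∧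
      ∀ C, IsOption H₁ v (k ∩ frontierOf H₁ v.robber) C →
        WinIn H₁ H₂ n ⟨⟨k, k ∩ frontierOf H₁ v.robber⟩, C⟩

theorem WinIn.mono {m n : ℕ} (hmn : m ≤ n) {v : Config V} (h : WinIn H₁ H₂ m v) :
    WinIn H₁ H₂ n v := by
  induction m generalizing n v with
  | zero => exact h.elim
  | succ m ih =>
    obtain ⟨k, hk, hf, ho⟩ := h
    cases n with
    | zero => lia
    | succ n => exact ⟨k, hk, hf, fun C hC => ih (by lia) (ho C hC)⟩

/-- The Captain wins from the configuration `v` by greedy moves. -/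
def Win (H₁ H₂ : Hypergraph V) (v : Config V) : Prop := ∃ n, WinIn H₁ H₂ n v

theorem Win.intro [Finite V] {v : Config V} {k : Set V} (hk : k ∈ E(H₂))
    (hf : (v.squad ∩ v.robber).Nonempty → k = v.squad)
    (ho : ∀ C, IsOption H₁ v (k ∩ frontierOf H₁ v.robber) C →
      Win H₁ H₂ ⟨⟨k, k ∩ frontierOf H₁ v.robber⟩, C⟩) : Win H₁ H₂ v := by
  have : ∀ C, ∃ n, IsOption H₁ v (k ∩ frontierOf H₁ v.robber) C →
      WinIn H₁ H₂ n ⟨⟨k, k ∩ frontierOf H₁ v.robber⟩, C⟩ := fun C => by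
    by_cases hC : IsOption H₁ v (k ∩ frontierOf H₁ v.robber) C
    · obtain ⟨n, hn⟩ := ho C hC
      exact ⟨n, fun _ => hn⟩
    · exact ⟨0, fun h => (hC h).elim⟩
  choose f hf' using this
  obtain ⟨B, hB⟩ := Finite.exists_le f
  exact ⟨B + 1, k, hk, hf, fun C hC => (hf' C hC).mono (hB C)⟩

instance [Finite V] : Finite (Config V) :=
  Finite.of_injective (fun v : Config V => (v.squad, v.cops, v.robber)) <| by
    rintro ⟨⟨_, _⟩, _⟩ ⟨⟨_, _⟩, _⟩ h
    simp_all

/-- Since there are finitely many configurations, acyclicity of the strategy graph allows induction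
along its arcs. -/
theorem Win.of_isWinning [Finite V] {σ : Config V → Position V} (hs : IsStrategy H₁ H₂ σ)
    (hg : IsGreedy H₁ σ) (hw : IsWinning H₁ σ) {v : Config V} (hv : Dom H₁ σ v) :
    Win H₁ H₂ v := by
  let r : Config V → Config V → Prop := fun w v => Relation.TransGen (Arc H₁ σ) v w
  have : IsTrans _ r := ⟨fun _ _ _ h h' => Relation.TransGen.trans h' h⟩
  have : Std.Irrefl r := ⟨hw⟩
  have hwf : WellFounded r := Finite.wellFounded_of_trans_of_irrefl r
  induction v using hwf.induction with
  | _ v ih =>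
    obtain ⟨hk, -⟩ := hs v hv
    obtain ⟨hc, hf⟩ := hg v hv
    refine .intro hk hf fun C hC => ?_
    rw [← hc] at hC ⊢
    exact ih ⟨σ v, C⟩ (.single ⟨hv, rfl, .inl hC⟩) (.move v C hv hC)

/-- The least number of greedy moves in which the Captain wins from `v`. -/
noncomputable def winRank (H₁ H₂ : Hypergraph V) (v : Config V) : ℕ := sInf {n | WinIn H₁ H₂ n v}

theorem Win.exists_move {v : Config V} (h : Win H₁ H₂ v) : ∃ k ∈ E(H₂),
    ((v.squad ∩ v.robber).Nonempty → k = v.squad) ∧ 0 < winRank H₁ H₂ v ∧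
      ∀ C, IsOption H₁ v (k ∩ frontierOf H₁ v.robber) C →
        Win H₁ H₂ ⟨⟨k, k ∩ frontierOf H₁ v.robber⟩, C⟩ ∧
        winRank H₁ H₂ ⟨⟨k, k ∩ frontierOf H₁ v.robber⟩, C⟩ < winRank H₁ H₂ v := by
  have h' : WinIn H₁ H₂ (winRank H₁ H₂ v) v := Nat.sInf_mem h
  cases hn : winRank H₁ H₂ v with
  | zero => rw [hn] at h'; exact h'.elim
  | succ n =>
    rw [hn] at h'
    obtain ⟨k, hk, hf, ho⟩ := h'
    exact ⟨k, hk, hf, by lia, fun C hC => ⟨⟨n, ho C hC⟩, Nat.lt_succ_of_le (Nat.sInf_le (ho C hC))⟩⟩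

/-- The moves that decrease `winRank` form a winning strategy, unless there are no nodes: then a
capture configuration may coincide with the initial one. -/
theorem HasGreedyWinningStrategy.of_win (hV : V(H₁).Nonempty)
    (h : Win H₁ H₂ (initialConfig H₁)) : HasGreedyWinningStrategy H₁ H₂ := by
  have : ∀ v, ∃ p : Position V, Win H₁ H₂ v → p.squad ∈ E(H₂) ∧
      p.cops = p.squad ∩ frontierOf H₁ v.robber ∧
      ((v.squad ∩ v.robber).Nonempty → p.squad = v.squad) ∧ 0 < winRank H₁ H₂ v ∧
      ∀ C, IsOption H₁ v p.cops C →
        Win H₁ H₂ ⟨p, C⟩ ∧ winRank H₁ H₂ ⟨p, C⟩ < winRank H₁ H₂ v := fun v => by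
    by_cases hv : Win H₁ H₂ v
    · obtain ⟨k, hk, hf, hr, ho⟩ := hv.exists_move
      exact ⟨⟨k, k ∩ frontierOf H₁ v.robber⟩, fun _ => ⟨hk, rfl, hf, hr, ho⟩⟩
    · exact ⟨⟨∅, ∅⟩, fun hv' => (hv hv').elim⟩
  choose σ hσ using this
  have hdom : ∀ v, Dom H₁ σ v → Win H₁ H₂ v ∧ v.robber ≠ ∅ := by
    intro v hv
    induction hv with
    | init => exact ⟨h, hV.ne_empty⟩
    | move v C hv hC ih => exact ⟨((hσ v ih.1).2.2.2.2 C hC).1, hC.1.1.1.ne_empty⟩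
  refine ⟨σ, fun v hv => ?_, fun v hv => ?_, fun v hv => ?_⟩
  · obtain ⟨h₁, h₂, -⟩ := hσ v (hdom v hv).1
    exact ⟨h₁, h₂.subset⟩
  · obtain ⟨-, h₂, h₃, -⟩ := hσ v (hdom v hv).1
    exact ⟨h₂, h₃⟩
  · classical
    -- Along all arcs, also those into capture configurations, the following potential decreases.
    let μ : Config V → ℕ := fun w => if w.robber = ∅ then 0 else winRank H₁ H₂ w
    have hμ : ∀ v w, Arc H₁ σ v w → μ w < μ v := by
      rintro v ⟨p, C⟩ ⟨hv, rfl, ho⟩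
      obtain ⟨-, -, -, h₄, h₅⟩ := hσ v (hdom v hv).1
      simp only [μ, (hdom v hv).2, if_false]
      split_ifs with hC
      · exact h₄
      · exact (h₅ C (ho.resolve_right fun h => hC h.2)).2
    have hμ' : ∀ v w, Relation.TransGen (Arc H₁ σ) v w → μ w < μ v := by
      intro v w h
      induction h with
      | single h => exact hμ _ _ h
      | tail _ h ih => exact (hμ _ _ h).trans ih
    exact (hμ' v v hv).false

theorem hasGreedyWinningStrategy_iff_win [Finite V] (hV : V(H₁).Nonempty) :
    HasGreedyWinningStrategy H₁ H₂ ↔ Win H₁ H₂ (initialConfig H₁) :=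
  ⟨fun ⟨_, hs, hg, hw⟩ => .of_isWinning hs hg hw .init, .of_win hV⟩

/-! ### The squad and a node of the Robber determine the winner -/

/-- The Captain wins if his squad is `h`, all cops of `h` next to the component of `x` off `h` are
in action, and the Robber stands in this component. When the Captain changes his squad to `k`, the
Robber can escape through all nodes of the border of his component except those in `k`. -/
inductive WinAt (H₁ H₂ : Hypergraph V) : Set V → V → Prop
  | mk (h : Set V) (x : V) (k : Set V) (hk : k ∈ E(H₂))
      (ho : ∀ z ∈ V(H₁) \ k, HasPathOff H₁ (k ∩ border H₁ (reach H₁ h x)) x z →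
        WinAt H₁ H₂ k z) : WinAt H₁ H₂ h x

theorem inter_inter_frontierOf {M C k : Set V} (hC : IsComponentOff H₁ M C) :
    M ∩ (k ∩ frontierOf H₁ C) = k ∩ border H₁ C := by
  refine Set.Subset.antisymm ?_ ?_
  · rintro x ⟨hM, hk, hF⟩
    exact ⟨hk, hF, fun h => (hC.1.2.1 h).2 hM⟩
  · rintro x ⟨hk, hb⟩
    exact ⟨hC.border_subset hb, hk, hb.1⟩

theorem isOption_reach {v : Config V} {M : Set V} {x z : V}
    (hv : IsComponentOff H₁ v.cops v.robber) (hx : x ∈ v.robber) (hz : z ∈ V(H₁) \ M)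
    (h : HasPathOff H₁ (v.cops ∩ M) x z) : IsOption H₁ v M (reach H₁ M z) := by
  refine ⟨isComponentOff_reach hz, ?_⟩
  have : ∀ y ∈ v.robber ∪ reach H₁ M z, HasPathOff H₁ (v.cops ∩ M) x y := by
    rintro y (hy | hy)
    · exact (hv.1.2.2 x hx y hy).mono Set.inter_subset_left
    · exact h.trans (HasPathOff.mono Set.inter_subset_right hy)
  exact fun y hy y' hy' => (this y hy).symm.trans (this y' hy')

theorem WinAt.of_win {v : Config V} (h : Win H₁ H₂ v) (hv : IsComponentOff H₁ v.cops v.robber)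
    (hM : v.cops ⊆ v.squad) {x : V} (hx : x ∈ v.robber \ v.squad) :
    WinAt H₁ H₂ v.squad x := by
  obtain ⟨n, hn⟩ := h
  induction n generalizing v x with
  | zero => exact hn.elim
  | succ n ih =>
    obtain ⟨k, hk, hf, ho⟩ := hn
    by_cases hd : (v.squad ∩ v.robber).Nonempty
    · obtain rfl := hf hd
      have hz : x ∈ V(H₁) \ (v.squad ∩ frontierOf H₁ v.robber) :=
        ⟨(hv.1.2.1 hx.1).1, fun h => hx.2 h.1⟩
      exact ih (v := ⟨⟨v.squad, v.squad ∩ frontierOf H₁ v.robber⟩, reach H₁ _ x⟩)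
        (isComponentOff_reach hz) Set.inter_subset_left ⟨.refl, hx.2⟩
        (ho _ (isOption_reach hv hx.1 hz .refl))
    · have hd' : ∀ y ∈ v.robber, y ∉ v.squad := fun y hy hy' => hd ⟨y, hy', hy⟩
      refine .mk _ _ k hk fun z hz hp => ?_
      rw [← (hv.of_disjoint hM hd').eq_reach hx.1, ← inter_inter_frontierOf hv] at hp
      have hz' : z ∈ V(H₁) \ (k ∩ frontierOf H₁ v.robber) := ⟨hz.1, fun h => hz.2 h.1⟩
      exact ih (v := ⟨⟨k, k ∩ frontierOf H₁ v.robber⟩, reach H₁ _ z⟩)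
        (isComponentOff_reach hz') Set.inter_subset_left ⟨.refl, hz.2⟩
        (ho _ (isOption_reach hv hx.1 hz' hp))

theorem WinAt.win [Finite V] (hV : ∀ x ∈ V(H₁), ∃ e ∈ E(H₁), x ∈ e) {h : Set V} {x : V}
    (hw : WinAt H₁ H₂ h x) {M C : Set V} (hC : IsComponentOff H₁ M C) (hM : M ⊆ h)
    (hd : ∀ y ∈ C, y ∉ h) (hx : x ∈ C) : Win H₁ H₂ ⟨⟨h, M⟩, C⟩ := by
  induction hw generalizing M C with
  | mk h x k hk ho ih =>
    rw [← (hC.of_disjoint hM hd).eq_reach hx, ← inter_inter_frontierOf hC] at ih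
    refine .intro hk (fun ⟨y, hy, hy'⟩ => (hd y hy' hy).elim) fun C' hC' => ?_
    dsimp only at hC' ⊢
    have hp : ∀ y ∈ C', HasPathOff H₁ (M ∩ (k ∩ frontierOf H₁ C)) x y :=
      fun y hy => hC'.2 x (.inl hx) y (.inr hy)
    by_cases hd' : ∀ y ∈ C', y ∉ k
    · obtain ⟨y, hy⟩ := hC'.1.1.1
      exact ih y ⟨(hC'.1.1.2.1 hy).1, hd' y hy⟩ (hp y hy) hC'.1 Set.inter_subset_left hd' hy
    · -- The Captain has to keep the squad `k`. After the next move it is disjoint from the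
      -- component of the Robber, which can only shrink.
      refine .intro hk (fun _ => rfl) fun C'' hC'' => ?_
      dsimp only at hC'' ⊢
      have hb : border H₁ C' ⊆ k ∩ frontierOf H₁ C ∩ (k ∩ frontierOf H₁ C') := fun y hy =>
        ⟨hC'.1.border_subset hy, (hC'.1.border_subset hy).1, hy.1⟩
      obtain ⟨c, hc⟩ := hC'.1.1.1
      have hsub : C'' ⊆ C' := fun y hy =>
        mem_of_hasPathOff hb hc (hC''.2 c (.inl hc) y (.inr hy))
      have hd'' : ∀ y ∈ C'', y ∉ k := by
        intro y hy hyk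
        obtain ⟨e, he, hye⟩ := hV y (hC''.1.1.2.1 hy).1
        exact (hC''.1.1.2.1 hy).2 ⟨hyk, e, he, ⟨y, hye, hsub hy⟩, hye⟩
      obtain ⟨y, hy⟩ := hC''.1.1.1
      exact ih y ⟨(hC''.1.1.2.1 hy).1, hd'' y hy⟩ (hp y (hsub hy)) hC''.1 Set.inter_subset_left
        hd'' hy

/-- If the first hypergraph is not connected, then the Robber has no option at all after the first
move, since the union of the set of all nodes and his component would have to be connected. -/
theorem hasGreedyWinningStrategy_iff [Finite V] (hV : ∀ x ∈ V(H₁), ∃ e ∈ E(H₁), x ∈ e)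
    (hne : V(H₁).Nonempty) : HasGreedyWinningStrategy H₁ H₂ ↔
      E(H₂).Nonempty ∧ ((∃ x ∈ V(H₁), ∃ y ∈ V(H₁), ¬ HasPathOff H₁ ∅ x y) ∨
        ∃ x ∈ V(H₁), WinAt H₁ H₂ ∅ x) := by
  rw [hasGreedyWinningStrategy_iff_win hne]
  obtain ⟨x₀, hx₀⟩ := hne
  by_cases hc : ∃ x ∈ V(H₁), ∃ y ∈ V(H₁), ¬ HasPathOff H₁ ∅ x y
  · simp only [hc, true_or, and_true]
    refine ⟨fun ⟨n, hn⟩ => ?_, fun ⟨k, hk⟩ => ?_⟩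
    · cases n with
      | zero => exact hn.elim
      | succ n => exact ⟨_, hn.choose_spec.1⟩
    · refine .intro hk (fun h => by simp [initialConfig] at h) fun C hC => ?_
      obtain ⟨x, hx, y, hy, hp⟩ := hc
      exact (hp ((hC.2 x (.inl hx) y (.inl hy)).mono (Set.empty_subset _))).elim
  · simp only [hc, false_or]
    push Not at hc
    have hcomp : IsComponentOff H₁ ∅ V(H₁) :=
      ⟨⟨⟨x₀, hx₀⟩, by simp, hc⟩, fun W hW _ => by simpa using hW.2.1⟩
    refine ⟨fun h => ?_, fun ⟨_, x, hx, hw⟩ => ?_⟩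
    · have h' : WinAt H₁ H₂ ∅ x₀ := WinAt.of_win h hcomp subset_rfl ⟨hx₀, fun h => h.elim⟩
      refine ⟨?_, x₀, hx₀, h'⟩
      cases h' with
      | mk _ _ k hk _ => exact ⟨k, hk⟩
    · exact hw.win hV hcomp subset_rfl (fun _ _ h => h.elim) hx

/-- With an empty squad, the capture configuration would be the initial configuration. -/
theorem hasGreedyWinningStrategy_iff_of_eq_empty (hV : V(H₁) = ∅) :
    HasGreedyWinningStrategy H₁ H₂ ↔ ∃ k ∈ E(H₂), k.Nonempty := by
  have hno : ∀ (v : Config V) (M C : Set V), ¬ IsOption H₁ v M C := by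
    rintro v M C ⟨⟨⟨⟨x, hx⟩, hsub, -⟩, -⟩, -⟩
    simpa [hV] using hsub hx
  have hF : frontierOf H₁ (initialConfig H₁).robber = ∅ := by
    simp [frontierOf, initialConfig, hV]
  constructor
  · rintro ⟨σ, hs, hg, hw⟩
    have h₁ := hs _ .init
    have h₂ := (hg _ .init).1
    refine ⟨_, h₁.1, Set.nonempty_iff_ne_empty.2 fun h₃ => hw (initialConfig H₁) (.single ?_)⟩
    rw [hF, Set.inter_empty] at h₂
    refine ⟨.init, ?_, .inr ⟨fun C => hno _ _ C, hV⟩⟩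
    cases hp : σ (initialConfig H₁)
    simp_all [initialConfig]
  · rintro ⟨k, hk, x, hx⟩
    have hdom : ∀ v, Dom H₁ (fun _ => ⟨k, ∅⟩) v → v = initialConfig H₁ := by
      intro v hv
      cases hv with
      | init => rfl
      | move v C hv hC => exact (hno _ _ _ hC).elim
    refine ⟨fun _ => ⟨k, ∅⟩, fun v hv => ⟨hk, Set.empty_subset _⟩, fun v hv => ?_, fun v hv => ?_⟩
    · obtain rfl := hdom v hv
      rw [hF]
      simp [initialConfig]
    · -- A cycle would begin and end in the initial configuration, but no arc ends there.
      obtain rfl : v = initialConfig H₁ := by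
        obtain ⟨w, h, -⟩ := Relation.TransGen.head'_iff.1 hv
        exact hdom v h.1
      obtain ⟨w, -, h⟩ := Relation.TransGen.tail'_iff.1 hv
      have := congrArg Position.squad h.2.1
      simp only [initialConfig] at this
      exact absurd hx (by simp [← this])

end

end RobberCaptain

namespace RobberCaptain

open scoped Hypergraph
open StackProgram Function

/-! ### The relations computed from an input -/

/-- The relations that are computed from an input. Nodes are represented by their numbers, and a
hyperedge by the position of the comma that ends its row. -/
inductive Rel
  | col
  | second
  | edge₁
  | edge₂
  | comp
  | bord
  | path
  | win
  deriving DecidableEq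

instance : Fintype Rel :=
  ⟨{.col, .second, .edge₁, .edge₂, .comp, .bord, .path, .win}, fun r => by cases r <;> simp⟩

instance : Fintype Sym :=
  ⟨{.zero, .one, .comma, .semicolon}, fun s => by cases s <;> simp⟩

/-- The arities of the relations. A tape symbol stands for the set of its positions. -/
def arity : Sym ⊕ Rel → ℕ
  | .inl _ => 1
  | .inr .col => 2
  | .inr .second => 1
  | .inr .edge₁ => 2
  | .inr .edge₂ => 2
  | .inr .comp => 3
  | .inr .bord => 3
  | .inr .path => 4
  | .inr .win => 2

/-- Position `i` of `w` holds a separator. -/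
def IsSep (w : List Sym) (i : ℕ) : Prop := w[i]? = some .comma ∨ w[i]? = some .semicolon

/-- Position `i` of `w` holds a bit. -/
def IsBit (w : List Sym) (i : ℕ) : Prop := w[i]? = some .zero ∨ w[i]? = some .one

/-- Position `q` of `w` belongs to column `x` of a matrix: it holds a bit, as do exactly the `x`
positions between it and the last separator before it. -/
def IsCol (w : List Sym) (q x : ℕ) : Prop :=
  ∃ s, s + 1 + x = q ∧ IsSep w s ∧ ∀ i, s < i → i ≤ q → IsBit w i

/-- The row of `w` that ends before position `p` has a `1` in column `x`. -/
def RowHas (w : List Sym) (p x : ℕ) : Prop :=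
  ∃ q < p, w[q]? = some .one ∧ IsCol w q x ∧ ∀ i, q < i → i < p → ¬ IsSep w i

/-- Position `p` of `w` ends a row of the second matrix. -/
def IsSecond (w : List Sym) (p : ℕ) : Prop :=
  w[p]? = some .comma ∧ ∃ i j, i < j ∧ j < p ∧ w[i]? = some .semicolon ∧ w[j]? = some .semicolon

/-- Position `p` of `w` ends a row of the first matrix. -/
def IsFirst (w : List Sym) (p : ℕ) : Prop := w[p]? = some .comma ∧ ¬ IsSecond w p

/-- The set of nodes whose characteristic string is the row of `w` that ends at position `p`. -/
def rowSet (w : List Sym) (n p : ℕ) : Set (Fin n) := {x | RowHas w p x}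

/-- The squad represented by `p`: a hyperedge of the second hypergraph, or the empty set for
positions that do not represent any. -/
def squad (w : List Sym) (n p : ℕ) : Set (Fin n) := {x | IsSecond w p ∧ RowHas w p x}

/-- The string `w` represents the pair of hypergraphs `H₁`, `H₂`. -/
structure Codes (w : List Sym) {n : ℕ} (H₁ H₂ : Hypergraph (Fin n)) : Prop where
  lt_of_rowHas : ∀ {p x}, w[p]? = some .comma → RowHas w p x → x < n
  lt_length : n < w.length
  mem_edgeSet₁ : ∀ {e}, e ∈ E(H₁) ↔ ∃ p, IsFirst w p ∧ rowSet w n p = e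
  mem_edgeSet₂ : ∀ {e}, e ∈ E(H₂) ↔ ∃ p, IsSecond w p ∧ rowSet w n p = e
  exists_edge : ∀ {x}, x ∈ V(H₁) → ∃ e ∈ E(H₁), x ∈ e

section

variable (w : List Sym) {n : ℕ} (H₁ H₂ : Hypergraph (Fin n))

/-- The intended meaning of the relations. -/
def Meaning : Sym ⊕ Rel → List ℕ → Prop
  | .inl s, [p] => w[p]? = some s
  | .inr .col, [q, x] => IsCol w q x
  | .inr .second, [p] => IsSecond w p
  | .inr .edge₁, [p, x] => ∃ X : Fin n, X = x ∧ IsFirst w p ∧ RowHas w p x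
  | .inr .edge₂, [p, x] => ∃ X : Fin n, X = x ∧ X ∈ squad w n p
  | .inr .comp, [j, x, y] => ∃ X ∈ V(H₁), ∃ Y : Fin n, X = x ∧ Y = y ∧ Y ∈ reach H₁ (squad w n j) X
  | .inr .bord, [j, x, y] => ∃ X ∈ V(H₁), ∃ Y : Fin n, X = x ∧ Y = y ∧
      Y ∈ border H₁ (reach H₁ (squad w n j) X)
  | .inr .path, [j, x, k, z] => ∃ X ∈ V(H₁), ∃ Z : Fin n, X = x ∧ Z = z ∧
      HasPathOff H₁ (squad w n k ∩ border H₁ (reach H₁ (squad w n j) X)) X Z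
  | .inr .win, [j, x] => ∃ X ∈ V(H₁), X = x ∧ WinAt H₁ H₂ (squad w n j) X
  | _, _ => False

end

/-! ### Formulas that define the relations -/

/-- Formulas about inputs and the relations computed from them. The variables `0`, `1`, `2`, `3`
are used for the members of tuples, `4`, …, `7` for quantification, and the others as names of loop
counters. -/
abbrev Formula := Fm (Sym ⊕ Rel) (Fin 12)

/-- The symbol at position `x` is `s`. -/
def symFm (s : Sym) (x : Fin 12) : Formula := .rel (.inl s) [x]

/-- The computed relation `r` holds of `xs`. -/
def relFm (r : Rel) (xs : List (Fin 12)) : Formula := .rel (.inr r) xs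

/-- Position `x` holds a separator. -/
def sepFm (x : Fin 12) : Formula := .or (symFm .comma x) (symFm .semicolon x)

/-- Position `x` holds a bit. -/
def bitFm (x : Fin 12) : Formula := .or (symFm .zero x) (symFm .one x)

/-- `y` is the successor of `x`; the variable `z` is quantified. -/
def succFm (x y z : Fin 12) : Formula := .and (.lt x y) (.neg (.ex z (.and (.lt x z) (.lt z y))))

/-- The recursive definition of columns: position `0` is in column `1` if it holds a bit, and the
position before it holds a separator or is in the preceding column. -/
def colFm : Formula :=
  .and (bitFm 0) <| .ex 4 <| .and (succFm 4 0 6) <|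
    .or (.and (sepFm 4) (.neg (.ex 5 (.lt 5 1))))
      (.ex 5 (.and (succFm 5 1 6) (relFm .col [4, 5])))

/-- Position `0` ends a row of the second matrix: two semicolons stand before it. -/
def secondFm : Formula :=
  .and (symFm .comma 0) <| .ex 4 <| .ex 5 <| .and (.lt 4 5) <| .and (.lt 5 0) <|
    .and (symFm .semicolon 4) (symFm .semicolon 5)

/-- The row that ends before position `0` has a `1` in column `1`. -/
def rowFm : Formula :=
  .ex 4 <| .and (.lt 4 0) <| .and (symFm .one 4) <| .and (relFm .col [4, 1]) <|
    .neg <| .ex 5 <| .and (.lt 4 5) <| .and (.lt 5 0) (sepFm 5)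

/-- Node `1` is in the hyperedge of the first hypergraph that is represented by `0`. -/
def edge₁Fm : Formula := .and (.and (symFm .comma 0) (.neg (relFm .second [0]))) rowFm

/-- Node `1` is in the squad represented by `0`. -/
def edge₂Fm : Formula := .and (relFm .second [0]) rowFm

/-- `x` is a node of the first hypergraph; the variable `i` is quantified. -/
def nodeFm (x i : Fin 12) : Formula := .ex i (relFm .edge₁ [i, x])

/-- The recursive definition of reachability from node `1` to node `2` outside of squad `0`. -/
def compFm : Formula :=
  .or (.and (.eq 1 2) (nodeFm 1 4)) <|
    .ex 4 <| .and (relFm .comp [0, 1, 4]) <| .ex 5 <|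
      .and (.and (relFm .edge₁ [5, 4]) (.neg (relFm .edge₂ [0, 4])))
        (.and (relFm .edge₁ [5, 2]) (.neg (relFm .edge₂ [0, 2])))

/-- Node `2` is in the border of the component of node `1` outside of squad `0`. -/
def bordFm : Formula :=
  .and (.ex 4 <| .and (relFm .comp [0, 1, 4]) <| .ex 5 <|
      .and (relFm .edge₁ [5, 4]) (relFm .edge₁ [5, 2]))
    (.neg (relFm .comp [0, 1, 2]))

/-- The recursive definition of reachability from node `1` to node `3` outside of the intersection
of squad `2` with the border of the component of node `1` outside of squad `0`. -/
def pathFm : Formula :=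
  .or (.and (.eq 1 3) (nodeFm 1 4)) <|
    .ex 4 <| .and (relFm .path [0, 1, 2, 4]) <| .ex 5 <|
      .and (.and (relFm .edge₁ [5, 4]) (.neg (.and (relFm .edge₂ [2, 4]) (relFm .bord [0, 1, 4]))))
        (.and (relFm .edge₁ [5, 3]) (.neg (.and (relFm .edge₂ [2, 3]) (relFm .bord [0, 1, 3]))))

/-- The recursive definition of `WinAt` for squad `0` and node `1`. -/
def winFm : Formula :=
  .and (nodeFm 1 4) <| .ex 4 <| .and (relFm .second [4]) <| .all 5 <|
    .imp (.and (nodeFm 5 6) (.and (.neg (relFm .edge₂ [4, 5])) (relFm .path [0, 1, 4, 5])))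
      (relFm .win [4, 5])

/-- The Captain has a greedy winning strategy: according to whether there are nodes or not, this is
`hasGreedyWinningStrategy_iff` or `hasGreedyWinningStrategy_iff_of_eq_empty`. A position that does
not end a row of the second matrix represents the empty squad. -/
def answerFm : Formula :=
  .or
    (.and (.ex 4 (nodeFm 4 5)) <| .and (.ex 4 (relFm .second [4])) <|
      .ex 4 <| .and (.neg (relFm .second [4])) <| .or
        (.ex 5 <| .ex 6 <| .and (nodeFm 5 7) <| .and (nodeFm 6 7) (.neg (relFm .comp [4, 5, 6])))
        (.ex 5 <| .and (nodeFm 5 7) (relFm .win [4, 5])))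
    (.and (.neg (.ex 4 (nodeFm 4 5))) <| .ex 4 <| .and (relFm .second [4]) <|
      .ex 5 (relFm .edge₂ [4, 5]))

/-- The program that computes the relations. -/
def program : Cmd (Sym ⊕ Rel) (Fin 12) :=
  .seq (.fix [8, 9] (.inr .col) [0, 1] colFm) <|
  .seq (.fix [8] (.inr .second) [0] secondFm) <|
  .seq (.fix [8, 9] (.inr .edge₁) [0, 1] edge₁Fm) <|
  .seq (.fix [8, 9] (.inr .edge₂) [0, 1] edge₂Fm) <|
  .seq (.fix [8, 9, 10] (.inr .comp) [0, 1, 2] compFm) <|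
  .seq (.fix [8, 9, 10] (.inr .bord) [0, 1, 2] bordFm) <|
  .seq (.fix [8, 9, 10, 11] (.inr .path) [0, 1, 2, 3] pathFm) <|
  .fix [8, 9] (.inr .win) [0, 1] winFm

theorem wf_program : program.wf 4 = true := by decide

theorem wf_answerFm : answerFm.wf 4 = true := by decide

section

variable {w : List Sym} {n : ℕ} {H₁ H₂ : Hypergraph (Fin n)}

theorem squad_of_isSecond {p : ℕ} (hp : IsSecond w p) : squad w n p = rowSet w n p :=
  Set.ext fun _ => and_iff_right hp

theorem squad_of_not_isSecond {p : ℕ} (hp : ¬ IsSecond w p) : squad w n p = ∅ :=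
  Set.eq_empty_of_forall_notMem fun _ h => hp h.1

theorem lt_length_of_isFirst {p : ℕ} (hp : IsFirst w p) : p < w.length :=
  (List.getElem?_eq_some_iff.1 hp.1).1

theorem lt_length_of_isSecond {p : ℕ} (hp : IsSecond w p) : p < w.length :=
  (List.getElem?_eq_some_iff.1 hp.1).1

theorem Codes.mem_vertexSet (hw : Codes w H₁ H₂) {x : Fin n} :
    x ∈ V(H₁) ↔ ∃ p < w.length, IsFirst w p ∧ RowHas w p x := by
  constructor
  · intro hx
    obtain ⟨e, he, hxe⟩ := hw.exists_edge hx
    obtain ⟨p, hp, rfl⟩ := hw.mem_edgeSet₁.1 he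
    exact ⟨p, lt_length_of_isFirst hp, hp, hxe⟩
  · rintro ⟨p, -, hp, hx⟩
    exact H₁.subset_vertexSet_of_mem_edgeSet' (hw.mem_edgeSet₁.2 ⟨p, hp, rfl⟩) hx

theorem Codes.adjOff_iff (hw : Codes w H₁ H₂) {S : Set (Fin n)} {x y : Fin n} :
    AdjOff H₁ S x y ↔ ∃ p < w.length, ((IsFirst w p ∧ RowHas w p x) ∧ x ∉ S) ∧
      (IsFirst w p ∧ RowHas w p y) ∧ y ∉ S := by
  constructor
  · rintro ⟨e, he, hx, hy⟩
    obtain ⟨p, hp, rfl⟩ := hw.mem_edgeSet₁.1 he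
    exact ⟨p, lt_length_of_isFirst hp, ⟨⟨hp, hx.1⟩, hx.2⟩, ⟨hp, hy.1⟩, hy.2⟩
  · rintro ⟨p, -, ⟨⟨hp, hx⟩, hx'⟩, ⟨-, hy⟩, hy'⟩
    exact ⟨_, hw.mem_edgeSet₁.2 ⟨p, hp, rfl⟩, ⟨hx, hx'⟩, hy, hy'⟩

local notation "Sem" => Meaning w H₁ H₂

theorem meaning_edge₁ {p : ℕ} {x : Fin n} :
    Sem (.inr .edge₁) [p, x] ↔ IsFirst w p ∧ RowHas w p x :=
  ⟨fun ⟨_, _, h⟩ => h, fun h => ⟨x, rfl, h⟩⟩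

theorem meaning_edge₂ {p : ℕ} {x : Fin n} : Sem (.inr .edge₂) [p, x] ↔ x ∈ squad w n p :=
  ⟨fun ⟨_, hX, h⟩ => Fin.ext hX ▸ h, fun h => ⟨x, rfl, h⟩⟩

theorem meaning_comp {j : ℕ} {x y : Fin n} :
    Sem (.inr .comp) [j, x, y] ↔ x ∈ V(H₁) ∧ y ∈ reach H₁ (squad w n j) x := by
  constructor
  · rintro ⟨X, hX, Y, hx, hy, h⟩
    obtain rfl := Fin.ext hx
    obtain rfl := Fin.ext hy
    exact ⟨hX, h⟩
  · exact fun h => ⟨x, h.1, y, rfl, rfl, h.2⟩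

theorem meaning_bord {j : ℕ} {x y : Fin n} : Sem (.inr .bord) [j, x, y] ↔
    x ∈ V(H₁) ∧ y ∈ border H₁ (reach H₁ (squad w n j) x) := by
  constructor
  · rintro ⟨X, hX, Y, hx, hy, h⟩
    obtain rfl := Fin.ext hx
    obtain rfl := Fin.ext hy
    exact ⟨hX, h⟩
  · exact fun h => ⟨x, h.1, y, rfl, rfl, h.2⟩

theorem meaning_path {j k : ℕ} {x z : Fin n} : Sem (.inr .path) [j, x, k, z] ↔
    x ∈ V(H₁) ∧ HasPathOff H₁ (squad w n k ∩ border H₁ (reach H₁ (squad w n j) x)) x z := by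
  constructor
  · rintro ⟨X, hX, Z, hx, hz, h⟩
    obtain rfl := Fin.ext hx
    obtain rfl := Fin.ext hz
    exact ⟨hX, h⟩
  · exact fun h => ⟨x, h.1, z, rfl, rfl, h.2⟩

theorem meaning_win {j : ℕ} {x : Fin n} :
    Sem (.inr .win) [j, x] ↔ x ∈ V(H₁) ∧ WinAt H₁ H₂ (squad w n j) x := by
  constructor
  · rintro ⟨X, hX, hx, h⟩
    obtain rfl := Fin.ext hx
    exact ⟨hX, h⟩
  · exact fun h => ⟨x, h.1, rfl, h.2⟩

theorem node_iff (hw : Codes w H₁ H₂) {x : Fin n} :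
    (∃ i < w.length, Sem (.inr .edge₁) [i, x]) ↔ x ∈ V(H₁) := by
  simp only [meaning_edge₁, hw.mem_vertexSet]

/-! ### Correctness of the definitions -/

section

variable {R : Sym ⊕ Rel → List ℕ → Prop} {N : ℕ}

theorem sat_colFm {q x : ℕ} : colFm.Sat N R (assign (fun _ => 0) [0, 1] [q, x]) ↔
    (R (.inl .zero) [q] ∨ R (.inl .one) [q]) ∧ ∃ r < N, (r < q ∧ ¬ ∃ i < N, r < i ∧ i < q) ∧
      ((R (.inl .comma) [r] ∨ R (.inl .semicolon) [r]) ∧ (¬ ∃ i < N, i < x) ∨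
        ∃ y < N, (y < x ∧ ¬ ∃ i < N, y < i ∧ i < x) ∧ R (.inr .col) [r, y]) := by
  simp [colFm, bitFm, succFm, sepFm, relFm, symFm, Fm.Sat, Fm.sat_or, assign]

theorem sat_secondFm {p : ℕ} : secondFm.Sat N R (assign (fun _ => 0) [0] [p]) ↔
    R (.inl .comma) [p] ∧ ∃ i < N, ∃ j < N, i < j ∧ j < p ∧
      R (.inl .semicolon) [i] ∧ R (.inl .semicolon) [j] := by
  simp [secondFm, symFm, Fm.Sat, assign]

theorem sat_rowFm {p x : ℕ} : rowFm.Sat N R (assign (fun _ => 0) [0, 1] [p, x]) ↔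
    ∃ q < N, q < p ∧ R (.inl .one) [q] ∧ R (.inr .col) [q, x] ∧
      ¬ ∃ i < N, q < i ∧ i < p ∧ (R (.inl .comma) [i] ∨ R (.inl .semicolon) [i]) := by
  simp [rowFm, symFm, sepFm, relFm, Fm.Sat, Fm.sat_or, assign]

theorem sat_edge₁Fm {p x : ℕ} : edge₁Fm.Sat N R (assign (fun _ => 0) [0, 1] [p, x]) ↔
    (R (.inl .comma) [p] ∧ ¬ R (.inr .second) [p]) ∧
      rowFm.Sat N R (assign (fun _ => 0) [0, 1] [p, x]) := by
  simp [edge₁Fm, symFm, relFm, Fm.Sat, assign]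

theorem sat_edge₂Fm {p x : ℕ} : edge₂Fm.Sat N R (assign (fun _ => 0) [0, 1] [p, x]) ↔
    R (.inr .second) [p] ∧ rowFm.Sat N R (assign (fun _ => 0) [0, 1] [p, x]) := by
  simp [edge₂Fm, relFm, Fm.Sat, assign]

theorem sat_compFm {j x y : ℕ} : compFm.Sat N R (assign (fun _ => 0) [0, 1, 2] [j, x, y]) ↔
    (x = y ∧ ∃ i < N, R (.inr .edge₁) [i, x]) ∨
      ∃ z < N, R (.inr .comp) [j, x, z] ∧ ∃ i < N,
        (R (.inr .edge₁) [i, z] ∧ ¬ R (.inr .edge₂) [j, z]) ∧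
          R (.inr .edge₁) [i, y] ∧ ¬ R (.inr .edge₂) [j, y] := by
  simp [compFm, nodeFm, relFm, Fm.Sat, Fm.sat_or, Fm.sat_eq, assign]

theorem sat_bordFm {j x y : ℕ} : bordFm.Sat N R (assign (fun _ => 0) [0, 1, 2] [j, x, y]) ↔
    (∃ z < N, R (.inr .comp) [j, x, z] ∧ ∃ i < N,
      R (.inr .edge₁) [i, z] ∧ R (.inr .edge₁) [i, y]) ∧ ¬ R (.inr .comp) [j, x, y] := by
  simp [bordFm, relFm, Fm.Sat, assign]

theorem sat_pathFm {j x k z : ℕ} :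
    pathFm.Sat N R (assign (fun _ => 0) [0, 1, 2, 3] [j, x, k, z]) ↔
    (x = z ∧ ∃ i < N, R (.inr .edge₁) [i, x]) ∨
      ∃ y < N, R (.inr .path) [j, x, k, y] ∧ ∃ i < N,
        (R (.inr .edge₁) [i, y] ∧ ¬ (R (.inr .edge₂) [k, y] ∧ R (.inr .bord) [j, x, y])) ∧
          R (.inr .edge₁) [i, z] ∧ ¬ (R (.inr .edge₂) [k, z] ∧ R (.inr .bord) [j, x, z]) := by
  simp [pathFm, nodeFm, relFm, Fm.Sat, Fm.sat_or, Fm.sat_eq, assign]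

theorem sat_winFm {j x : ℕ} : winFm.Sat N R (assign (fun _ => 0) [0, 1] [j, x]) ↔
    (∃ i < N, R (.inr .edge₁) [i, x]) ∧ ∃ k < N, R (.inr .second) [k] ∧ ∀ z < N,
      (∃ i < N, R (.inr .edge₁) [i, z]) ∧ ¬ R (.inr .edge₂) [k, z] ∧
        R (.inr .path) [j, x, k, z] → R (.inr .win) [k, z] := by
  simp only [winFm, nodeFm, relFm, Fm.Sat, Fm.sat_all, Fm.sat_imp, assign]
  simp

theorem sat_answerFm : answerFm.Sat N R (fun _ => 0) ↔
    ((∃ x < N, ∃ i < N, R (.inr .edge₁) [i, x]) ∧ (∃ k < N, R (.inr .second) [k]) ∧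
      ∃ j < N, ¬ R (.inr .second) [j] ∧
        ((∃ x < N, ∃ y < N, (∃ i < N, R (.inr .edge₁) [i, x]) ∧
          (∃ i < N, R (.inr .edge₁) [i, y]) ∧ ¬ R (.inr .comp) [j, x, y]) ∨
        ∃ x < N, (∃ i < N, R (.inr .edge₁) [i, x]) ∧ R (.inr .win) [j, x])) ∨
      ((¬ ∃ x < N, ∃ i < N, R (.inr .edge₁) [i, x]) ∧
        ∃ k < N, R (.inr .second) [k] ∧ ∃ x < N, R (.inr .edge₂) [k, x]) := by
  simp only [answerFm, nodeFm, relFm, Fm.Sat, Fm.sat_or]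
  simp

end

end

end RobberCaptain

namespace RobberCaptain

open scoped Hypergraph
open StackProgram Function

section

variable {w : List Sym} {n : ℕ} {H₁ H₂ : Hypergraph (Fin n)}

local notation "Sem" => Meaning w H₁ H₂

theorem not_exists_between {N p q : ℕ} (hq : q < N) :
    (p < q ∧ ¬ ∃ i < N, p < i ∧ i < q) ↔ q = p + 1 := by
  constructor
  · rintro ⟨h, h'⟩
    by_contra hne
    exact h' ⟨p + 1, by lia, by lia, by lia⟩
  · rintro rfl
    exact ⟨by lia, fun ⟨i, _, _, _⟩ => by lia⟩

theorem isCol_succ {q x : ℕ} : IsCol w (q + 1) (x + 1) ↔ IsBit w (q + 1) ∧ IsCol w q x := by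
  constructor
  · rintro ⟨s, hs, hsep, hb⟩
    exact ⟨hb _ (by lia) le_rfl, s, by lia, hsep, fun i h₁ h₂ => hb i h₁ (by lia)⟩
  · rintro ⟨hq, s, hs, hsep, hb⟩
    refine ⟨s, by lia, hsep, fun i h₁ h₂ => ?_⟩
    rcases h₂.lt_or_eq with h | rfl
    · exact hb i h₁ (by lia)
    · exact hq

theorem isCol_zero {q : ℕ} : IsCol w (q + 1) 0 ↔ IsBit w (q + 1) ∧ IsSep w q := by
  constructor
  · rintro ⟨s, hs, hsep, hb⟩
    obtain rfl : s = q := by lia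
    exact ⟨hb _ (by lia) le_rfl, hsep⟩
  · rintro ⟨hq, hsep⟩
    refine ⟨q, rfl, hsep, fun i h₁ h₂ => ?_⟩
    obtain rfl : i = q + 1 := by lia
    exact hq

theorem not_isCol_zero {x : ℕ} : ¬ IsCol w 0 x := fun ⟨s, hs, _⟩ => by lia

theorem sat_colFm_iff {T : List ℕ → Prop} {q x : ℕ} (hq : q < w.length) (hx : x < w.length) :
    colFm.Sat w.length (update Sem (.inr .col) T) (assign (fun _ => 0) [0, 1] [q, x]) ↔
      IsBit w q ∧ ∃ r, r + 1 = q ∧ (IsSep w r ∧ x = 0 ∨ ∃ y, y + 1 = x ∧ T [r, y]) := by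
  rw [sat_colFm]
  simp only [not_exists_between hq, not_exists_between hx, update_self, ne_eq, reduceCtorEq,
    not_false_eq_true, update_of_ne, Meaning]
  refine and_congr_right fun _ => ⟨?_, ?_⟩
  · rintro ⟨r, -, rfl, ⟨hs, hx'⟩ | ⟨y, -, rfl, hT⟩⟩
    · refine ⟨r, rfl, .inl ⟨hs, ?_⟩⟩
      by_contra h
      exact hx' ⟨0, by lia, by lia⟩
    · exact ⟨r, rfl, .inr ⟨y, rfl, hT⟩⟩
  · rintro ⟨r, rfl, ⟨hs, rfl⟩ | ⟨y, rfl, hT⟩⟩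
    · exact ⟨r, by lia, rfl, .inl ⟨hs, by simp⟩⟩
    · exact ⟨r, by lia, rfl, .inr ⟨y, by lia, rfl, hT⟩⟩

theorem sat_secondFm_iff {p : ℕ} :
    secondFm.Sat w.length Sem (assign (fun _ => 0) [0] [p]) ↔ IsSecond w p := by
  rw [sat_secondFm]
  refine and_congr_right fun hp => ?_
  have := (List.getElem?_eq_some_iff.1 hp).1
  constructor
  · rintro ⟨i, -, j, -, h⟩
    exact ⟨i, j, h⟩
  · rintro ⟨i, j, h₁, h₂, h⟩
    exact ⟨i, by lia, j, by lia, h₁, h₂, h⟩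

theorem sat_rowFm_iff {p x : ℕ} (hp : p < w.length) :
    rowFm.Sat w.length Sem (assign (fun _ => 0) [0, 1] [p, x]) ↔ RowHas w p x := by
  rw [sat_rowFm]
  constructor
  · rintro ⟨q, -, hqp, hq, hc, hs⟩
    exact ⟨q, hqp, hq, hc, fun i h₁ h₂ h₃ => hs ⟨i, by lia, h₁, h₂, h₃⟩⟩
  · rintro ⟨q, hqp, hq, hc, hs⟩
    exact ⟨q, by lia, hqp, hq, hc, fun ⟨i, _, h₁, h₂, h₃⟩ => hs i h₁ h₂ h₃⟩

theorem sat_edge₁Fm_iff (hw : Codes w H₁ H₂) {p x : ℕ} (hp : p < w.length) :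
    edge₁Fm.Sat w.length Sem (assign (fun _ => 0) [0, 1] [p, x]) ↔ Sem (.inr .edge₁) [p, x] := by
  rw [sat_edge₁Fm, sat_rowFm_iff hp]
  exact ⟨fun ⟨h₁, h₂⟩ => ⟨⟨x, hw.lt_of_rowHas h₁.1 h₂⟩, rfl, h₁, h₂⟩, fun ⟨_, _, h⟩ => h⟩

theorem sat_edge₂Fm_iff (hw : Codes w H₁ H₂) {p x : ℕ} (hp : p < w.length) :
    edge₂Fm.Sat w.length Sem (assign (fun _ => 0) [0, 1] [p, x]) ↔ Sem (.inr .edge₂) [p, x] := by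
  rw [sat_edge₂Fm, sat_rowFm_iff hp]
  exact ⟨fun ⟨h₁, h₂⟩ => ⟨⟨x, hw.lt_of_rowHas h₁.1 h₂⟩, rfl, h₁, h₂⟩, fun ⟨_, hX, h⟩ => hX ▸ h⟩

/-- Every node that satisfies the membership formula of some row is a number below `n`. -/
theorem exists_fin_of_edge₁ {p x : ℕ} (h : Sem (.inr .edge₁) [p, x]) : ∃ X : Fin n, X = x :=
  ⟨h.choose, h.choose_spec.1⟩

theorem comp_sound (hw : Codes w H₁ H₂) {T : List ℕ → Prop}
    (hT : ∀ is, T is → Sem (.inr .comp) is) {j x y : ℕ}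
    (h : compFm.Sat w.length (update Sem (.inr .comp) T)
      (assign (fun _ => 0) [0, 1, 2] [j, x, y])) : Sem (.inr .comp) [j, x, y] := by
  rw [sat_compFm] at h
  simp only [update_self, ne_eq, reduceCtorEq, not_false_eq_true, update_of_ne, Sum.inr.injEq] at h
  rcases h with ⟨rfl, i, hi, h⟩ | ⟨z, hz, h, i, hi, ⟨h₁, h₂⟩, h₃, h₄⟩
  · obtain ⟨X, rfl⟩ := exists_fin_of_edge₁ h
    exact meaning_comp.2 ⟨(node_iff hw).1 ⟨i, hi, h⟩, .refl⟩
  · obtain ⟨X, hX, Z, rfl, rfl, hp⟩ := hT _ h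
    obtain ⟨Y, rfl⟩ := exists_fin_of_edge₁ h₃
    rw [meaning_edge₁] at h₁ h₃
    rw [meaning_edge₂] at h₂ h₄
    exact meaning_comp.2 ⟨hX, .tail hp (hw.adjOff_iff.2 ⟨i, hi, ⟨h₁, h₂⟩, h₃, h₄⟩)⟩

theorem comp_complete (hw : Codes w H₁ H₂) {T : List ℕ → Prop}
    (hT : ∀ is, IsTuple w.length 3 is → compFm.Sat w.length (update Sem (.inr .comp) T)
      (assign (fun _ => 0) [0, 1, 2] is) → T is) {j x y : ℕ} (hj : j < w.length)
    (h : Sem (.inr .comp) [j, x, y]) : T [j, x, y] := by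
  obtain ⟨X, hX, Y, rfl, rfl, h⟩ := h
  have hlt : ∀ z : Fin n, z < w.length := fun z => z.2.trans hw.lt_length
  induction h with
  | refl =>
    refine hT _ (isTuple_three.2 ⟨j, hj, _, hlt X, _, hlt X, rfl⟩) (sat_compFm.2 ?_)
    simp only [update_self, ne_eq, reduceCtorEq, not_false_eq_true, update_of_ne, Sum.inr.injEq]
    exact .inl ⟨trivial, (node_iff hw).2 hX⟩
  | @tail Z Y _ h ih =>
    obtain ⟨i, hi, ⟨h₁, h₂⟩, h₃, h₄⟩ := hw.adjOff_iff.1 h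
    refine hT _ (isTuple_three.2 ⟨j, hj, _, hlt X, _, hlt Y, rfl⟩) (sat_compFm.2 ?_)
    simp only [update_self, ne_eq, reduceCtorEq, not_false_eq_true, update_of_ne, Sum.inr.injEq]
    exact .inr ⟨Z, hlt Z, ih, i, hi, ⟨meaning_edge₁.2 h₁, meaning_edge₂.not.2 h₂⟩,
      meaning_edge₁.2 h₃, meaning_edge₂.not.2 h₄⟩

theorem sat_bordFm_iff (hw : Codes w H₁ H₂) {j x y : ℕ} :
    bordFm.Sat w.length Sem (assign (fun _ => 0) [0, 1, 2] [j, x, y]) ↔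
      Sem (.inr .bord) [j, x, y] := by
  rw [sat_bordFm]
  constructor
  · rintro ⟨⟨z, hz, ⟨X, hX, Z, rfl, rfl, h⟩, i, hi, h₁, h₂⟩, h₃⟩
    obtain ⟨Y, rfl⟩ := exists_fin_of_edge₁ h₂
    rw [meaning_edge₁] at h₁ h₂
    rw [meaning_comp] at h₃
    exact meaning_bord.2 ⟨hX, ⟨_, hw.mem_edgeSet₁.2 ⟨i, h₁.1, rfl⟩, ⟨Z, h₁.2, h⟩, h₂.2⟩,
      fun h => h₃ ⟨hX, h⟩⟩
  · rintro ⟨X, hX, Y, rfl, rfl, ⟨e, he, ⟨Z, hZe, hZ⟩, hYe⟩, hY⟩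
    obtain ⟨i, hi, rfl⟩ := hw.mem_edgeSet₁.1 he
    exact ⟨⟨Z, Z.2.trans hw.lt_length, meaning_comp.2 ⟨hX, hZ⟩, i, lt_length_of_isFirst hi,
      meaning_edge₁.2 ⟨hi, hZe⟩, meaning_edge₁.2 ⟨hi, hYe⟩⟩, fun h => hY (meaning_comp.1 h).2⟩

theorem path_sound (hw : Codes w H₁ H₂) {T : List ℕ → Prop}
    (hT : ∀ is, T is → Sem (.inr .path) is) {j x k z : ℕ}
    (h : pathFm.Sat w.length (update Sem (.inr .path) T)
      (assign (fun _ => 0) [0, 1, 2, 3] [j, x, k, z])) : Sem (.inr .path) [j, x, k, z] := by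
  rw [sat_pathFm] at h
  simp only [update_self, ne_eq, reduceCtorEq, not_false_eq_true, update_of_ne, Sum.inr.injEq] at h
  rcases h with ⟨rfl, i, hi, h⟩ | ⟨y, hy, h, i, hi, ⟨h₁, h₂⟩, h₃, h₄⟩
  · obtain ⟨X, rfl⟩ := exists_fin_of_edge₁ h
    exact meaning_path.2 ⟨(node_iff hw).1 ⟨i, hi, h⟩, .refl⟩
  · obtain ⟨X, hX, Y, rfl, rfl, hp⟩ := hT _ h
    obtain ⟨Z, rfl⟩ := exists_fin_of_edge₁ h₃
    rw [meaning_edge₁] at h₁ h₃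
    rw [meaning_edge₂, meaning_bord] at h₂ h₄
    exact meaning_path.2 ⟨hX, .tail hp (hw.adjOff_iff.2
      ⟨i, hi, ⟨h₁, fun h => h₂ ⟨h.1, hX, h.2⟩⟩, h₃, fun h => h₄ ⟨h.1, hX, h.2⟩⟩)⟩

theorem path_complete (hw : Codes w H₁ H₂) {T : List ℕ → Prop}
    (hT : ∀ is, IsTuple w.length 4 is → pathFm.Sat w.length (update Sem (.inr .path) T)
      (assign (fun _ => 0) [0, 1, 2, 3] is) → T is) {j x k z : ℕ} (hj : j < w.length)
    (hk : k < w.length) (h : Sem (.inr .path) [j, x, k, z]) : T [j, x, k, z] := by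
  obtain ⟨X, hX, Z, rfl, rfl, h⟩ := h
  have hlt : ∀ z : Fin n, z < w.length := fun z => z.2.trans hw.lt_length
  induction h with
  | refl =>
    refine hT _ (isTuple_four.2 ⟨j, hj, _, hlt X, k, hk, _, hlt X, rfl⟩) (sat_pathFm.2 ?_)
    simp only [update_self, ne_eq, reduceCtorEq, not_false_eq_true, update_of_ne, Sum.inr.injEq]
    exact .inl ⟨trivial, (node_iff hw).2 hX⟩
  | @tail Y Z _ h ih =>
    obtain ⟨i, hi, ⟨h₁, h₂⟩, h₃, h₄⟩ := hw.adjOff_iff.1 h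
    refine hT _ (isTuple_four.2 ⟨j, hj, _, hlt X, k, hk, _, hlt Z, rfl⟩) (sat_pathFm.2 ?_)
    simp only [update_self, ne_eq, reduceCtorEq, not_false_eq_true, update_of_ne, Sum.inr.injEq,
      meaning_edge₁, meaning_edge₂, meaning_bord]
    exact .inr ⟨Y, hlt Y, ih, i, hi, ⟨meaning_edge₁.2 h₁, fun h => h₂
      ⟨meaning_edge₂.1 h.1, (meaning_bord.1 h.2).2⟩⟩, h₃, fun h => h₄ ⟨h.1, h.2.2⟩⟩

theorem win_sound (hw : Codes w H₁ H₂) {T : List ℕ → Prop}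
    (hT : ∀ is, T is → Sem (.inr .win) is) {j x : ℕ}
    (h : winFm.Sat w.length (update Sem (.inr .win) T) (assign (fun _ => 0) [0, 1] [j, x])) :
    Sem (.inr .win) [j, x] := by
  rw [sat_winFm] at h
  simp only [update_self, ne_eq, reduceCtorEq, not_false_eq_true, update_of_ne, Sum.inr.injEq] at h
  obtain ⟨hx, k, -, hk, h⟩ := h
  obtain ⟨X, rfl⟩ := exists_fin_of_edge₁ hx.choose_spec.2
  have hX := (node_iff hw).1 hx
  refine meaning_win.2 ⟨hX, .mk _ _ (squad w n k) ?_ fun Z hZ hp => ?_⟩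
  · exact hw.mem_edgeSet₂.2 ⟨k, hk, (squad_of_isSecond hk).symm⟩
  · exact (meaning_win.1 (hT _ (h Z (Z.2.trans hw.lt_length) ⟨(node_iff hw).2 hZ.1,
      fun h => hZ.2 (meaning_edge₂.1 h), meaning_path.2 ⟨hX, hp⟩⟩))).2

theorem win_complete (hw : Codes w H₁ H₂) {T : List ℕ → Prop}
    (hT : ∀ is, IsTuple w.length 2 is → winFm.Sat w.length (update Sem (.inr .win) T)
      (assign (fun _ => 0) [0, 1] is) → T is) {j x : ℕ} (hj : j < w.length)
    (h : Sem (.inr .win) [j, x]) : T [j, x] := by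
  obtain ⟨X, hX, rfl, h⟩ := h
  generalize hs : squad w n j = s at h
  induction h generalizing j with
  | mk s X k hk ho ih =>
    obtain ⟨p, hp, rfl⟩ := hw.mem_edgeSet₂.1 hk
    subst hs
    have hp' := lt_length_of_isSecond hp
    refine hT _ (isTuple_two.2 ⟨j, hj, _, X.2.trans hw.lt_length, rfl⟩) (sat_winFm.2 ?_)
    simp only [update_self, ne_eq, reduceCtorEq, not_false_eq_true, update_of_ne, Sum.inr.injEq]
    refine ⟨(node_iff hw).2 hX, p, hp', hp, fun z hz ⟨hz₁, hz₂, hz₃⟩ => ?_⟩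
    obtain ⟨Z, rfl⟩ := exists_fin_of_edge₁ hz₁.choose_spec.2
    rw [node_iff hw] at hz₁
    rw [meaning_edge₂, squad_of_isSecond hp] at hz₂
    rw [meaning_path, squad_of_isSecond hp] at hz₃
    exact ih Z ⟨hz₁, hz₂⟩ hz₃.2 hp' hz₁ (squad_of_isSecond hp)

theorem correct_program (hw : Codes w H₁ H₂) {M : Sym ⊕ Rel → ℕ → Bool}
    (hM : Correct w.length arity Sem [.inl .zero, .inl .one, .inl .comma, .inl .semicolon] M) :
    Correct w.length arity Sem
      [.inr .win, .inr .path, .inr .bord, .inr .comp, .inr .edge₂, .inr .edge₁, .inr .second,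
        .inr .col, .inl .zero, .inl .one, .inl .comma, .inl .semicolon]
      (program.eval w.length (fun _ => 0) M) := by
  have hN : ∀ _ : Fin 12, 0 < w.length := fun _ => (Nat.zero_le n).trans_lt hw.lt_length
  have h₁ := hM.fix (a := .inr .col) (rs := [8, 9]) (xs := [0, 1]) (φ := colFm) (by simp) rfl rfl
    (by decide) (by decide) hN
    (fun T hT is his h => by
      obtain ⟨q, hq, x, hx, rfl⟩ := isTuple_two.1 his
      obtain ⟨hb, r, rfl, ⟨hs, rfl⟩ | ⟨y, rfl, hy⟩⟩ := (sat_colFm_iff hq hx).1 h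
      · exact isCol_zero.2 ⟨hb, hs⟩
      · exact isCol_succ.2 ⟨hb, hT _ hy⟩)
    (fun T hT is his h => by
      obtain ⟨q, hq, x, hx, rfl⟩ := isTuple_two.1 his
      change IsCol w q x at h
      clear his
      induction x generalizing q with
      | zero =>
        cases q with
        | zero => exact (not_isCol_zero h).elim
        | succ q =>
          obtain ⟨hb, hs⟩ := isCol_zero.1 h
          exact hT _ (isTuple_two.2 ⟨_, hq, _, hx, rfl⟩)
            ((sat_colFm_iff hq hx).2 ⟨hb, q, rfl, .inl ⟨hs, rfl⟩⟩)
      | succ x ih =>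
        cases q with
        | zero => exact (not_isCol_zero h).elim
        | succ q =>
          obtain ⟨hb, h⟩ := isCol_succ.1 h
          exact hT _ (isTuple_two.2 ⟨_, hq, _, hx, rfl⟩)
            ((sat_colFm_iff hq hx).2 ⟨hb, q, rfl, .inr ⟨x, rfl, ih q (by lia) (by lia) h⟩⟩))
  have h₂ := h₁.fix_of_iff (a := .inr .second) (rs := [8]) (xs := [0]) (φ := secondFm) (by simp)
    rfl rfl (by decide) (by decide) hN fun is his => by
      obtain ⟨p, hp, rfl⟩ := isTuple_one.1 his
      exact sat_secondFm_iff
  have h₃ := h₂.fix_of_iff (a := .inr .edge₁) (rs := [8, 9]) (xs := [0, 1]) (φ := edge₁Fm)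
    (by simp) rfl rfl (by decide) (by decide) hN fun is his => by
      obtain ⟨p, hp, x, hx, rfl⟩ := isTuple_two.1 his
      exact sat_edge₁Fm_iff hw hp
  have h₄ := h₃.fix_of_iff (a := .inr .edge₂) (rs := [8, 9]) (xs := [0, 1]) (φ := edge₂Fm)
    (by simp) rfl rfl (by decide) (by decide) hN fun is his => by
      obtain ⟨p, hp, x, hx, rfl⟩ := isTuple_two.1 his
      exact sat_edge₂Fm_iff hw hp
  have h₅ := h₄.fix (a := .inr .comp) (rs := [8, 9, 10]) (xs := [0, 1, 2]) (φ := compFm)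
    (by simp) rfl rfl (by decide) (by decide) hN
    (fun T hT is his h => by
      obtain ⟨j, hj, x, hx, y, hy, rfl⟩ := isTuple_three.1 his
      exact comp_sound hw hT h)
    (fun T hT is his h => by
      obtain ⟨j, hj, x, hx, y, hy, rfl⟩ := isTuple_three.1 his
      exact comp_complete hw hT hj h)
  have h₆ := h₅.fix_of_iff (a := .inr .bord) (rs := [8, 9, 10]) (xs := [0, 1, 2]) (φ := bordFm)
    (by simp) rfl rfl (by decide) (by decide) hN fun is his => by
      obtain ⟨j, hj, x, hx, y, hy, rfl⟩ := isTuple_three.1 his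
      exact sat_bordFm_iff hw
  have h₇ := h₆.fix (a := .inr .path) (rs := [8, 9, 10, 11]) (xs := [0, 1, 2, 3]) (φ := pathFm)
    (by simp) rfl rfl (by decide) (by decide) hN
    (fun T hT is his h => by
      obtain ⟨j, hj, x, hx, k, hk, z, hz, rfl⟩ := isTuple_four.1 his
      exact path_sound hw hT h)
    (fun T hT is his h => by
      obtain ⟨j, hj, x, hx, k, hk, z, hz, rfl⟩ := isTuple_four.1 his
      exact path_complete hw hT hj hk h)
  exact h₇.fix (a := .inr .win) (rs := [8, 9]) (xs := [0, 1]) (φ := winFm)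
    (by simp) rfl rfl (by decide) (by decide) hN
    (fun T hT is his h => by
      obtain ⟨j, hj, x, hx, rfl⟩ := isTuple_two.1 his
      exact win_sound hw hT h)
    (fun T hT is his h => by
      obtain ⟨j, hj, x, hx, rfl⟩ := isTuple_two.1 his
      exact win_complete hw hT hj h)

theorem correct_inputRel (w : List Sym) {n : ℕ} (H₁ H₂ : Hypergraph (Fin n)) :
    Correct w.length arity (Meaning w H₁ H₂)
      [.inl .zero, .inl .one, .inl .comma, .inl .semicolon] (inputRel w) := by
  refine ⟨fun a ha is his => ?_, fun a ha j => ?_⟩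
  · cases a with
    | inl s =>
      obtain ⟨i, hi, rfl⟩ := isTuple_one.1 his
      simp [inputRel, address, Meaning]
    | inr r => simp at ha
  · cases a with
    | inl s => cases s <;> simp at ha
    | inr r => rfl

/-- The relations that are computed from a code of two hypergraphs tell the winner. -/
theorem holds_answerFm_iff (hw : Codes w H₁ H₂) :
    answerFm.Holds w.length (program.eval w.length (fun _ => 0) (inputRel w)) (fun _ => 0) ↔
      HasGreedyWinningStrategy H₁ H₂ := by
  have h0 : 0 < w.length := (Nat.zero_le n).trans_lt hw.lt_length
  have hlt : ∀ z : Fin n, z < w.length := fun z => z.2.trans hw.lt_length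
  rw [(correct_program hw (correct_inputRel w H₁ H₂)).sat_iff (by decide) (fun _ => h0),
    sat_answerFm]
  have hV : (∃ x < w.length, ∃ i < w.length, Sem (.inr .edge₁) [i, x]) ↔ V(H₁).Nonempty := by
    constructor
    · rintro ⟨x, hx, h⟩
      obtain ⟨X, rfl⟩ := exists_fin_of_edge₁ h.choose_spec.2
      exact ⟨X, (node_iff hw).1 h⟩
    · rintro ⟨X, hX⟩
      exact ⟨X, hlt X, (node_iff hw).2 hX⟩
  rw [hV]
  by_cases hne : V(H₁).Nonempty
  · rw [hasGreedyWinningStrategy_iff (fun x => hw.exists_edge) hne]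
    simp only [hne, true_and, not_true, false_and, or_false]
    refine and_congr ?_ ?_
    · constructor
      · rintro ⟨k, -, hk⟩
        exact ⟨_, hw.mem_edgeSet₂.2 ⟨k, hk, rfl⟩⟩
      · rintro ⟨e, he⟩
        obtain ⟨k, hk, -⟩ := hw.mem_edgeSet₂.1 he
        exact ⟨k, lt_length_of_isSecond hk, hk⟩
    · constructor
      · rintro ⟨j, hj, hs, ⟨x, hx, y, hy, h₁, h₂, h₃⟩ | ⟨x, hx, -, h⟩⟩
        · obtain ⟨X, rfl⟩ := exists_fin_of_edge₁ h₁.choose_spec.2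
          obtain ⟨Y, rfl⟩ := exists_fin_of_edge₁ h₂.choose_spec.2
          rw [meaning_comp, squad_of_not_isSecond hs] at h₃
          rw [node_iff hw] at h₁ h₂
          exact .inl ⟨X, h₁, Y, h₂, fun h => h₃ ⟨h₁, h⟩⟩
        · obtain ⟨X, hX, -, h⟩ := h
          rw [squad_of_not_isSecond hs] at h
          exact .inr ⟨X, hX, h⟩
      · -- The position `0` represents the empty squad.
        have hs : ¬ IsSecond w 0 := fun ⟨_, i, j, _, h, _⟩ => by lia
        have hs' := squad_of_not_isSecond (n := n) hs
        rintro (⟨X, hX, Y, hY, h⟩ | ⟨X, hX, h⟩)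
        · refine ⟨0, h0, hs, .inl ⟨X, hlt X, Y, hlt Y, (node_iff hw).2 hX, (node_iff hw).2 hY, ?_⟩⟩
          rw [meaning_comp, hs']
          exact fun h' => h h'.2
        · refine ⟨0, h0, hs, .inr ⟨X, hlt X, (node_iff hw).2 hX, ?_⟩⟩
          rw [meaning_win, hs']
          exact ⟨hX, h⟩
  · rw [hasGreedyWinningStrategy_iff_of_eq_empty (Set.not_nonempty_iff_eq_empty.1 hne)]
    simp only [hne, false_and, not_false_eq_true, true_and, false_or]
    constructor
    · rintro ⟨k, -, hk, x, -, X, -, h⟩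
      exact ⟨_, hw.mem_edgeSet₂.2 ⟨k, hk, rfl⟩, X, h.2⟩
    · rintro ⟨e, he, X, hX⟩
      obtain ⟨k, hk, rfl⟩ := hw.mem_edgeSet₂.1 he
      exact ⟨k, lt_length_of_isSecond hk, hk, X, hlt X, X, rfl, hk, hX⟩

end

end RobberCaptain

namespace RobberCaptain

open scoped Hypergraph
open StackProgram Function

/-! ### Encoded inputs -/

section

variable {n : ℕ}

/-- The rows of a matrix. -/
abbrev rows (L : List (Finset (Fin n))) : List Sym := L.flatMap encodeRow

/-- The characteristic string of a hyperedge. -/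
def bits (h : Finset (Fin n)) : List Sym :=
  List.ofFn fun i => if i ∈ h then Sym.one else Sym.zero

theorem length_bits (h : Finset (Fin n)) : (bits h).length = n := List.length_ofFn

theorem encodeRow_eq (h : Finset (Fin n)) : encodeRow h = bits h ++ [.comma] := rfl

theorem mem_bits {h : Finset (Fin n)} {s : Sym} (hs : s ∈ bits h) : s = .zero ∨ s = .one := by
  obtain ⟨i, rfl⟩ := (List.mem_ofFn' _ _).1 hs
  dsimp only
  split_ifs <;> simp

theorem getElem?_bits_eq_one {h : Finset (Fin n)} {x : ℕ} :
    (bits h)[x]? = some .one ↔ ∃ X ∈ h, (X : ℕ) = x := by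
  simp only [bits, List.getElem?_ofFn]
  constructor
  · intro hx
    split_ifs at hx with hxn hxh
    · exact ⟨_, hxh, rfl⟩
    · simp at hx
  · rintro ⟨X, hX, rfl⟩
    simp [hX]

theorem semicolon_notMem_rows (L : List (Finset (Fin n))) : Sym.semicolon ∉ rows L := by
  simp only [rows, List.mem_flatMap, encodeRow_eq, List.mem_append, not_exists, not_and]
  rintro h - (hs | hs)
  · rcases mem_bits hs with hs | hs <;> cases hs
  · simp at hs

/-- The commas in the rows of a matrix are the ends of the rows. -/
theorem getElem?_rows_eq_comma {L : List (Finset (Fin n))} {i : ℕ} :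
    (rows L)[i]? = some .comma ↔
      ∃ L' h L'', L = L' ++ h :: L'' ∧ i = (rows L').length + n := by
  constructor
  · intro hi
    induction L generalizing i with
    | nil => simp at hi
    | cons h L ih =>
      rw [rows, List.flatMap_cons, encodeRow_eq, List.append_assoc, List.getElem?_append,
        length_bits] at hi
      split_ifs at hi with hin
      · rcases mem_bits (List.mem_of_getElem? hi) with hs | hs <;> cases hs
      · rw [List.singleton_append, List.getElem?_cons] at hi
        split_ifs at hi with hin'
        · exact ⟨[], h, L, rfl, by simp; lia⟩
        · obtain ⟨L', h', L'', rfl, hi⟩ := ih hi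
          refine ⟨h :: L', h', L'', rfl, ?_⟩
          rw [rows, List.flatMap_cons, encodeRow_eq, List.length_append, List.length_append,
            length_bits, List.length_singleton]
          lia
  · rintro ⟨L', h, L'', rfl, rfl⟩
    rw [rows, List.flatMap_append, List.flatMap_cons, encodeRow_eq, List.getElem?_append_right
      (by simp), List.append_assoc, List.getElem?_append_right (by simp [length_bits])]
    simp [length_bits]

theorem rowHas_iff_getElem? {a b c : List Sym} {s : Sym} (hs : s = .comma ∨ s = .semicolon)
    (hb : ∀ t ∈ b, t = .zero ∨ t = .one) {x : ℕ} :
    RowHas (a ++ s :: (b ++ c)) (a.length + 1 + b.length) x ↔ b[x]? = some .one := by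
  set w := a ++ s :: (b ++ c) with hw
  have hsep : w[a.length]? = some s := by simp [hw]
  have hbit : ∀ i < b.length, w[a.length + 1 + i]? = b[i]? := by
    intro i hi
    rw [hw, List.getElem?_append_right (by lia), List.getElem?_cons, if_neg (by lia),
      List.getElem?_append_left (by lia)]
    congr 1
    lia
  have hsep' : IsSep w a.length := by
    rcases hs with rfl | rfl
    exacts [.inl hsep, .inr hsep]
  have hbit' : ∀ i, a.length < i → i < a.length + 1 + b.length → IsBit w i := by
    intro i h₁ h₂
    have h := hbit (i - (a.length + 1)) (by lia)
    rw [show a.length + 1 + (i - (a.length + 1)) = i by lia,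
      List.getElem?_eq_getElem (l := b) (by lia)] at h
    rcases hb _ (List.getElem_mem (l := b) (n := i - (a.length + 1)) (by lia)) with hb | hb
    · exact .inl (by rw [h, hb])
    · exact .inr (by rw [h, hb])
  have hne : ∀ i, IsSep w i → ¬ IsBit w i := by
    rintro i (h | h) (h' | h') <;> simp [h] at h'
  constructor
  · rintro ⟨q, hqp, hq, ⟨r, hr, hrs, hrb⟩, hsq⟩
    have h₁ : a.length < q := by
      rcases lt_trichotomy q a.length with h | h | h
      · exact (hsq _ h (by lia) hsep').elim
      · exact (hne q (h ▸ hsep') (.inr hq)).elim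
      · exact h
    have h₂ : r = a.length := by
      rcases lt_trichotomy r a.length with h | h | h
      · exact (hne _ hsep' (hrb _ h h₁.le)).elim
      · exact h
      · exact (hne r hrs (hbit' r h (by lia))).elim
    rw [← hbit x (by lia), ← hq]
    congr 1
    lia
  · intro hx
    have hxb : x < b.length := (List.getElem?_eq_some_iff.1 hx).1
    refine ⟨a.length + 1 + x, by lia, by rw [hbit x hxb, hx],
      ⟨a.length, by lia, hsep', fun i h₁ h₂ => hbit' i h₁ (by lia)⟩, fun i h₁ h₂ h => ?_⟩
    exact hne i h (hbit' i (by lia) h₂)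

theorem rowHas_rows {a c : List Sym} {L' L'' : List (Finset (Fin n))} {h : Finset (Fin n)}
    {x : ℕ} : RowHas (a ++ .semicolon :: (rows (L' ++ h :: L'') ++ c))
      (a.length + 1 + ((rows L').length + n)) x ↔ ∃ X ∈ h, (X : ℕ) = x := by
  obtain ⟨a', s, hs, ha⟩ : ∃ a' s, (s = Sym.comma ∨ s = .semicolon) ∧
      a ++ .semicolon :: rows L' = a' ++ [s] := by
    rcases List.eq_nil_or_concat L' with rfl | ⟨L', h', rfl⟩
    · exact ⟨a, .semicolon, .inr rfl, by simp⟩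
    · refine ⟨a ++ .semicolon :: (rows L' ++ bits h'), .comma, .inl rfl, ?_⟩
      simp [rows, encodeRow_eq]
  have h₁ : a ++ .semicolon :: (rows (L' ++ h :: L'') ++ c) =
      a' ++ s :: (bits h ++ .comma :: (rows L'' ++ c)) := by
    have := congrArg (· ++ (bits h ++ .comma :: (rows L'' ++ c))) ha
    simpa [rows, encodeRow_eq] using this
  have h₂ : a.length + 1 + ((rows L').length + n) = a'.length + 1 + (bits h).length := by
    have := congrArg List.length ha
    simp only [List.length_append, List.length_cons, List.length_nil] at this
    rw [length_bits]
    lia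
  rw [h₁, h₂, rowHas_iff_getElem? hs fun t => mem_bits, getElem?_bits_eq_one]

end

section

variable (I : Instance)

theorem Instance.encode_eq : I.encode = List.replicate I.n .one ++
    .semicolon :: (rows I.edges₁ ++ .semicolon :: rows I.edges₂) := by
  simp [encode]

theorem Instance.length_encode :
    I.encode.length = I.n + 1 + (rows I.edges₁).length + 1 + (rows I.edges₂).length := by
  rw [encode_eq]
  simp only [List.length_append, List.length_cons, List.length_replicate]
  lia

theorem Instance.getElem?_encode (i : ℕ) : I.encode[i]? =
    if i < I.n then some .one else if i = I.n then some .semicolon else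
    if i < I.n + 1 + (rows I.edges₁).length then (rows I.edges₁)[i - (I.n + 1)]? else
    if i = I.n + 1 + (rows I.edges₁).length then some .semicolon else
      (rows I.edges₂)[i - (I.n + 1 + (rows I.edges₁).length + 1)]? := by
  rw [encode_eq, List.getElem?_append, List.length_replicate, List.getElem?_cons,
    List.getElem?_append, List.getElem?_cons]
  split_ifs <;> first | lia | skip
  rw [List.getElem?_replicate, if_pos ‹_›]

theorem Instance.getElem?_encode_eq_semicolon {i : ℕ} : I.encode[i]? = some .semicolon ↔
    i = I.n ∨ i = I.n + 1 + (rows I.edges₁).length := by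
  rw [getElem?_encode]
  split_ifs with h₁ h₂ h₃ h₄
  · exact iff_of_false (by simp) (by lia)
  · exact iff_of_true rfl (.inl h₂)
  · exact iff_of_false (fun h => semicolon_notMem_rows _ (List.mem_of_getElem? h)) (by lia)
  · exact iff_of_true rfl (.inr h₄)
  · exact iff_of_false (fun h => semicolon_notMem_rows _ (List.mem_of_getElem? h)) (by lia)

theorem Instance.isSecond_iff {p : ℕ} : IsSecond I.encode p ↔
    I.encode[p]? = some .comma ∧ I.n + 1 + (rows I.edges₁).length < p := by
  refine and_congr_right fun _ => ?_
  simp only [getElem?_encode_eq_semicolon]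
  constructor
  · rintro ⟨i, j, h₁, h₂, h₃, h₄⟩
    lia
  · exact fun h => ⟨_, _, by lia, h, .inl rfl, .inr rfl⟩

theorem Instance.isSecond_iff_exists {p : ℕ} : IsSecond I.encode p ↔
    ∃ L' h L'', I.edges₂ = L' ++ h :: L'' ∧
      p = I.n + 1 + (rows I.edges₁).length + 1 + ((rows L').length + I.n) := by
  rw [isSecond_iff, getElem?_encode]
  constructor
  · rintro ⟨h, hp⟩
    rw [if_neg (by lia), if_neg (by lia), if_neg (by lia), if_neg (by lia),
      getElem?_rows_eq_comma] at h
    obtain ⟨L', h, L'', hL, h'⟩ := h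
    exact ⟨L', h, L'', hL, by lia⟩
  · rintro ⟨L', h, L'', hL, rfl⟩
    rw [if_neg (by lia), if_neg (by lia), if_neg (by lia), if_neg (by lia), getElem?_rows_eq_comma]
    exact ⟨⟨L', h, L'', hL, by lia⟩, by lia⟩

theorem Instance.isFirst_iff_exists {p : ℕ} : IsFirst I.encode p ↔
    ∃ L' h L'', I.edges₁ = L' ++ h :: L'' ∧ p = I.n + 1 + ((rows L').length + I.n) := by
  have : IsFirst I.encode p ↔ I.encode[p]? = some .comma ∧
      p ≤ I.n + 1 + (rows I.edges₁).length := by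
    rw [IsFirst, isSecond_iff]
    exact and_congr_right fun h => by simp [h]
  rw [this, getElem?_encode]
  constructor
  · rintro ⟨h, hp⟩
    split_ifs at h
    · simp at h
    · simp at h
    · obtain ⟨L', h, L'', hL, h'⟩ := getElem?_rows_eq_comma.1 h
      exact ⟨L', h, L'', hL, by lia⟩
    · simp at h
    · lia
  · rintro ⟨L', h, L'', hL, rfl⟩
    have hc : (rows I.edges₁)[(rows L').length + I.n]? = some .comma :=
      getElem?_rows_eq_comma.2 ⟨L', h, L'', hL, rfl⟩
    have := (List.getElem?_eq_some_iff.1 hc).1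
    rw [if_neg (by lia), if_neg (by lia), if_pos (by lia)]
    exact ⟨by rw [← hc]; congr 1; lia, by lia⟩

theorem Instance.rowHas_iff_of_isFirst {p : ℕ} {L' L'' : List (Finset (Fin I.n))}
    {h : Finset (Fin I.n)} (hL : I.edges₁ = L' ++ h :: L'')
    (hp : p = I.n + 1 + ((rows L').length + I.n)) {x : ℕ} :
    RowHas I.encode p x ↔ ∃ X ∈ h, (X : ℕ) = x := by
  rw [encode_eq, hL, hp, ← rowHas_rows (a := List.replicate I.n .one)
    (c := .semicolon :: rows I.edges₂) (L' := L') (L'' := L''), List.length_replicate]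

theorem Instance.rowHas_iff_of_isSecond {p : ℕ} {L' L'' : List (Finset (Fin I.n))}
    {h : Finset (Fin I.n)} (hL : I.edges₂ = L' ++ h :: L'')
    (hp : p = I.n + 1 + (rows I.edges₁).length + 1 + ((rows L').length + I.n)) {x : ℕ} :
    RowHas I.encode p x ↔ ∃ X ∈ h, (X : ℕ) = x := by
  rw [encode_eq, hL, hp, ← rowHas_rows (a := List.replicate I.n .one ++ .semicolon :: rows I.edges₁)
    (c := []) (L' := L') (L'' := L'')]
  simp only [List.append_assoc, List.cons_append, List.append_nil, List.length_append,
    List.length_replicate, List.length_cons]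
  rw [show I.n + ((rows I.edges₁).length + 1) = I.n + 1 + (rows I.edges₁).length by lia]

/-- The encoding of an input represents its pair of hypergraphs. -/
theorem Instance.codes : Codes I.encode I.H₁ I.H₂ where
  lt_of_rowHas {p x} hp hx := by
    by_cases hs : IsSecond I.encode p
    · obtain ⟨L', h, L'', hL, hp⟩ := I.isSecond_iff_exists.1 hs
      obtain ⟨X, -, rfl⟩ := (I.rowHas_iff_of_isSecond hL hp).1 hx
      exact X.2
    · obtain ⟨L', h, L'', hL, hp⟩ := I.isFirst_iff_exists.1 ⟨hp, hs⟩
      obtain ⟨X, -, rfl⟩ := (I.rowHas_iff_of_isFirst hL hp).1 hx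
      exact X.2
  lt_length := by
    rw [length_encode]
    lia
  mem_edgeSet₁ {e} := by
    constructor
    · rintro ⟨h, hh, rfl⟩
      obtain ⟨L', L'', hL⟩ := List.append_of_mem hh
      refine ⟨_, I.isFirst_iff_exists.2 ⟨L', h, L'', hL, rfl⟩, Set.ext fun x => ?_⟩
      exact (I.rowHas_iff_of_isFirst hL rfl).trans (by simp [Fin.val_inj])
    · rintro ⟨p, hp, rfl⟩
      obtain ⟨L', h, L'', hL, hp⟩ := I.isFirst_iff_exists.1 hp
      refine ⟨h, by simp [hL], Set.ext fun x => ?_⟩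
      exact ((I.rowHas_iff_of_isFirst hL hp).trans (by simp [Fin.val_inj])).symm
  mem_edgeSet₂ {e} := by
    constructor
    · rintro ⟨h, hh, rfl⟩
      obtain ⟨L', L'', hL⟩ := List.append_of_mem hh
      refine ⟨_, I.isSecond_iff_exists.2 ⟨L', h, L'', hL, rfl⟩, Set.ext fun x => ?_⟩
      exact (I.rowHas_iff_of_isSecond hL rfl).trans (by simp [Fin.val_inj])
    · rintro ⟨p, hp, rfl⟩
      obtain ⟨L', h, L'', hL, hp⟩ := I.isSecond_iff_exists.1 hp
      refine ⟨h, by simp [hL], Set.ext fun x => ?_⟩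
      exact ((I.rowHas_iff_of_isSecond hL hp).trans (by simp [Fin.val_inj])).symm
  exists_edge := by
    rintro x ⟨h, hh, hx⟩
    exact ⟨h, ⟨h, hh, rfl⟩, hx⟩

end

end RobberCaptain

theorem theorem3p5 :
    Nonempty (Turing.TM2ComputableInPolyTime
      RobberCaptain.Instance.encode Computability.encodeBool RobberCaptain.Instance.answer) := by
  refine StackProgram.nonempty_tm2ComputableInPolyTime _ _ RobberCaptain.program
    RobberCaptain.answerFm 4 RobberCaptain.wf_program RobberCaptain.wf_answerFm
    (fun I h => ?_) fun I => ?_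
  · have := I.length_encode
    rw [h, List.length_nil] at this
    lia
  · rw [RobberCaptain.holds_answerFm_iff I.codes]
    exact @decide_eq_true_iff _ (_)
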